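/- \textbf{Setting.} Let $T>0$ and let $\mathcal B,\mathcal B_f,\mathcal B_s\subset\mathbb R^3$ be the closures of bounded open sets. The fluid and the elastic solid move by time-dependent diffeomorphisms $\varphi_f(t):\mathcal B_f\to\mathcal B$, $\varphi_s(t):\mathcal B_s\to\mathcal B$, $0\le t\le T$. All data and unknowns are smooth up to the boundary. For $k=f,s$ put $u_k=\partial_t\varphi_k\circ\varphi_k^{-1}$, $J\varphi_k^{-1}=|\det\nabla\varphi_k^{-1}|$, $\rho_k=(\rho_k^0\circ\varphi_k^{-1})J\varphi_k^{-1}$ with $\rho_k^0>0$, and let $b=(\nabla\varphi_s\nabla\varphi_s^{\mathsf T})\circ\varphi_s^{-1}$ be the Finger tensor. The pore volume fraction is $\phi$, $0<\phi<1$; $s_f,s_s$ are the entropy densities, $\eta^{\rm sp}_k=s_k/\rho_k$ the specific entropies, and $\bar\rho_f=\rho_f/\phi$, $\bar\rho_s=\rho_s/(1-\phi)$. Write $\bar D^k_tg=\partial_tg+\operatorname{div}(gu_k)$, $D^k_tg=\partial_tg+u_k\cdot\nabla g$, $\pounds_um=u\cdot\nabla m+\nabla u^{\mathsf T}m+m\operatorname{div}u$,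 and $\pounds_ub$ for the Lie derivative of a symmetric 2-contravariant tensor. Let $\ell(u_f,u_s,\rho_f,\rho_s,s_f,s_s,b,\phi)$ be a Lagrangian with smooth functional derivatives ($\delta\ell/\delta b$ symmetric). The porous media Lagrangian is $$\ell=\int_{\mathcal B}\Big[\tfrac12\rho_f|u_f|^2-\rho_fe_f\big(\bar\rho_f,\tfrac{s_f}{\rho_f}\big)+\tfrac12\rho_s|u_s|^2-\rho_se_s\big(\bar\rho_s,\tfrac{s_s}{\rho_s},b\big)\Big]d^3x ,$$ with smooth energies $e_f$ on $\{\bar\rho_f>0\}$ and $e_s$ on $\{\bar\rho_s>0,\ b \text{ positive definite}\}$; put $\sigma_{\rm el}=2\rho_s\frac{\partial e_s}{\partial b}\cdot b$, $T_k=\partial e_k/\partial\eta^{\rm sp}_k$. \textbf{Constraint terms.} Let $\phi_f^0,\phi^0_s$ be the reference pore volume fractions on $\mathcal B_f$, $\mathcal B_s$ (both are $\phi^0$ when the reference configurations are identified). To $\ell$ one adds $$\int_{\mathcal B}\mu_f\big(\phi-(\phi_f^0\circ\varphi_f^{-1})J\varphi_f^{-1}\big)d^3x\ +\ \int_{\mathcal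 B}\mu_s\big((1-\phi)-((1-\phi_s^0)\circ\varphi_s^{-1})J\varphi_s^{-1}\big)d^3x ,$$ where the second term is present only if the solid is incompressible as well; if only the fluid is incompressible, $\mu_s$ is read as $0$ below. Variations are induced by smooth families of configurations $(\varphi_f,\varphi_s,\phi,\mu_f,\mu_s)$ with $\eta_k=\delta\varphi_k\circ\varphi_k^{-1}$ vanishing at $t=0,T$, while $\delta\phi,\delta\mu_f,\delta\mu_s$ are free. One of four classes is fixed: free slip ($\varphi_k$ maps onto $\mathcal B$, no further condition), no slip ($\eta_f=\eta_s=0$ on $\partial\mathcal B$), no slip of the solid only ($\eta_s=0$ on $\partial\mathcal B$), or interior variations ($\eta_f,\eta_s$, and below also $\delta\gamma_k$, supported in a compact subset of $(0,T)\times\operatorname{int}\mathcal B$). The equations below are meant in $(0,T)\times\operatorname{int}\mathcal B$. \textbf{(A)} For every such family, $\delta\big((\phi_f^0\circ\varphi_f^{-1})J\varphi_f^{-1}\big)=-\operatorname{div}\big((\phi_f^0\circ\varphi_f^{-1})J\varphi_f^{-1}\,\eta_f\big)$, which is $-\operatorname{div}(\phi\,\eta_f)$ when the fluid constraint holds; likewise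 for $((1-\phi_s^0)\circ\varphi_s^{-1})J\varphi_s^{-1}$ with $\eta_s$, which gives $-\operatorname{div}((1-\phi)\eta_s)$ when the solid constraint holds. \textbf{(B) Advected entropies.} Let $s_k=(s_k^0\circ\varphi_k^{-1})J\varphi_k^{-1}$ and let $f_f,f_s$ be given force fields. If $$\delta\int_0^T\big[\ell+\text{constraint terms}\big]dt+\int_0^T\!\!\int_{\mathcal B}(f_f\cdot\eta_f+f_s\cdot\eta_s)\,d^3x\,dt=0$$ for one of the four classes of variations, then $$\begin{aligned}&\partial_t\tfrac{\delta\ell}{\delta u_f}+\pounds_{u_f}\tfrac{\delta\ell}{\delta u_f}=\rho_f\nabla\tfrac{\delta\ell}{\delta\rho_f}+s_f\nabla\tfrac{\delta\ell}{\delta s_f}-\phi\nabla\mu_f+f_f,\\ &\partial_t\tfrac{\delta\ell}{\delta u_s}+\pounds_{u_s}\tfrac{\delta\ell}{\delta u_s}=\rho_s\nabla\tfrac{\delta\ell}{\delta\rho_s}+s_s\nabla\tfrac{\delta\ell}{\delta s_s}-(1-\phi)\nabla\mu_s-\tfrac{\delta\ell}{\delta b}:\nabla b-2\operatorname{div}\big(\tfrac{\delta\ell}{\delta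 b}\cdot b\big)+f_s,\\ &\partial_t\rho_k+\operatorname{div}(\rho_ku_k)=0,\quad\partial_ts_k+\operatorname{div}(s_ku_k)=0,\quad\partial_tb+\pounds_{u_s}b=0,\quad\tfrac{\delta\ell}{\delta\phi}+\mu_f-\mu_s=0,\end{aligned}$$ together with $\phi=(\phi_f^0\circ\varphi_f^{-1})J\varphi_f^{-1}$ and $\partial_t\phi+\operatorname{div}(\phi u_f)=0$, and, if the solid is incompressible too, $1-\phi=((1-\phi_s^0)\circ\varphi_s^{-1})J\varphi_s^{-1}$ and $\partial_t(1-\phi)+\operatorname{div}((1-\phi)u_s)=0$. For the porous media Lagrangian (whose functional derivatives are the partial derivatives of its integrand) this becomes the system of the compressible case, $$\begin{aligned}&\rho_f(\partial_tu_f+u_f\cdot\nabla u_f)=-\phi\nabla p+f_f,\\ &\rho_s(\partial_tu_s+u_s\cdot\nabla u_s)=-(1-\phi)\nabla p+\operatorname{div}\sigma_{\rm el}+f_s,\\ &\partial_t\rho_k+\operatorname{div}(\rho_ku_k)=0,\quad\partial_ts_k+\operatorname{div}(s_ku_k)=0,\quad\partial_tb+\pounds_{u_s}b=0,\end{aligned}$$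 together with the same constraints and transport equations for $\phi$ (and $1-\phi$), and with the pressure condition $$p=\bar\rho_f^2\frac{\partial e_f}{\partial\bar\rho_f}+\mu_f=\bar\rho_s^2\frac{\partial e_s}{\partial\bar\rho_s}+\mu_s .$$ Conversely, in both cases, the system implies stationarity with respect to interior variations. \textbf{(C) Irreversible processes.} Now $s_k$ are unknowns, and so are $\sigma_k$ and $\gamma_k$. Let friction forces $f_k$, friction stresses $\tau_k$ and fluxes $J_{fs}=J_{sf}=-J_{ff}=-J_{ss}$ be given smooth fields, and assume $\delta\ell/\delta s_k\ne0$ (for the porous media Lagrangian: $T_k\neq0$). The principle is $$\delta\int_0^T\Big[\ell+\text{constraint terms}+\sum_k\int_{\mathcal B}(s_k-\sigma_k)D^k_t\gamma_k\,d^3x\Big]dt=0,$$ subject to $\frac{\delta\ell}{\delta s_k}\bar D^k_t\sigma_k=f_k\cdot u_k-\tau_k:\nabla u_k+\sum_lJ_{kl}D^l_t\gamma_l$ on the solution, and to $\frac{\delta\ell}{\delta s_k}(\delta\sigma_k+\operatorname{div}(\sigma_k\eta_k))=f_k\cdot\eta_k-\tau_k:\nabla\eta_k+\sum_lJ_{kl}(\delta\gamma_l+\eta_l\cdot\nabla\gamma_l)$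 on the variations, with $\delta s_k$ free and $\eta_k,\delta\gamma_k$ vanishing at $t=0,T$. If it holds for one of the four classes, then the equations of (B) hold, for a general Lagrangian, with $f_k$ replaced by $\operatorname{div}\tau_k+f_k$ in the momentum equations and with the entropy equations replaced by $$\tfrac{\delta\ell}{\delta s_f}\bar D^f_ts_f=f_f\cdot u_f-\tau_f:\nabla u_f-J_{fs}\big(\tfrac{\delta\ell}{\delta s_s}-\tfrac{\delta\ell}{\delta s_f}\big),\qquad\tfrac{\delta\ell}{\delta s_s}\bar D^s_ts_s=f_s\cdot u_s-\tau_s:\nabla u_s-J_{sf}\big(\tfrac{\delta\ell}{\delta s_f}-\tfrac{\delta\ell}{\delta s_s}\big),$$ together with $\bar D^k_t\sigma_k=\bar D^k_ts_k$ and $D^k_t\gamma_k=-\delta\ell/\delta s_k$. For the porous media Lagrangian this becomes $$\begin{aligned}&\rho_f(\partial_tu_f+u_f\cdot\nabla u_f)=-\phi\nabla p+\operatorname{div}\tau_f+f_f,\\ &\rho_s(\partial_tu_s+u_s\cdot\nabla u_s)=-(1-\phi)\nabla p+\operatorname{div}(\sigma_{\rm el}+\tau_s)+f_s,\\ &T_f\bar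 D^f_ts_f=-f_f\cdot u_f+\tau_f:\nabla u_f-J_{fs}(T_s-T_f),\\ &T_s\bar D^s_ts_s=-f_s\cdot u_s+\tau_s:\nabla u_s-J_{sf}(T_f-T_s),\end{aligned}$$ with the equations for $\rho_k$ and $b$, the constraints and transport equations for $\phi$ (and $1-\phi$) and the pressure condition of (B), and $\bar D^k_t\sigma_k=\bar D^k_ts_k$, $D^k_t\gamma_k=T_k$. Conversely, in both cases, the system implies the principle for interior variations. -/

import Mathlib

open Set MeasureTheory
open scoped ContDiff

namespace PorousMedia

noncomputable section

/-! ## Calculus on three-dimensional space -/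

/-- Physical space with its Euclidean norm. -/
abbrev Space := EuclideanSpace ℝ (Fin 3)

/-- Components of a two-index tensor. -/
abbrev Tensor := Fin 3 → Fin 3 → ℝ

/-- The partial derivative `∂f/∂xⁱ` at `x`. -/
def pd (i : Fin 3) (f : Space → ℝ) (x : Space) : ℝ :=
  fderiv ℝ f x (EuclideanSpace.single i 1)

/-- Divergence of a vector field. -/
def divv (v : Space → Space) (x : Space) : ℝ := ∑ i, pd i (fun y => v y i) x

/-- Divergence of a tensor field, `(div S)ᵢ = ∑ⱼ ∂ⱼ Sᵢⱼ`. -/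
def divT (S : Space → Tensor) (x : Space) : Space :=
  WithLp.toLp 2 (fun i => ∑ j, pd j (fun y => S y i j) x)

/-- `(u · ∇) v`. -/
def advect (u v : Space → Space) (x : Space) : Space := fderiv ℝ v x (u x)

/-- Lie derivative of a momentum density:
`(£ᵤ m)ᵢ = uʲ ∂ⱼ mᵢ + mⱼ ∂ᵢ uʲ + mᵢ ∂ⱼ uʲ`. -/
def lieMomentum (u m : Space → Space) (x : Space) : Space :=
  WithLp.toLp 2 (fun i =>
    (∑ j, u x j * pd j (fun y => m y i) x) + (∑ j, m x j * pd i (fun y => u y j) x)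
      + m x i * divv u x)

/-- Lie derivative of a symmetric two-contravariant tensor field:
`(£ᵤ b)ⁱʲ = uᵏ ∂ₖ bⁱʲ - bᵏʲ ∂ₖ uⁱ - bⁱᵏ ∂ₖ uʲ`. -/
def lieTensor (u : Space → Space) (b : Space → Tensor) (x : Space) : Tensor := fun i j =>
  ∑ k, (u x k * pd k (fun y => b y i j) x - b x k j * pd k (fun y => u y i) x
    - b x i k * pd k (fun y => u y j) x)

/-- The product `A · B` of two tensors. -/
def tmul (A B : Tensor) : Tensor := fun i k => ∑ j, A i j * B j k

/-- The full contraction `A : B`. -/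
def contract (A B : Tensor) : ℝ := ∑ i, ∑ j, A i j * B i j

/-- The velocity gradient, `(∇u)ᵢⱼ = ∂ⱼ uⁱ`. -/
def gradV (u : Space → Space) (x : Space) : Tensor := fun i j => pd j (fun y => u y i) x

/-- The covector `P : ∇b`, with components `∑ⱼₖ Pⱼₖ ∂ᵢ bʲᵏ`. -/
def contractGrad (P : Tensor) (b : Space → Tensor) (x : Space) : Space :=
  WithLp.toLp 2 (fun i => contract P (fun j k => pd i (fun y => b y j k) x))

/-! ## Smoothness up to the boundary

A function is smooth on a compact domain when it is given by a function that is smooth near each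
point of it. -/

/-- `f (t, x)` is smooth on `[0, T] × closure Ω`. -/
def SmoothST {V : Type*} [NormedAddCommGroup V] [NormedSpace ℝ V] (T : ℝ) (Ω : Set Space)
    (f : ℝ → Space → V) : Prop :=
  ∀ t ∈ Icc 0 T, ∀ x ∈ closure Ω, ContDiffAt ℝ ∞ (fun p : ℝ × Space => f p.1 p.2) (t, x)

/-- `f (ε, t, x)` is smooth on `(-a, a) × [0, T] × closure Ω`. -/
def SmoothEST {V : Type*} [NormedAddCommGroup V] [NormedSpace ℝ V] (a T : ℝ) (Ω : Set Space)
    (f : ℝ → ℝ → Space → V) : Prop :=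
  ∀ ε ∈ Ioo (-a) a, ∀ t ∈ Icc 0 T, ∀ x ∈ closure Ω,
    ContDiffAt ℝ ∞ (fun p : ℝ × ℝ × Space => f p.1 p.2.1 p.2.2) (ε, t, x)

/-! ## Eulerian states, Lagrangians and functional derivatives -/

/-- The Eulerian variables at one instant: velocities, mass densities and entropy densities (per
unit volume of the mixture) of the fluid and of the solid, Finger tensor of the solid, pore volume
fraction.  The same structure also collects the functional derivatives of a Lagrangian with
respect to these variables. -/
structure Fields where
  uf : Space → Space
  us : Space → Space
  ρf : Space → ℝ
  ρs : Space → ℝ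
  sf : Space → ℝ
  ss : Space → ℝ
  b : Space → Tensor
  φ : Space → ℝ

/-- Positive densities, volume fraction strictly between 0 and 1, symmetric positive definite
Finger tensor. -/
structure Fields.IsPhysical (Ω : Set Space) (F : Fields) : Prop where
  ρf_pos : ∀ x ∈ closure Ω, 0 < F.ρf x
  ρs_pos : ∀ x ∈ closure Ω, 0 < F.ρs x
  φ_pos : ∀ x ∈ closure Ω, 0 < F.φ x
  φ_lt_one : ∀ x ∈ closure Ω, F.φ x < 1
  b_symm : ∀ x ∈ closure Ω, ∀ i j, F.b x i j = F.b x j i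
  b_pos : ∀ x ∈ closure Ω, ∀ v : Fin 3 → ℝ, v ≠ 0 → 0 < ∑ i, ∑ j, v i * F.b x i j * v j

/-- A family of field tuples that depends smoothly on `(ε, t, x)`. -/
structure SmoothFamily (a T : ℝ) (Ω : Set Space) (F : ℝ → ℝ → Fields) : Prop where
  uf : SmoothEST a T Ω (fun ε t => (F ε t).uf)
  us : SmoothEST a T Ω (fun ε t => (F ε t).us)
  ρf : SmoothEST a T Ω (fun ε t => (F ε t).ρf)
  ρs : SmoothEST a T Ω (fun ε t => (F ε t).ρs)
  sf : SmoothEST a T Ω (fun ε t => (F ε t).sf)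
  ss : SmoothEST a T Ω (fun ε t => (F ε t).ss)
  b : SmoothEST a T Ω (fun ε t => (F ε t).b)
  φ : SmoothEST a T Ω (fun ε t => (F ε t).φ)

/-- The integral over `Ω` of `G · ∂F/∂ε` for a one-parameter family `F` of field tuples. -/
def pairing (Ω : Set Space) (G : Fields) (F : ℝ → Fields) (ε : ℝ) : ℝ :=
  ∫ x in Ω, (inner ℝ (G.uf x) (deriv (fun e => (F e).uf x) ε)
    + inner ℝ (G.us x) (deriv (fun e => (F e).us x) ε)
    + G.ρf x * deriv (fun e => (F e).ρf x) ε + G.ρs x * deriv (fun e => (F e).ρs x) ε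
    + G.sf x * deriv (fun e => (F e).sf x) ε + G.ss x * deriv (fun e => (F e).ss x) ε
    + contract (G.b x) (deriv (fun e => (F e).b x) ε)
    + G.φ x * deriv (fun e => (F e).φ x) ε)

/-- `dl F` collects the functional derivatives `δℓ/δu_f, …, δℓ/δφ` of the functional `l` at `F`:
along every smooth family of physical states the derivative of `l` is the `L²` pairing with `dl`,
and `dl` is again smooth along the family.  The derivative with respect to the symmetric tensor `b`
is symmetric. -/
def IsFunctionalDeriv (T : ℝ) (Ω : Set Space) (l : Fields → ℝ) (dl : Fields → Fields) : Prop :=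
  ∀ (a : ℝ) (F : ℝ → ℝ → Fields), SmoothFamily a T Ω F →
    (∀ ε ∈ Ioo (-a) a, ∀ t ∈ Icc 0 T, (F ε t).IsPhysical Ω) →
    SmoothFamily a T Ω (fun ε t => dl (F ε t)) ∧
    ∀ ε ∈ Ioo (-a) a, ∀ t ∈ Icc 0 T,
      (∀ x ∈ closure Ω, ∀ i j, (dl (F ε t)).b x i j = (dl (F ε t)).b x j i) ∧
      HasDerivAt (fun e => l (F e t)) (pairing Ω (dl (F ε t)) (fun e => F e t) ε) ε

/-! ## Motions of the two media -/

/-- Fixed data: final time, interior `Ω` of the region filled by the medium, interiors of the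
reference configurations of the fluid and the solid, and the reference mass densities, pore
volume fractions and entropy densities.  (The reference entropy densities are used only when
entropy is advected.) -/
structure Setup where
  T : ℝ
  Ω : Set Space
  Ωf : Set Space
  Ωs : Set Space
  ρf0 : Space → ℝ
  ρs0 : Space → ℝ
  φf0 : Space → ℝ
  φs0 : Space → ℝ
  sf0 : Space → ℝ
  ss0 : Space → ℝ
  T_pos : 0 < T
  Ω_open : IsOpen Ω
  Ωf_open : IsOpen Ωf
  Ωs_open : IsOpen Ωs
  Ω_bdd : Bornology.IsBounded Ω
  Ωf_bdd : Bornology.IsBounded Ωf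
  Ωs_bdd : Bornology.IsBounded Ωs
  ρf0_smooth : ∀ X ∈ closure Ωf, ContDiffAt ℝ ∞ ρf0 X
  ρs0_smooth : ∀ X ∈ closure Ωs, ContDiffAt ℝ ∞ ρs0 X
  φf0_smooth : ∀ X ∈ closure Ωf, ContDiffAt ℝ ∞ φf0 X
  φs0_smooth : ∀ X ∈ closure Ωs, ContDiffAt ℝ ∞ φs0 X
  sf0_smooth : ∀ X ∈ closure Ωf, ContDiffAt ℝ ∞ sf0 X
  ss0_smooth : ∀ X ∈ closure Ωs, ContDiffAt ℝ ∞ ss0 X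
  ρf0_pos : ∀ X ∈ closure Ωf, 0 < ρf0 X
  ρs0_pos : ∀ X ∈ closure Ωs, 0 < ρs0 X

/-- `χ t` is, for `0 ≤ t ≤ T`, a diffeomorphism from the closure of `Ω₀` to the closure of `Ω`,
smooth in `(t, X)`, with inverse `ψ t`.  (The identities on the open sets pass to the closures by
continuity.) -/
structure IsMotion (T : ℝ) (Ω₀ Ω : Set Space) (χ ψ : ℝ → Space → Space) : Prop where
  smooth : SmoothST T Ω₀ χ
  smooth_inv : SmoothST T Ω ψ
  mapsTo : ∀ t ∈ Icc 0 T, MapsTo (χ t) Ω₀ Ω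
  mapsTo_inv : ∀ t ∈ Icc 0 T, MapsTo (ψ t) Ω Ω₀
  left_inv : ∀ t ∈ Icc 0 T, LeftInvOn (ψ t) (χ t) Ω₀
  right_inv : ∀ t ∈ Icc 0 T, RightInvOn (ψ t) (χ t) Ω

/-- Eulerian velocity `u(t, x) = ∂ₜχ(t, χ⁻¹(t, x))`. -/
def velocity (χ ψ : ℝ → Space → Space) (t : ℝ) (x : Space) : Space :=
  deriv (fun τ => χ τ (ψ t x)) t

/-- The Eulerian density `(r₀ ∘ χ⁻¹) Jχ⁻¹`, where `Jχ⁻¹ = |det ∇χ⁻¹|` and `ψ = χ⁻¹`. -/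
def pushDensity (ψ : ℝ → Space → Space) (r₀ : Space → ℝ) (t : ℝ) (x : Space) : ℝ :=
  r₀ (ψ t x) * |(fderiv ℝ (ψ t) x).det|

/-- The Finger deformation tensor `b = 𝔽 𝔽ᵀ`, `𝔽 = ∇χ`, in spatial coordinates. -/
def finger (χ ψ : ℝ → Space → Space) (t : ℝ) (x : Space) : Tensor := fun i j =>
  ∑ A, pd A (fun X => χ t X i) (ψ t x) * pd A (fun X => χ t X j) (ψ t x)

/-- The mechanical unknowns: the motions of the fluid and of the solid with their inverses, the
pore volume fraction and the Lagrange multipliers. -/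
structure Config where
  χf : ℝ → Space → Space
  ψf : ℝ → Space → Space
  χs : ℝ → Space → Space
  ψs : ℝ → Space → Space
  φ : ℝ → Space → ℝ
  μf : ℝ → Space → ℝ
  μs : ℝ → Space → ℝ

/-- The motions are time-dependent diffeomorphisms, `0 < φ < 1`, everything is smooth. -/
structure Config.IsAdmissible (D : Setup) (c : Config) : Prop where
  motion_f : IsMotion D.T D.Ωf D.Ω c.χf c.ψf
  motion_s : IsMotion D.T D.Ωs D.Ω c.χs c.ψs
  φ_smooth : SmoothST D.T D.Ω c.φ
  μf_smooth : SmoothST D.T D.Ω c.μf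
  μs_smooth : SmoothST D.T D.Ω c.μs
  φ_pos : ∀ t ∈ Icc 0 D.T, ∀ x ∈ closure D.Ω, 0 < c.φ t x
  φ_lt_one : ∀ t ∈ Icc 0 D.T, ∀ x ∈ closure D.Ω, c.φ t x < 1

def Config.uf (c : Config) : ℝ → Space → Space := velocity c.χf c.ψf

def Config.us (c : Config) : ℝ → Space → Space := velocity c.χs c.ψs

/-- The Eulerian state of a configuration at time `t`, for given entropy densities. -/
def Config.state (D : Setup) (c : Config) (sf ss : ℝ → Space → ℝ) (t : ℝ) : Fields where
  uf := c.uf t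
  us := c.us t
  ρf := pushDensity c.ψf D.ρf0 t
  ρs := pushDensity c.ψs D.ρs0 t
  sf := sf t
  ss := ss t
  b := finger c.χs c.ψs t
  φ := c.φ t

/-- The Eulerian state when each entropy is advected by its own medium. -/
def Config.advState (D : Setup) (c : Config) : ℝ → Fields :=
  c.state D (pushDensity c.ψf D.sf0) (pushDensity c.ψs D.ss0)

/-! ## Incompressibility constraints -/

/-- Which media are incompressible: the fluid only, or both. -/
inductive Incompressible
  | fluid
  | both

/-- The multiplier of the solid constraint; there is none if only the fluid is incompressible. -/
def Incompressible.solid (k : Incompressible) (μs : ℝ → Space → ℝ) : ℝ → Space → ℝ :=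
  match k with
  | .fluid => fun _ _ => 0
  | .both => μs

/-- The Lagrange multiplier terms
`∫ μ_f (φ - (φ⁰ ∘ φ_f⁻¹) Jφ_f⁻¹) + ∫ μ_s ((1-φ) - ((1-φ⁰) ∘ φ_s⁻¹) Jφ_s⁻¹)`,
the second one being present only if the solid is incompressible as well. -/
def constraintTerm (D : Setup) (k : Incompressible) (c : Config) (t : ℝ) : ℝ :=
  (∫ x in D.Ω, c.μf t x * (c.φ t x - pushDensity c.ψf D.φf0 t x))
    + ∫ x in D.Ω, k.solid c.μs t x * ((1 - c.φ t x)
        - pushDensity c.ψs (fun X => 1 - D.φs0 X) t x)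

/-- The incompressibility constraints and the transport equations for the volume fractions. -/
structure VolumeEqs (D : Setup) (k : Incompressible) (c : Config) : Prop where
  constraint_f : ∀ t ∈ Ioo 0 D.T, ∀ x ∈ D.Ω, c.φ t x = pushDensity c.ψf D.φf0 t x
  transport_f : ∀ t ∈ Ioo 0 D.T, ∀ x ∈ D.Ω,
    deriv (fun τ => c.φ τ x) t + divv (fun y => c.φ t y • c.uf t y) x = 0
  constraint_s : k = .both → ∀ t ∈ Ioo 0 D.T, ∀ x ∈ D.Ω,
    1 - c.φ t x = pushDensity c.ψs (fun X => 1 - D.φs0 X) t x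
  transport_s : k = .both → ∀ t ∈ Ioo 0 D.T, ∀ x ∈ D.Ω,
    deriv (fun τ => 1 - c.φ τ x) t + divv (fun y => (1 - c.φ t y) • c.us t y) x = 0

/-! ## Variations -/

/-- `η_f = δφ_f ∘ φ_f⁻¹` for a family of configurations. -/
def etaF (c : ℝ → Config) (t : ℝ) (x : Space) : Space :=
  deriv (fun ε => (c ε).χf t ((c 0).ψf t x)) 0

/-- `η_s = δφ_s ∘ φ_s⁻¹` for a family of configurations. -/
def etaS (c : ℝ → Config) (t : ℝ) (x : Space) : Space :=
  deriv (fun ε => (c ε).χs t ((c 0).ψs t x)) 0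

/-- A smooth variation: a smooth family of admissible configurations such that the variations of
the two motions vanish at `t = 0` and `t = T`. -/
structure IsVariation (D : Setup) (a : ℝ) (c : ℝ → Config) : Prop where
  a_pos : 0 < a
  admissible : ∀ ε ∈ Ioo (-a) a, (c ε).IsAdmissible D
  χf_smooth : SmoothEST a D.T D.Ωf (fun ε => (c ε).χf)
  ψf_smooth : SmoothEST a D.T D.Ω (fun ε => (c ε).ψf)
  χs_smooth : SmoothEST a D.T D.Ωs (fun ε => (c ε).χs)
  ψs_smooth : SmoothEST a D.T D.Ω (fun ε => (c ε).ψs)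
  φ_smooth : SmoothEST a D.T D.Ω (fun ε => (c ε).φ)
  μf_smooth : SmoothEST a D.T D.Ω (fun ε => (c ε).μf)
  μs_smooth : SmoothEST a D.T D.Ω (fun ε => (c ε).μs)
  ends_f : ∀ x ∈ closure D.Ω, etaF c 0 x = 0 ∧ etaF c D.T x = 0
  ends_s : ∀ x ∈ closure D.Ω, etaS c 0 x = 0 ∧ etaS c D.T x = 0

/-- `g` vanishes outside a compact subset of `(0, T) × Ω`. -/
def SupportedInside {V : Type*} [Zero V] (D : Setup) (g : ℝ → Space → V) : Prop :=
  ∃ K : Set (ℝ × Space), IsCompact K ∧ K ⊆ Ioo 0 D.T ×ˢ D.Ω ∧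
    ∀ t ∈ Icc 0 D.T, ∀ x ∈ closure D.Ω, (t, x) ∉ K → g t x = 0

/-- Classes of variations: free slip, no slip for both media, no slip for the solid only, and
variations supported in the interior. -/
inductive VariationClass
  | freeSlip
  | noSlip
  | noSlipSolid
  | interior

/-- Restrictions on `η_f, η_s`.  Under free slip none is needed: a family of diffeomorphisms of
the closed domains has variations tangent to the boundary. -/
def VariationClass.Allows (bc : VariationClass) (D : Setup) (ηf ηs : ℝ → Space → Space) : Prop :=
  match bc with
  | .freeSlip => True
  | .noSlip => ∀ t ∈ Icc 0 D.T, ∀ x ∈ frontier D.Ω, ηf t x = 0 ∧ ηs t x = 0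
  | .noSlipSolid => ∀ t ∈ Icc 0 D.T, ∀ x ∈ frontier D.Ω, ηs t x = 0
  | .interior => SupportedInside D ηf ∧ SupportedInside D ηs

/-! ## The variational principle without irreversible processes -/

/-- The action with Lagrange multiplier terms. -/
def action (D : Setup) (k : Incompressible) (l : Fields → ℝ) (c : Config) : ℝ :=
  ∫ t in (0 : ℝ)..D.T, (l (c.advState D t) + constraintTerm D k c t)

/-- The Lagrange-d'Alembert principle `δS + ∫∫ (f_f · η_f + f_s · η_s) = 0`, with free
variations of the motions, of `φ` and of the multipliers. -/
def IsCritical (D : Setup) (k : Incompressible) (bc : VariationClass) (l : Fields → ℝ)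
    (ff fs : ℝ → Space → Space) (c₀ : Config) : Prop :=
  ∀ (a : ℝ) (c : ℝ → Config), IsVariation D a c → c 0 = c₀ →
    bc.Allows D (etaF c) (etaS c) →
    HasDerivAt (fun ε => action D k l (c ε))
      (-∫ t in (0 : ℝ)..D.T, ∫ x in D.Ω,
        (inner ℝ (ff t x) (etaF c t x) + inner ℝ (fs t x) (etaS c t x))) 0

/-! ## The variational principle of nonequilibrium thermodynamics -/

/-- The unknowns with irreversible processes: in addition the entropy densities `s_k`, the
entropies `σ_k` generated by the irreversible processes and the thermal displacements `γ_k`. -/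
structure ThermoConfig extends Config where
  sf : ℝ → Space → ℝ
  ss : ℝ → Space → ℝ
  σf : ℝ → Space → ℝ
  σs : ℝ → Space → ℝ
  γf : ℝ → Space → ℝ
  γs : ℝ → Space → ℝ

structure ThermoConfig.IsAdmissible (D : Setup) (c : ThermoConfig) : Prop where
  config : c.toConfig.IsAdmissible D
  sf_smooth : SmoothST D.T D.Ω c.sf
  ss_smooth : SmoothST D.T D.Ω c.ss
  σf_smooth : SmoothST D.T D.Ω c.σf
  σs_smooth : SmoothST D.T D.Ω c.σs
  γf_smooth : SmoothST D.T D.Ω c.γf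
  γs_smooth : SmoothST D.T D.Ω c.γs

def ThermoConfig.thermoState (D : Setup) (c : ThermoConfig) : ℝ → Fields :=
  c.toConfig.state D c.sf c.ss

/-- `D_t g = ∂ₜ g + u · ∇g`. -/
def Dt (u : ℝ → Space → Space) (g : ℝ → Space → ℝ) (t : ℝ) (x : Space) : ℝ :=
  deriv (fun τ => g τ x) t + inner ℝ (u t x) (gradient (g t) x)

/-- `D̄_t g = ∂ₜ g + div (g u)`. -/
def Dbar (u : ℝ → Space → Space) (g : ℝ → Space → ℝ) (t : ℝ) (x : Space) : ℝ :=
  deriv (fun τ => g τ x) t + divv (fun y => g t y • u t y) x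

/-- `D_δ g = δg + η · ∇g` for a family `g ε`. -/
def Ddelta (η : ℝ → Space → Space) (g : ℝ → ℝ → Space → ℝ) (t : ℝ) (x : Space) : ℝ :=
  deriv (fun ε => g ε t x) 0 + inner ℝ (η t x) (gradient (g 0 t) x)

/-- `D̄_δ g = δg + div (g η)` for a family `g ε`. -/
def DdeltaBar (η : ℝ → Space → Space) (g : ℝ → ℝ → Space → ℝ) (t : ℝ) (x : Space) : ℝ :=
  deriv (fun ε => g ε t x) 0 + divv (fun y => g 0 t y • η t y) x

/-- Friction forces and friction stresses on the two media, and the heat exchange flux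
`J = J_fs = J_sf`, so that `J_ff = J_ss = -J`. -/
structure Friction where
  ff : ℝ → Space → Space
  fs : ℝ → Space → Space
  τf : ℝ → Space → Tensor
  τs : ℝ → Space → Tensor
  J : ℝ → Space → ℝ

structure Friction.IsSmooth (D : Setup) (R : Friction) : Prop where
  ff : SmoothST D.T D.Ω R.ff
  fs : SmoothST D.T D.Ω R.fs
  τf : SmoothST D.T D.Ω R.τf
  τs : SmoothST D.T D.Ω R.τs
  J : SmoothST D.T D.Ω R.J

/-- The phenomenological constraints
`(δℓ/δs_k) D̄_t σ_k = f_k · u_k - τ_k : ∇u_k + ∑ₗ J_kl D_t γ_l`. -/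
structure PhenomenologicalConstraint (D : Setup) (dl : Fields → Fields) (R : Friction)
    (c : ThermoConfig) : Prop where
  fluid : ∀ t ∈ Ioo 0 D.T, ∀ x ∈ D.Ω,
    (dl (c.thermoState D t)).sf x * Dbar c.uf c.σf t x
      = inner ℝ (R.ff t x) (c.uf t x) - contract (R.τf t x) (gradV (c.uf t) x)
        + ((-R.J t x) * Dt c.uf c.γf t x + R.J t x * Dt c.us c.γs t x)
  solid : ∀ t ∈ Ioo 0 D.T, ∀ x ∈ D.Ω,
    (dl (c.thermoState D t)).ss x * Dbar c.us c.σs t x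
      = inner ℝ (R.fs t x) (c.us t x) - contract (R.τs t x) (gradV (c.us t) x)
        + (R.J t x * Dt c.uf c.γf t x + (-R.J t x) * Dt c.us c.γs t x)

def thermoEtaF (c : ℝ → ThermoConfig) : ℝ → Space → Space := etaF (fun ε => (c ε).toConfig)

def thermoEtaS (c : ℝ → ThermoConfig) : ℝ → Space → Space := etaS (fun ε => (c ε).toConfig)

/-- The variational constraints
`(δℓ/δs_k) D̄_δ σ_k = f_k · η_k - τ_k : ∇η_k + ∑ₗ J_kl D_δ γ_l`. -/
structure VariationalConstraint (D : Setup) (dl : Fields → Fields) (R : Friction)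
    (c : ℝ → ThermoConfig) : Prop where
  fluid : ∀ t ∈ Ioo 0 D.T, ∀ x ∈ D.Ω,
    (dl ((c 0).thermoState D t)).sf x * DdeltaBar (thermoEtaF c) (fun ε => (c ε).σf) t x
      = inner ℝ (R.ff t x) (thermoEtaF c t x) - contract (R.τf t x) (gradV (thermoEtaF c t) x)
        + ((-R.J t x) * Ddelta (thermoEtaF c) (fun ε => (c ε).γf) t x
          + R.J t x * Ddelta (thermoEtaS c) (fun ε => (c ε).γs) t x)
  solid : ∀ t ∈ Ioo 0 D.T, ∀ x ∈ D.Ω,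
    (dl ((c 0).thermoState D t)).ss x * DdeltaBar (thermoEtaS c) (fun ε => (c ε).σs) t x
      = inner ℝ (R.fs t x) (thermoEtaS c t x) - contract (R.τs t x) (gradV (thermoEtaS c t) x)
        + (R.J t x * Ddelta (thermoEtaF c) (fun ε => (c ε).γf) t x
          + (-R.J t x) * Ddelta (thermoEtaS c) (fun ε => (c ε).γs) t x)

/-- A smooth variation of all unknowns; `η_k` and `δγ_k` vanish at `t = 0` and `t = T`. -/
structure IsThermoVariation (D : Setup) (a : ℝ) (c : ℝ → ThermoConfig) : Prop where
  config : IsVariation D a (fun ε => (c ε).toConfig)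
  sf_smooth : SmoothEST a D.T D.Ω (fun ε => (c ε).sf)
  ss_smooth : SmoothEST a D.T D.Ω (fun ε => (c ε).ss)
  σf_smooth : SmoothEST a D.T D.Ω (fun ε => (c ε).σf)
  σs_smooth : SmoothEST a D.T D.Ω (fun ε => (c ε).σs)
  γf_smooth : SmoothEST a D.T D.Ω (fun ε => (c ε).γf)
  γs_smooth : SmoothEST a D.T D.Ω (fun ε => (c ε).γs)
  ends_f : ∀ x ∈ closure D.Ω,
    deriv (fun ε => (c ε).γf 0 x) 0 = 0 ∧ deriv (fun ε => (c ε).γf D.T x) 0 = 0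
  ends_s : ∀ x ∈ closure D.Ω,
    deriv (fun ε => (c ε).γs 0 x) 0 = 0 ∧ deriv (fun ε => (c ε).γs D.T x) 0 = 0

/-- The action of the thermodynamic principle, with Lagrange multiplier terms. -/
def thermoAction (D : Setup) (k : Incompressible) (l : Fields → ℝ) (c : ThermoConfig) : ℝ :=
  ∫ t in (0 : ℝ)..D.T, (l (c.thermoState D t) + constraintTerm D k c.toConfig t
    + (∫ x in D.Ω, (c.sf t x - c.σf t x) * Dt c.uf c.γf t x)
    + ∫ x in D.Ω, (c.ss t x - c.σs t x) * Dt c.us c.γs t x)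

/-- The variational principle: the phenomenological constraints hold, and the action is stationary
for all variations that satisfy the variational constraints. -/
structure IsThermoCritical (D : Setup) (k : Incompressible) (bc : VariationClass)
    (l : Fields → ℝ) (dl : Fields → Fields) (R : Friction) (c₀ : ThermoConfig) : Prop where
  phenomenological : PhenomenologicalConstraint D dl R c₀
  stationary : ∀ (a : ℝ) (c : ℝ → ThermoConfig), IsThermoVariation D a c → c 0 = c₀ →
    bc.Allows D (thermoEtaF c) (thermoEtaS c) →
    (bc = .interior →
      SupportedInside D (fun t x => deriv (fun ε => (c ε).γf t x) 0) ∧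
      SupportedInside D (fun t x => deriv (fun ε => (c ε).γs t x) 0)) →
    VariationalConstraint D dl R c →
    HasDerivAt (fun ε => thermoAction D k l (c ε)) 0 0

/-! ## The equations of motion, general Lagrangian

Here `F t` is the state at time `t` and `G t` is the tuple of functional derivatives of the
Lagrangian at `F t`. -/

/-- Mass conservation and transport of the Finger tensor. -/
structure KinematicEqs (D : Setup) (F : ℝ → Fields) : Prop where
  mass_f : ∀ t ∈ Ioo 0 D.T, ∀ x ∈ D.Ω,
    deriv (fun τ => (F τ).ρf x) t + divv (fun y => (F t).ρf y • (F t).uf y) x = 0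
  mass_s : ∀ t ∈ Ioo 0 D.T, ∀ x ∈ D.Ω,
    deriv (fun τ => (F τ).ρs x) t + divv (fun y => (F t).ρs y • (F t).us y) x = 0
  strain : ∀ t ∈ Ioo 0 D.T, ∀ x ∈ D.Ω,
    deriv (fun τ => (F τ).b x) t + lieTensor (F t).us (F t).b x = 0

/-- Advection of the entropies. -/
structure EntropyAdvection (D : Setup) (F : ℝ → Fields) : Prop where
  fluid : ∀ t ∈ Ioo 0 D.T, ∀ x ∈ D.Ω,
    deriv (fun τ => (F τ).sf x) t + divv (fun y => (F t).sf y • (F t).uf y) x = 0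
  solid : ∀ t ∈ Ioo 0 D.T, ∀ x ∈ D.Ω,
    deriv (fun τ => (F τ).ss x) t + divv (fun y => (F t).ss y • (F t).us y) x = 0

/-- The two momentum equations with force densities `Ff`, `Fs`, and the condition from `δφ`. -/
structure GeneralMomentum (D : Setup) (F G : ℝ → Fields) (μf μs : ℝ → Space → ℝ)
    (Ff Fs : ℝ → Space → Space) : Prop where
  fluid : ∀ t ∈ Ioo 0 D.T, ∀ x ∈ D.Ω,
    deriv (fun τ => (G τ).uf x) t + lieMomentum (F t).uf (G t).uf x
      = (F t).ρf x • gradient (G t).ρf x + (F t).sf x • gradient (G t).sf x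
        - (F t).φ x • gradient (μf t) x + Ff t x
  solid : ∀ t ∈ Ioo 0 D.T, ∀ x ∈ D.Ω,
    deriv (fun τ => (G τ).us x) t + lieMomentum (F t).us (G t).us x
      = (F t).ρs x • gradient (G t).ρs x + (F t).ss x • gradient (G t).ss x
        - (1 - (F t).φ x) • gradient (μs t) x
        - contractGrad ((G t).b x) (F t).b x
        - (2 : ℝ) • divT (fun y => tmul ((G t).b y) ((F t).b y)) x + Fs t x
  fraction : ∀ t ∈ Ioo 0 D.T, ∀ x ∈ D.Ω, (G t).φ x + μf t x - μs t x = 0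

/-- The equations of motion without irreversible processes, for a general Lagrangian. -/
structure GeneralSystem (D : Setup) (k : Incompressible) (dl : Fields → Fields)
    (ff fs : ℝ → Space → Space) (c : Config) : Prop where
  momentum : GeneralMomentum D (c.advState D) (fun t => dl (c.advState D t))
    c.μf (k.solid c.μs) ff fs
  kinematic : KinematicEqs D (c.advState D)
  entropy : EntropyAdvection D (c.advState D)
  volume : VolumeEqs D k c

/-- The equations of motion with irreversible processes, for a general Lagrangian. -/
structure GeneralThermoSystem (D : Setup) (k : Incompressible) (dl : Fields → Fields)
    (R : Friction) (c : ThermoConfig) : Prop where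
  momentum : GeneralMomentum D (c.thermoState D) (fun t => dl (c.thermoState D t))
    c.μf (k.solid c.μs)
    (fun t x => divT (R.τf t) x + R.ff t x) (fun t x => divT (R.τs t) x + R.fs t x)
  kinematic : KinematicEqs D (c.thermoState D)
  entropy_f : ∀ t ∈ Ioo 0 D.T, ∀ x ∈ D.Ω,
    (dl (c.thermoState D t)).sf x * Dbar c.uf c.sf t x
      = inner ℝ (R.ff t x) (c.uf t x) - contract (R.τf t x) (gradV (c.uf t) x)
        - R.J t x * ((dl (c.thermoState D t)).ss x - (dl (c.thermoState D t)).sf x)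
  entropy_s : ∀ t ∈ Ioo 0 D.T, ∀ x ∈ D.Ω,
    (dl (c.thermoState D t)).ss x * Dbar c.us c.ss t x
      = inner ℝ (R.fs t x) (c.us t x) - contract (R.τs t x) (gradV (c.us t) x)
        - R.J t x * ((dl (c.thermoState D t)).sf x - (dl (c.thermoState D t)).ss x)
  generated_f : ∀ t ∈ Ioo 0 D.T, ∀ x ∈ D.Ω, Dbar c.uf c.σf t x = Dbar c.uf c.sf t x
  generated_s : ∀ t ∈ Ioo 0 D.T, ∀ x ∈ D.Ω, Dbar c.us c.σs t x = Dbar c.us c.ss t x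
  displacement_f : ∀ t ∈ Ioo 0 D.T, ∀ x ∈ D.Ω,
    Dt c.uf c.γf t x = -(dl (c.thermoState D t)).sf x
  displacement_s : ∀ t ∈ Ioo 0 D.T, ∀ x ∈ D.Ω,
    Dt c.us c.γs t x = -(dl (c.thermoState D t)).ss x
  volume : VolumeEqs D k c.toConfig

/-! ## The Lagrangian of a porous medium -/

/-- The specific internal energies `e_f(ρ̄_f, η_f)` and `e_s(ρ̄_s, η_s, b)`, smooth for positive
actual densities and positive definite `b`.  Only the values of `e_s` at symmetric `b` matter. -/
structure Energies where
  ef : ℝ → ℝ → ℝ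
  es : ℝ → ℝ → Tensor → ℝ
  ef_smooth : ContDiffOn ℝ ∞ (fun p : ℝ × ℝ => ef p.1 p.2) {p | 0 < p.1}
  es_smooth : ContDiffOn ℝ ∞ (fun p : ℝ × ℝ × Tensor => es p.1 p.2.1 p.2.2)
    {p | 0 < p.1 ∧ ∀ v : Fin 3 → ℝ, v ≠ 0 → 0 < ∑ i, ∑ j, v i * p.2.2 i j * v j}

/-- The symmetrized unit tensor `(eᵢ ⊗ eⱼ + eⱼ ⊗ eᵢ)/2`. -/
def symUnit (i j : Fin 3) : Tensor := fun k m =>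
  ((if k = i ∧ m = j then 1 else 0) + (if k = j ∧ m = i then 1 else 0)) / 2

/-- Actual fluid density `ρ̄_f = ρ_f/φ`. -/
def Fields.rbf (F : Fields) (x : Space) : ℝ := F.ρf x / F.φ x

/-- Actual solid density `ρ̄_s = ρ_s/(1-φ)`. -/
def Fields.rbs (F : Fields) (x : Space) : ℝ := F.ρs x / (1 - F.φ x)

/-- Specific entropy of the fluid. -/
def Fields.hf (F : Fields) (x : Space) : ℝ := F.sf x / F.ρf x

/-- Specific entropy of the solid. -/
def Fields.hs (F : Fields) (x : Space) : ℝ := F.ss x / F.ρs x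

/-- `∂e_f/∂ρ̄_f` at a state. -/
def Energies.efρ (e : Energies) (F : Fields) (x : Space) : ℝ :=
  deriv (fun r => e.ef r (F.hf x)) (F.rbf x)

/-- `∂e_s/∂ρ̄_s` at a state. -/
def Energies.esρ (e : Energies) (F : Fields) (x : Space) : ℝ :=
  deriv (fun r => e.es r (F.hs x) (F.b x)) (F.rbs x)

/-- The fluid temperature `T_f = ∂e_f/∂η_f`. -/
def Energies.tempF (e : Energies) (F : Fields) (x : Space) : ℝ :=
  deriv (fun h => e.ef (F.rbf x) h) (F.hf x)

/-- The solid temperature `T_s = ∂e_s/∂η_s`. -/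
def Energies.tempS (e : Energies) (F : Fields) (x : Space) : ℝ :=
  deriv (fun h => e.es (F.rbs x) h (F.b x)) (F.hs x)

/-- `∂e_s/∂b`, a symmetric tensor, at a state. -/
def Energies.esb (e : Energies) (F : Fields) (x : Space) : Tensor := fun i j =>
  fderiv ℝ (fun B => e.es (F.rbs x) (F.hs x) B) (F.b x) (symUnit i j)

/-- `ρ̄_f² ∂e_f/∂ρ̄_f`. -/
def Energies.pF (e : Energies) (F : Fields) (x : Space) : ℝ := F.rbf x ^ 2 * e.efρ F x

/-- `ρ̄_s² ∂e_s/∂ρ̄_s`. -/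
def Energies.pS (e : Energies) (F : Fields) (x : Space) : ℝ := F.rbs x ^ 2 * e.esρ F x

/-- The elastic stress `σ_el = 2 ρ_s (∂e_s/∂b) · b`. -/
def Energies.sigmaEl (e : Energies) (F : Fields) (x : Space) : Tensor := fun i j =>
  2 * F.ρs x * tmul (e.esb F x) (F.b x) i j

/-- The Lagrangian
`∫ ½ρ_f|u_f|² - ρ_f e_f(ρ̄_f, s_f/ρ_f) + ½ρ_s|u_s|² - ρ_s e_s(ρ̄_s, s_s/ρ_s, b)`. -/
def Energies.lagrangian (e : Energies) (Ω : Set Space) (F : Fields) : ℝ :=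
  ∫ x in Ω, (1 / 2 * F.ρf x * ‖F.uf x‖ ^ 2 - F.ρf x * e.ef (F.rbf x) (F.hf x)
    + 1 / 2 * F.ρs x * ‖F.us x‖ ^ 2 - F.ρs x * e.es (F.rbs x) (F.hs x) (F.b x))

/-- The partial derivatives of the integrand of that Lagrangian. -/
def Energies.dLagrangian (e : Energies) (F : Fields) : Fields where
  uf := fun x => F.ρf x • F.uf x
  us := fun x => F.ρs x • F.us x
  ρf := fun x => 1 / 2 * ‖F.uf x‖ ^ 2 - e.ef (F.rbf x) (F.hf x) - F.rbf x * e.efρ F x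
    + F.hf x * e.tempF F x
  ρs := fun x => 1 / 2 * ‖F.us x‖ ^ 2 - e.es (F.rbs x) (F.hs x) (F.b x) - F.rbs x * e.esρ F x
    + F.hs x * e.tempS F x
  sf := fun x => -e.tempF F x
  ss := fun x => -e.tempS F x
  b := fun x i j => -F.ρs x * e.esb F x i j
  φ := fun x => e.pF F x - e.pS F x

/-! ## The equations of motion of a porous medium -/

/-- The momentum equations with pressure `p` and further force densities `Ff`, `Fs`. -/
structure PorousMomentum (D : Setup) (e : Energies) (F : ℝ → Fields) (p : ℝ → Space → ℝ)
    (Ff Fs : ℝ → Space → Space) : Prop where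
  fluid : ∀ t ∈ Ioo 0 D.T, ∀ x ∈ D.Ω,
    (F t).ρf x • (deriv (fun τ => (F τ).uf x) t + advect (F t).uf (F t).uf x)
      = -((F t).φ x • gradient (p t) x) + Ff t x
  solid : ∀ t ∈ Ioo 0 D.T, ∀ x ∈ D.Ω,
    (F t).ρs x • (deriv (fun τ => (F τ).us x) t + advect (F t).us (F t).us x)
      = -((1 - (F t).φ x) • gradient (p t) x) + divT (e.sigmaEl (F t)) x + Fs t x

/-- The porous media equations without irreversible processes, with pressure `p`. -/
structure PorousSystem (D : Setup) (e : Energies) (F : ℝ → Fields) (p : ℝ → Space → ℝ)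
    (ff fs : ℝ → Space → Space) : Prop where
  momentum : PorousMomentum D e F p ff fs
  kinematic : KinematicEqs D F
  entropy : EntropyAdvection D F

/-- The porous media equations with irreversible processes, with pressure `p`. -/
structure PorousThermoSystem (D : Setup) (e : Energies) (F : ℝ → Fields) (p : ℝ → Space → ℝ)
    (R : Friction) : Prop where
  momentum : PorousMomentum D e F p
    (fun t x => divT (R.τf t) x + R.ff t x) (fun t x => divT (R.τs t) x + R.fs t x)
  kinematic : KinematicEqs D F
  entropy_f : ∀ t ∈ Ioo 0 D.T, ∀ x ∈ D.Ω,
    e.tempF (F t) x * Dbar (fun τ => (F τ).uf) (fun τ => (F τ).sf) t x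
      = -inner ℝ (R.ff t x) ((F t).uf x) + contract (R.τf t x) (gradV (F t).uf x)
        - R.J t x * (e.tempS (F t) x - e.tempF (F t) x)
  entropy_s : ∀ t ∈ Ioo 0 D.T, ∀ x ∈ D.Ω,
    e.tempS (F t) x * Dbar (fun τ => (F τ).us) (fun τ => (F τ).ss) t x
      = -inner ℝ (R.fs t x) ((F t).us x) + contract (R.τs t x) (gradV (F t).us x)
        - R.J t x * (e.tempF (F t) x - e.tempS (F t) x)

/-- The pressure condition `p = ρ̄_f² ∂e_f/∂ρ̄_f + μ_f = ρ̄_s² ∂e_s/∂ρ̄_s + μ_s`. -/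
def PressureCondition (D : Setup) (e : Energies) (F : ℝ → Fields) (μf μs p : ℝ → Space → ℝ) :
    Prop :=
  ∀ t ∈ Ioo 0 D.T, ∀ x ∈ D.Ω,
    p t x = e.pF (F t) x + μf t x ∧ p t x = e.pS (F t) x + μs t x

/-- The complete system with advected entropies and incompressibility. -/
def IncompressibleSystem (D : Setup) (k : Incompressible) (e : Energies)
    (ff fs : ℝ → Space → Space) (c : Config) : Prop :=
  ∃ p : ℝ → Space → ℝ,
    PressureCondition D e (c.advState D) c.μf (k.solid c.μs) p ∧
    PorousSystem D e (c.advState D) p ff fs ∧ VolumeEqs D k c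

/-- The complete system with irreversible processes and incompressibility, with the conditions
that determine `σ_k` and `γ_k`. -/
def IncompressibleThermoSystem (D : Setup) (k : Incompressible) (e : Energies)
    (R : Friction) (c : ThermoConfig) : Prop :=
  (∃ p : ℝ → Space → ℝ,
    PressureCondition D e (c.thermoState D) c.μf (k.solid c.μs) p ∧
    PorousThermoSystem D e (c.thermoState D) p R ∧ VolumeEqs D k c.toConfig) ∧
  ∀ t ∈ Ioo 0 D.T, ∀ x ∈ D.Ω,
    Dbar c.uf c.σf t x = Dbar c.uf c.sf t x ∧ Dbar c.us c.σs t x = Dbar c.us c.ss t x ∧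
    Dt c.uf c.γf t x = e.tempF (c.thermoState D t) x ∧
    Dt c.us c.γs t x = e.tempS (c.thermoState D t) x

end

end PorousMedia

/-!
The motions enter the action through Eulerian fields only, and the proof rests on the variations of
these fields along a smooth family of motions with displacement `η = δφ ∘ φ⁻¹`.  For a fixed time
the family parameter generates a local flow with velocity `η` (`IsMotionFamily.isLocalFlow`), as
time generates a local flow with velocity `u` (`IsMotion.isLocalFlow`).  One computation therefore
gives both the transport equations and the variations:

* densities satisfy `∂ₜρ = -div (ρ u)` and `δρ = -div (ρ η)` (`IsLocalFlow.deriv_pushDensity`, from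
  Jacobi's formula), which includes the transported reference volume fractions;
* the Finger tensor satisfies `∂ₜb = -£_u b` and `δb = -£_η b` (`IsLocalFlow.deriv_finger`);
* the velocity satisfies `δu = ∂ₜη + u · ∇η - η · ∇u` (`deriv_velocity`), because the derivatives in
  the parameter and in time commute.

A Lagrangian is differentiated along a family of states under the time integral
(`IsFunctionalDeriv.hasDerivAt_action`).  When the displacements have compact support in the
cylinder `(0, T) × Ω`, integration by parts (`IsTest.integral_fderiv` and its corollaries) turns the
first variation into `∫ A_f · η_f + A_s · η_s + P δφ + Q δμ_f + R δμ_s`, where the vanishing of the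
coefficients is the momentum equations, the condition from `δφ` and the two constraints
(`IsVariation.hasDerivAt_action_adv`, `generalMomentum_iff`).  So the equations imply stationarity
for interior variations.

Conversely, every sufficiently small test field `w` is the displacement field of a family of
motions, obtained by composition with the diffeomorphisms `x + sin ε w(t, x)`
(`Config.IsAdmissible.exists_variation`).  Their displacements vanish near the boundary, so they
belong to each of the four classes, and the fundamental lemma of the calculus of variations needs
only small test functions (`SmoothIn.eq_zero_of_integral`).

With irreversible processes, variations of `s_k` alone give `D_t γ_k = -δℓ/δs_k`
(`IsThermoCritical.displacement`).  Since `δℓ/δs_k` does not vanish, the variational constraint can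
be solved for `δσ_k` whatever the other variations are (`smoothST_solveConstraint`).  Inserting the
constraints into the first variation, the heat exchange terms cancel in the sum over the two
constituents, the friction terms become `div τ_k + f_k` after integration by parts, and the
coefficient of `δγ_k + η_k · ∇γ_k` is the difference of the transport rates of `σ_k` and `s_k`
(`IsThermoVariation.hasDerivAt_action_constrained`).  This uses that the momentum `θ ∇γ` is
transported by the rates of `θ` and `γ` (`deriv_add_lieMomentum_smul_gradient`).  The
phenomenological constraint then becomes the entropy equation.

For the porous media Lagrangian the functional derivatives are computed by the chain rule
(`Energies.isFunctionalDeriv`).  Conservation of mass turns the momentum terms into mass times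
acceleration (`deriv_add_lieMomentum_smul_velocity`), and the thermodynamic terms combine into a
pressure gradient and the divergence of the elastic stress (`energy_gradient`).  The condition from
`δφ` says that the two expressions of the pressure agree (`GeneralMomentum.pressureCondition`), so
that the general systems are equivalent to those with a common pressure
(`PressureCondition.momentum_iff`).
-/

namespace PorousMedia

noncomputable section

open Filter Topology

/-! ### Partial derivatives of functions of time and space -/

section Slices

variable {E V W : Type*} [NormedAddCommGroup E] [NormedSpace ℝ E] [NormedAddCommGroup V]
  [NormedSpace ℝ V] [NormedAddCommGroup W] [NormedSpace ℝ W]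

theorem contDiffAt_fderiv_top {F : E → V} {p : E} (hF : ContDiffAt ℝ ∞ F p) :
    ContDiffAt ℝ ∞ (fderiv ℝ F) p :=
  hF.fderiv_right (m := ∞) (by norm_cast)

theorem differentiableAt_of_smooth {F : E → V} {p : E} (hF : ContDiffAt ℝ ∞ F p) :
    DifferentiableAt ℝ F p :=
  hF.differentiableAt (by norm_num)

theorem eventually_differentiableAt {F : E → V} {p : E} (hF : ContDiffAt ℝ ∞ F p) :
    ∀ᶠ q in 𝓝 p, DifferentiableAt ℝ F q := by
  have h1 : ContDiffAt ℝ 1 F p := hF.of_le (by norm_cast)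
  filter_upwards [h1.eventually (by simp)] with q hq
  exact hq.differentiableAt (by norm_num)

/-- Second derivatives of a smooth function commute. -/
theorem fderiv_fderiv_comm {F : E → V} {p : E} (hF : ContDiffAt ℝ ∞ F p) (v w : E) :
    fderiv ℝ (fun q => fderiv ℝ F q v) p w = fderiv ℝ (fun q => fderiv ℝ F q w) p v := by
  have hd := differentiableAt_of_smooth (contDiffAt_fderiv_top hF)
  rw [fderiv_clm_apply hd (by fun_prop), fderiv_clm_apply hd (by fun_prop)]
  have hs : IsSymmSndFDerivAt ℝ F p := hF.isSymmSndFDerivAt (by simp; norm_cast)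
  simpa using hs w v

/-- `f (s, x)` is smooth near the point `(s, x)`. -/
def SmoothAt (f : ℝ → Space → V) (s : ℝ) (x : Space) : Prop :=
  ContDiffAt ℝ ∞ (fun p : ℝ × Space => f p.1 p.2) (s, x)

theorem fderiv_slice_right {F : ℝ × Space → V} {s : ℝ} {x : Space}
    (hF : DifferentiableAt ℝ F (s, x)) (v : Space) :
    fderiv ℝ (fun y => F (s, y)) x v = fderiv ℝ F (s, x) (0, v) := by
  have h := hF.hasFDerivAt.comp x (hasFDerivAt_prodMk_right s x)
  have h' : HasFDerivAt (fun y => F (s, y)) _ x := h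
  rw [h'.fderiv]
  simp

theorem hasDerivAt_slice_left {F : ℝ × Space → V} {s : ℝ} {x : Space}
    (hF : DifferentiableAt ℝ F (s, x)) :
    HasDerivAt (fun τ => F (τ, x)) (fderiv ℝ F (s, x) (1, 0)) s := by
  have h := HasFDerivAt.comp (g := F) (f := fun τ : ℝ => (τ, x)) s hF.hasFDerivAt
    (hasFDerivAt_prodMk_left s x)
  have h' : HasFDerivAt (fun τ => F (τ, x)) _ s := h
  simpa using h'.hasDerivAt

namespace SmoothAt

variable {f g : ℝ → Space → V} {s : ℝ} {x : Space}

theorem slice (h : SmoothAt f s x) : ContDiffAt ℝ ∞ (f s) x :=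
  ContDiffAt.comp x (f := fun y => (s, y)) h (by fun_prop)

theorem slice_time (h : SmoothAt f s x) : ContDiffAt ℝ ∞ (fun τ => f τ x) s :=
  ContDiffAt.comp s (f := fun τ => (τ, x)) h (by fun_prop)

theorem dx (h : SmoothAt f s x) : DifferentiableAt ℝ (f s) x := differentiableAt_of_smooth h.slice

theorem ds (h : SmoothAt f s x) : DifferentiableAt ℝ (fun τ => f τ x) s :=
  differentiableAt_of_smooth h.slice_time

theorem congr (h : SmoothAt f s x) (hg : ∀ᶠ p : ℝ × Space in 𝓝 (s, x), g p.1 p.2 = f p.1 p.2) :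
    SmoothAt g s x :=
  ContDiffAt.congr_of_eventuallyEq h hg

theorem deriv (h : SmoothAt f s x) : SmoothAt (fun s x => deriv (fun τ => f τ x) s) s x := by
  have h1 : ContDiffAt ℝ ∞ (fun q => fderiv ℝ (fun p : ℝ × Space => f p.1 p.2) q (1, 0)) (s, x) :=
    (contDiffAt_fderiv_top h).clm_apply contDiffAt_const
  refine h1.congr_of_eventuallyEq ?_
  filter_upwards [eventually_differentiableAt h] with q hq
  exact (hasDerivAt_slice_left (s := q.1) (x := q.2) hq).deriv

theorem fderiv (h : SmoothAt f s x) : SmoothAt (fun s x => fderiv ℝ (f s) x) s x := by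
  have h1 : ContDiffAt ℝ ∞ (fun q => (_root_.fderiv ℝ (fun p : ℝ × Space => f p.1 p.2) q).comp
      (ContinuousLinearMap.inr ℝ ℝ Space)) (s, x) :=
    (contDiffAt_fderiv_top h).clm_comp contDiffAt_const
  refine h1.congr_of_eventuallyEq ?_
  filter_upwards [eventually_differentiableAt h] with q hq
  ext v
  exact fderiv_slice_right (s := q.1) (x := q.2) hq v

theorem const (c : V) : SmoothAt (fun _ _ => c) s x := contDiffAt_const

theorem add (hf : SmoothAt f s x) (hg : SmoothAt g s x) :
    SmoothAt (fun s x => f s x + g s x) s x := ContDiffAt.add hf hg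

theorem sub (hf : SmoothAt f s x) (hg : SmoothAt g s x) :
    SmoothAt (fun s x => f s x - g s x) s x := ContDiffAt.sub hf hg

theorem neg (hf : SmoothAt f s x) : SmoothAt (fun s x => -f s x) s x := ContDiffAt.neg hf

theorem sum {ι : Type*} {u : Finset ι} {f : ι → ℝ → Space → V}
    (hf : ∀ i ∈ u, SmoothAt (f i) s x) : SmoothAt (fun s x => ∑ i ∈ u, f i s x) s x :=
  ContDiffAt.sum hf

theorem smul {a : ℝ → Space → ℝ} (ha : SmoothAt a s x) (hf : SmoothAt f s x) :
    SmoothAt (fun s x => a s x • f s x) s x := ContDiffAt.smul ha hf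

theorem mul {f g : ℝ → Space → ℝ} (hf : SmoothAt f s x) (hg : SmoothAt g s x) :
    SmoothAt (fun s x => f s x * g s x) s x := ContDiffAt.mul hf hg

theorem div {f g : ℝ → Space → ℝ} (hf : SmoothAt f s x) (hg : SmoothAt g s x) (h0 : g s x ≠ 0) :
    SmoothAt (fun s x => f s x / g s x) s x := ContDiffAt.div hf hg h0

theorem inner {f g : ℝ → Space → Space} (hf : SmoothAt f s x) (hg : SmoothAt g s x) :
    SmoothAt (fun s x => inner ℝ (f s x) (g s x)) s x := ContDiffAt.inner ℝ hf hg

/-- Composition with a map of space that depends on time. -/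
theorem comp {g : ℝ → Space → Space} (hf : SmoothAt f s (g s x)) (hg : SmoothAt g s x) :
    SmoothAt (fun s x => f s (g s x)) s x :=
  ContDiffAt.comp (s, x) (g := fun p : ℝ × Space => f p.1 p.2)
    (f := fun p : ℝ × Space => (p.1, g p.1 p.2)) hf (contDiffAt_fst.prodMk hg)

theorem clm_apply {f : ℝ → Space → W →L[ℝ] V} {g : ℝ → Space → W} (hf : SmoothAt f s x)
    (hg : SmoothAt g s x) : SmoothAt (fun s x => f s x (g s x)) s x := ContDiffAt.clm_apply hf hg

theorem of_contDiffAt {r : Space → V} (hr : ContDiffAt ℝ ∞ r x) : SmoothAt (fun _ x => r x) s x :=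
  ContDiffAt.comp (s, x) (g := r) (f := fun p : ℝ × Space => p.2) hr contDiffAt_snd

theorem pd {f : ℝ → Space → ℝ} (h : SmoothAt f s x) (i : Fin 3) :
    SmoothAt (fun s x => pd i (f s) x) s x :=
  h.fderiv.clm_apply (const _)

theorem coord {f : ℝ → Space → Space} (h : SmoothAt f s x) (i : Fin 3) :
    SmoothAt (fun s x => f s x i) s x :=
  ContDiffAt.comp (s, x) (g := fun v : Space => v i) (by fun_prop) h

theorem of_coord {f : ℝ → Space → Space} (h : ∀ i, SmoothAt (fun s x => f s x i) s x) :
    SmoothAt f s x := contDiffAt_euclidean.2 h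

theorem entry {f : ℝ → Space → Tensor} (h : SmoothAt f s x) (i j : Fin 3) :
    SmoothAt (fun s x => f s x i j) s x :=
  ContDiffAt.comp (s, x) (g := fun v : Tensor => v i j) (by fun_prop) h

theorem of_entry {f : ℝ → Space → Tensor} (h : ∀ i j, SmoothAt (fun s x => f s x i j) s x) :
    SmoothAt f s x := contDiffAt_pi.2 fun i => contDiffAt_pi.2 fun j => h i j

/-- Time derivatives commute with space derivatives. -/
theorem deriv_fderiv_comm (h : SmoothAt f s x) (v : Space) :
    _root_.deriv (fun τ => _root_.fderiv ℝ (f τ) x v) s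
      = _root_.fderiv ℝ (fun y => _root_.deriv (fun τ => f τ y) s) x v := by
  have hd := eventually_differentiableAt h
  set F : ℝ × Space → V := fun p => f p.1 p.2 with hF
  have hG : ∀ w, DifferentiableAt ℝ (fun q => _root_.fderiv ℝ F q w) (s, x) := fun w =>
    differentiableAt_of_smooth ((contDiffAt_fderiv_top h).clm_apply contDiffAt_const)
  have e1 : (fun τ => _root_.fderiv ℝ (f τ) x v) =ᶠ[𝓝 s]
      fun τ => _root_.fderiv ℝ F (τ, x) (0, v) := by
    have hc : Tendsto (fun τ : ℝ => (τ, x)) (𝓝 s) (𝓝 (s, x)) :=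
      (by fun_prop : Continuous fun τ : ℝ => (τ, x)).tendsto s
    filter_upwards [hc.eventually hd] with τ hτ
    exact fderiv_slice_right hτ v
  have e2 : (fun y => _root_.deriv (fun τ => f τ y) s) =ᶠ[𝓝 x]
      fun y => _root_.fderiv ℝ F (s, y) (1, 0) := by
    have hc : Tendsto (fun y : Space => (s, y)) (𝓝 x) (𝓝 (s, x)) :=
      (by fun_prop : Continuous fun y : Space => (s, y)).tendsto x
    filter_upwards [hc.eventually hd] with y hy
    exact (hasDerivAt_slice_left hy).deriv
  rw [e1.deriv_eq, e2.fderiv_eq, (hasDerivAt_slice_left (hG (0, v))).deriv,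
    fderiv_slice_right (hG (1, 0)) v]
  exact fderiv_fderiv_comm h (0, v) (1, 0)

theorem deriv_pd_comm {f : ℝ → Space → ℝ} (h : SmoothAt f s x) (i : Fin 3) :
    _root_.deriv (fun τ => PorousMedia.pd i (f τ) x) s
      = PorousMedia.pd i (fun y => _root_.deriv (fun τ => f τ y) s) x :=
  h.deriv_fderiv_comm _

/-- Chain rule in time along a moving point. -/
theorem deriv_comp {g : ℝ → Space → Space} (hf : SmoothAt f s (g s x)) (hg : SmoothAt g s x) :
    _root_.deriv (fun τ => f τ (g τ x)) s
      = _root_.deriv (fun τ => f τ (g s x)) s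
        + _root_.fderiv ℝ (f s) (g s x) (_root_.deriv (fun τ => g τ x) s) := by
  have h1 := (differentiableAt_of_smooth hf).hasFDerivAt
  have h2 : HasFDerivAt (fun τ : ℝ => (τ, g τ x)) _ s :=
    (hasFDerivAt_id s).prodMk hg.ds.hasDerivAt.hasFDerivAt
  have h3 : HasFDerivAt (fun τ => f τ (g τ x)) _ s :=
    HasFDerivAt.comp (g := fun p : ℝ × Space => f p.1 p.2) s h1 h2
  rw [h3.hasDerivAt.deriv]
  have e1 := (hasDerivAt_slice_left (differentiableAt_of_smooth hf)).deriv
  have e2 := fderiv_slice_right (differentiableAt_of_smooth hf)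
    (_root_.deriv (fun τ => g τ x) s)
  simp only at e1 e2
  rw [e1]
  change _ = _ + _root_.fderiv ℝ (fun y => f s y) (g s x) _
  rw [e2, ← map_add]
  simp

/-- Chain rule in space. -/
theorem fderiv_comp {g : ℝ → Space → Space} (hf : SmoothAt f s (g s x)) (hg : SmoothAt g s x)
    (v : Space) : _root_.fderiv ℝ (fun y => f s (g s y)) x v
      = _root_.fderiv ℝ (f s) (g s x) (_root_.fderiv ℝ (g s) x v) := by
  have h : HasFDerivAt (fun y => f s (g s y)) _ x := hf.dx.hasFDerivAt.comp x hg.dx.hasFDerivAt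
  rw [h.fderiv]; rfl

end SmoothAt

end Slices

section PartialDerivatives

variable {f g : Space → ℝ} {x : Space} {i j : Fin 3}

theorem pd_congr (h : f =ᶠ[𝓝 x] g) : pd i f x = pd i g x := by
  simp only [pd, h.fderiv_eq]

theorem pd_add (hf : DifferentiableAt ℝ f x) (hg : DifferentiableAt ℝ g x) :
    pd i (fun y => f y + g y) x = pd i f x + pd i g x := by
  simp [pd, fderiv_fun_add hf hg]

theorem pd_sub (hf : DifferentiableAt ℝ f x) (hg : DifferentiableAt ℝ g x) :
    pd i (fun y => f y - g y) x = pd i f x - pd i g x := by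
  simp [pd, fderiv_fun_sub hf hg]

theorem pd_neg : pd i (fun y => -f y) x = -pd i f x := by
  simp [pd, fderiv_fun_neg]

theorem pd_const (c : ℝ) : pd i (fun _ => c) x = 0 := by simp [pd]

theorem pd_mul (hf : DifferentiableAt ℝ f x) (hg : DifferentiableAt ℝ g x) :
    pd i (fun y => f y * g y) x = f x * pd i g x + g x * pd i f x := by
  simp [pd, fderiv_fun_mul hf hg]

theorem pd_sum {ι : Type*} {u : Finset ι} {f : ι → Space → ℝ}
    (hf : ∀ k ∈ u, DifferentiableAt ℝ (f k) x) :
    pd i (fun y => ∑ k ∈ u, f k y) x = ∑ k ∈ u, pd i (f k) x := by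
  simp [pd, fderiv_fun_sum hf]

theorem pd_comm (hf : ContDiffAt ℝ ∞ f x) :
    pd i (fun y => pd j f y) x = pd j (fun y => pd i f y) x :=
  fderiv_fderiv_comm hf _ _

theorem sum_smul_single (v : Space) : ∑ k, v k • EuclideanSpace.single k (1 : ℝ) = v := by
  ext k
  simp [Pi.single_apply]

theorem fderiv_eq_sum_pd (f : Space → ℝ) (x v : Space) :
    fderiv ℝ f x v = ∑ k, v k * pd k f x := by
  conv_lhs => rw [← sum_smul_single v]
  simp [pd, map_sum]

theorem fderiv_coord {v : Space → Space} (hv : DifferentiableAt ℝ v x) (w : Space) (k : Fin 3) :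
    fderiv ℝ v x w k = fderiv ℝ (fun y => v y k) x w := by
  have h := (EuclideanSpace.proj k : Space →L[ℝ] ℝ).hasFDerivAt.comp x
    hv.hasFDerivAt
  have h' : HasFDerivAt (fun y => v y k) _ x := h
  rw [h'.fderiv]; rfl

theorem fderiv_coord_eq_sum {v : Space → Space} (hv : DifferentiableAt ℝ v x) (w : Space)
    (k : Fin 3) : fderiv ℝ v x w k = ∑ m, w m * pd m (fun y => v y k) x := by
  rw [fderiv_coord hv, fderiv_eq_sum_pd]

theorem gradient_apply (f : Space → ℝ) (x : Space) (k : Fin 3) : gradient f x k = pd k f x := by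
  have h : inner ℝ (gradient f x) (EuclideanSpace.single k (1 : ℝ)) = pd k f x := by
    rw [gradient, InnerProductSpace.toDual_symm_apply]; rfl
  rw [← h, EuclideanSpace.inner_single_right]
  simp

theorem inner_eq_sum (v w : Space) : inner ℝ v w = ∑ k, v k * w k := by
  simp [PiLp.inner_apply, mul_comm]

theorem deriv_coord {v : ℝ → Space} {t : ℝ} (hv : DifferentiableAt ℝ v t) (k : Fin 3) :
    deriv v t k = deriv (fun τ => v τ k) t := by
  have h := (EuclideanSpace.proj k : Space →L[ℝ] ℝ).hasFDerivAt.comp_hasDerivAt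
    t hv.hasDerivAt
  have h' : HasDerivAt (fun τ => v τ k) _ t := h
  rw [h'.deriv]; rfl

theorem deriv_entry {v : ℝ → Tensor} {t : ℝ} (hv : DifferentiableAt ℝ v t) (i j : Fin 3) :
    deriv v t i j = deriv (fun τ => v τ i j) t :=
  ((hasDerivAt_pi.1 (hasDerivAt_pi.1 hv.hasDerivAt i)) j).deriv.symm

end PartialDerivatives

/-! ### Transport by a flow -/

/-- Near `(s, x)` the maps `ψ s` are smooth inverses of the maps `χ s`. -/
structure IsLocalFlow (χ ψ : ℝ → Space → Space) (s : ℝ) (x : Space) : Prop where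
  smooth : SmoothAt χ s (ψ s x)
  smooth_inv : SmoothAt ψ s x
  right_inv : ∀ᶠ p : ℝ × Space in 𝓝 (s, x), χ p.1 (ψ p.1 p.2) = p.2
  left_inv : ∀ᶠ p : ℝ × Space in 𝓝 (s, ψ s x), ψ p.1 (χ p.1 p.2) = p.2

theorem eventually_slice {P : ℝ × Space → Prop} {s : ℝ} {x : Space}
    (h : ∀ᶠ p in 𝓝 (s, x), P p) : ∀ᶠ y in 𝓝 x, P (s, y) :=
  ((by fun_prop : Continuous fun y : Space => (s, y)).tendsto x).eventually h

theorem eventually_slice_time {P : ℝ × Space → Prop} {s : ℝ} {x : Space}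
    (h : ∀ᶠ p in 𝓝 (s, x), P p) : ∀ᶠ τ in 𝓝 s, P (τ, x) :=
  ((by fun_prop : Continuous fun τ : ℝ => (τ, x)).tendsto s).eventually h

namespace IsLocalFlow

variable {χ ψ : ℝ → Space → Space} {s : ℝ} {x : Space}

theorem smooth_velocity (h : IsLocalFlow χ ψ s x) : SmoothAt (velocity χ ψ) s x :=
  h.smooth.deriv.comp h.smooth_inv

theorem apply_inv (h : IsLocalFlow χ ψ s x) : χ s (ψ s x) = x := h.right_inv.self_of_nhds

theorem fderiv_comp_inv (h : IsLocalFlow χ ψ s x) (v : Space) :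
    fderiv ℝ (χ s) (ψ s x) (fderiv ℝ (ψ s) x v) = v := by
  rw [← h.smooth.fderiv_comp h.smooth_inv v]
  have e : (fun y => χ s (ψ s y)) =ᶠ[𝓝 x] fun y => y := eventually_slice h.right_inv
  rw [e.fderiv_eq, fderiv_fun_id]; rfl

theorem fderiv_inv_comp (h : IsLocalFlow χ ψ s x) (v : Space) :
    fderiv ℝ (ψ s) x (fderiv ℝ (χ s) (ψ s x) v) = v := by
  have hx : χ s (ψ s x) = x := h.apply_inv
  have hs : SmoothAt ψ s (χ s (ψ s x)) := by rw [hx]; exact h.smooth_inv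
  have e1 := hs.fderiv_comp h.smooth v
  rw [hx] at e1
  rw [← e1]
  have e : (fun y => ψ s (χ s y)) =ᶠ[𝓝 (ψ s x)] fun y => y := eventually_slice h.left_inv
  rw [e.fderiv_eq, fderiv_fun_id]; rfl

theorem deriv_inv (h : IsLocalFlow χ ψ s x) :
    deriv (fun τ => ψ τ x) s = -fderiv ℝ (ψ s) x (velocity χ ψ s x) := by
  have e : (fun τ => χ τ (ψ τ x)) =ᶠ[𝓝 s] fun _ => x := eventually_slice_time h.right_inv
  have h1 := h.smooth.deriv_comp h.smooth_inv
  rw [e.deriv_eq, deriv_const] at h1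
  have h2 : velocity χ ψ s x = -fderiv ℝ (χ s) (ψ s x) (deriv (fun τ => ψ τ x) s) :=
    eq_neg_of_add_eq_zero_left h1.symm
  rw [h2, map_neg, h.fderiv_inv_comp, neg_neg]

/-- The material derivative of a quantity given in reference coordinates. -/
theorem deriv_comp_inv {V : Type*} [NormedAddCommGroup V] [NormedSpace ℝ V] {f : ℝ → Space → V}
    (h : IsLocalFlow χ ψ s x) (hf : SmoothAt f s (ψ s x)) :
    deriv (fun τ => f τ (ψ τ x)) s = deriv (fun τ => f τ (ψ s x)) s
      - fderiv ℝ (fun y => f s (ψ s y)) x (velocity χ ψ s x) := by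
  rw [hf.deriv_comp h.smooth_inv, h.deriv_inv, hf.fderiv_comp h.smooth_inv, map_neg, sub_eq_add_neg]

theorem deriv_eq_velocity (h : IsLocalFlow χ ψ s x) :
    (fun X => deriv (fun τ => χ τ X) s) =ᶠ[𝓝 (ψ s x)] fun X => velocity χ ψ s (χ s X) := by
  filter_upwards [eventually_slice h.left_inv] with X hX
  simp only [velocity, hX]

theorem smooth_pd (h : IsLocalFlow χ ψ s x) (i A : Fin 3) :
    SmoothAt (fun s x => pd A (fun X => χ s X i) (ψ s x)) s x :=
  ((h.smooth.coord i).pd A).comp h.smooth_inv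

theorem smooth_finger (h : IsLocalFlow χ ψ s x) : SmoothAt (finger χ ψ) s x :=
  SmoothAt.of_entry fun i j => SmoothAt.sum fun A _ => (h.smooth_pd i A).mul (h.smooth_pd j A)

/-- Transport of the deformation gradient. -/
theorem deriv_gradient (h : IsLocalFlow χ ψ s x) (i A : Fin 3) :
    deriv (fun τ => pd A (fun X => χ τ X i) (ψ τ x)) s
      = (∑ k, pd A (fun X => χ s X k) (ψ s x) * pd k (fun y => velocity χ ψ s y i) x)
        - ∑ k, velocity χ ψ s x k * pd k (fun y => pd A (fun X => χ s X i) (ψ s y)) x := by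
  have hi := h.smooth.coord i
  rw [h.deriv_comp_inv (hi.pd A), fderiv_eq_sum_pd, hi.deriv_pd_comm A]
  congr 1
  have e : (fun X => deriv (fun τ => χ τ X i) s) =ᶠ[𝓝 (ψ s x)]
      fun X => velocity χ ψ s (χ s X) i := by
    have h1 : ∀ᶠ X in 𝓝 (ψ s x), DifferentiableAt ℝ (fun τ => χ τ X) s := by
      filter_upwards [eventually_slice (eventually_differentiableAt h.smooth)] with X hX
      exact (hasDerivAt_slice_left hX).differentiableAt
    filter_upwards [h.deriv_eq_velocity, h1] with X hX h1
    rw [← hX, deriv_coord h1]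
  have hv : SmoothAt (fun s y => velocity χ ψ s y i) s (χ s (ψ s x)) := by
    rw [h.apply_inv]; exact h.smooth_velocity.coord i
  rw [pd_congr e, pd, hv.fderiv_comp h.smooth, h.apply_inv, fderiv_eq_sum_pd]
  refine Finset.sum_congr rfl fun k _ => ?_
  rw [fderiv_coord h.smooth.dx]; rfl

/-- The Finger tensor is advected as a two-contravariant tensor. -/
theorem deriv_finger (h : IsLocalFlow χ ψ s x) :
    deriv (fun τ => finger χ ψ τ x) s = -lieTensor (velocity χ ψ s) (finger χ ψ s) x := by
  ext i j
  rw [deriv_entry h.smooth_finger.ds]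
  have hd : ∀ i A, HasDerivAt (fun τ => pd A (fun X => χ τ X i) (ψ τ x)) _ s := fun i A =>
    (h.smooth_pd i A).ds.hasDerivAt
  have h1 : deriv (fun τ => finger χ ψ τ x i j) s = _ :=
    (HasDerivAt.fun_sum fun A (_ : A ∈ Finset.univ) => (hd i A).mul (hd j A)).deriv
  rw [h1]
  have h2 : ∀ k, pd k (fun y => finger χ ψ s y i j) x = _ := fun k =>
    pd_sum (u := Finset.univ) (f := fun A y => pd A (fun X => χ s X i) (ψ s y) *
      pd A (fun X => χ s X j) (ψ s y)) (fun A _ => (h.smooth_pd i A).dx.mul (h.smooth_pd j A).dx)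
  have h3 : ∀ k A, pd k (fun y => pd A (fun X => χ s X i) (ψ s y) *
      pd A (fun X => χ s X j) (ψ s y)) x = _ := fun k A =>
    pd_mul (h.smooth_pd i A).dx (h.smooth_pd j A).dx
  simp only [Pi.neg_apply, lieTensor, h2, h3, h.deriv_gradient]
  simp only [finger, Fin.sum_univ_three]
  ring

end IsLocalFlow

/-- Jacobi's formula for three-by-three matrices. -/
theorem fderiv_det_three {E : Type*} [NormedAddCommGroup E] [NormedSpace ℝ E]
    {a : Fin 3 → Fin 3 → E → ℝ} {x : E} (ha : ∀ i j, DifferentiableAt ℝ (a i j) x) (v : E) :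
    fderiv ℝ (fun y => Matrix.det (Matrix.of fun i j => a i j y)) x v
      = ∑ i, ∑ j, fderiv ℝ (a i j) x v * (Matrix.of fun i j => a i j x).adjugate j i := by
  have h3 : ∀ i j k l m n, HasFDerivAt (fun y => a i j y * a k l y * a m n y) _ x :=
    fun i j k l m n => ((ha i j).hasFDerivAt.mul (ha k l).hasFDerivAt).mul (ha m n).hasFDerivAt
  have h4 := ((((((h3 0 0 1 1 2 2).sub (h3 0 0 1 2 2 1)).sub (h3 0 1 1 0 2 2)).add
    (h3 0 1 1 2 2 0)).add (h3 0 2 1 0 2 1)).sub (h3 0 2 1 1 2 0)).fderiv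
  simp only [Matrix.det_fin_three, Matrix.of_apply]
  refine (congrArg (fun L => L v) h4).trans ?_
  simp only [Matrix.adjugate_fin_three, Matrix.of_apply, Fin.sum_univ_three]
  simp
  ring

/-- The Jacobian determinant as a polynomial in the partial derivatives. -/
theorem det_fderiv {f : Space → Space} {x : Space} (hf : DifferentiableAt ℝ f x) :
    (fderiv ℝ f x).det
      = Matrix.det (Matrix.of fun i j : Fin 3 => pd j (fun y => f y i) x) := by
  rw [ContinuousLinearMap.det, ← LinearMap.det_toMatrix (EuclideanSpace.basisFun (Fin 3) ℝ).toBasis]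
  congr 1
  ext i j
  simp only [LinearMap.toMatrix_apply, Matrix.of_apply, pd]
  rw [← fderiv_coord hf]
  simp

namespace IsLocalFlow

variable {χ ψ : ℝ → Space → Space} {s : ℝ} {x : Space}

theorem det_ne_zero (h : IsLocalFlow χ ψ s x) : (fderiv ℝ (ψ s) x).det ≠ 0 := by
  have e : (fderiv ℝ (χ s) (ψ s x)).comp (fderiv ℝ (ψ s) x) = ContinuousLinearMap.id ℝ Space := by
    ext1 v; exact h.fderiv_comp_inv v
  have e2 := congrArg ContinuousLinearMap.det e
  intro h0
  have e3 : LinearMap.det ((fderiv ℝ (χ s) (ψ s x) : Space →ₗ[ℝ] Space) ∘ₗ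
      (fderiv ℝ (ψ s) x : Space →ₗ[ℝ] Space))
        = LinearMap.det (LinearMap.id : Space →ₗ[ℝ] Space) := e2
  rw [ContinuousLinearMap.det] at h0
  rw [LinearMap.det_comp, h0, mul_zero, LinearMap.det_id] at e3
  exact zero_ne_one e3

/-- Transport of the Jacobian determinant, for flows given near a point at one time. -/
theorem deriv_det (h : ∀ᶠ y in 𝓝 x, IsLocalFlow χ ψ s y) :
    SmoothAt (fun s x => (fderiv ℝ (ψ s) x).det) s x ∧
    deriv (fun τ => (fderiv ℝ (ψ τ) x).det) s
      = -(∑ k, pd k (fun y => (fderiv ℝ (ψ s) y).det * velocity χ ψ s y k) x) := by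
  have h0 := h.self_of_nhds
  have hi := h0.smooth_inv
  have ha : ∀ i j, SmoothAt (fun s y => pd j (fun y => ψ s y i) y) s x := fun i j =>
    (hi.coord i).pd j
  have hw : ∀ k, SmoothAt (fun s y => velocity χ ψ s y k) s x := fun k => h0.smooth_velocity.coord k
  have hev : ∀ᶠ p : ℝ × Space in 𝓝 (s, x), (fderiv ℝ (ψ p.1) p.2).det
      = Matrix.det (Matrix.of fun i j : Fin 3 => pd j (fun y => ψ p.1 y i) p.2) := by
    filter_upwards [eventually_differentiableAt hi] with p hp
    refine det_fderiv ?_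
    exact hp.comp p.2 (f := fun y => (p.1, y)) (by fun_prop)
  have hD : SmoothAt (fun s x => Matrix.det (Matrix.of fun i j : Fin 3 =>
      pd j (fun y => ψ s y i) x)) s x := by
    simp only [Matrix.det_fin_three, Matrix.of_apply]
    refine (((((SmoothAt.sub ?_ ?_).sub ?_).add ?_).add ?_).sub ?_) <;>
    exact ((ha _ _).mul (ha _ _)).mul (ha _ _)
  have hS : SmoothAt (fun s x => (fderiv ℝ (ψ s) x).det) s x := hD.congr hev
  refine ⟨hS, ?_⟩
  have hdet : ∀ i j, deriv (fun τ => pd j (fun y => ψ τ y i) x) s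
      = -∑ k, (pd k (fun y => ψ s y i) x * pd j (fun y => velocity χ ψ s y k) x
        + velocity χ ψ s x k * pd k (fun y => pd j (fun y => ψ s y i) y) x) := by
    intro i j
    rw [(hi.coord i).deriv_pd_comm j]
    have e : (fun y => deriv (fun τ => ψ τ y i) s) =ᶠ[𝓝 x]
        fun y => -∑ k, velocity χ ψ s y k * pd k (fun z => ψ s z i) y := by
      filter_upwards [h] with y hy
      rw [← deriv_coord hy.smooth_inv.ds, hy.deriv_inv, PiLp.neg_apply,
        fderiv_coord_eq_sum hy.smooth_inv.dx]
    rw [pd_congr e, pd_neg, pd_sum (u := Finset.univ)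
      (f := fun k y => velocity χ ψ s y k * pd k (fun z => ψ s z i) y)
      fun k _ => (hw k).dx.mul (ha i k).dx]
    congr 1
    refine Finset.sum_congr rfl fun k _ => ?_
    rw [pd_mul (hw k).dx (ha i k).dx, pd_comm (hi.coord i).slice]
    ring
  have e1 : (fun τ => (fderiv ℝ (ψ τ) x).det) =ᶠ[𝓝 s] _ := eventually_slice_time hev
  have e2 : (fun y => (fderiv ℝ (ψ s) y).det) =ᶠ[𝓝 x] _ := eventually_slice hev
  have e3 : ∀ k, pd k (fun y => (fderiv ℝ (ψ s) y).det * velocity χ ψ s y k) x = _ := fun k =>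
    pd_mul hS.dx (hw k).dx
  simp only [e3, pd_congr e2]
  rw [e1.deriv_eq, hev.self_of_nhds]
  have h1 := fderiv_det_three (a := fun i j τ => pd j (fun y => ψ τ y i) x)
    (fun i j => (ha i j).ds) (1 : ℝ)
  have h2 : ∀ k, pd k _ x = _ := fun k =>
    fderiv_det_three (a := fun i j y => pd j (fun z => ψ s z i) y) (fun i j => (ha i j).dx)
      (EuclideanSpace.single k 1)
  rw [← fderiv_apply_one_eq_deriv]
  refine h1.trans ?_
  simp only [h2, fderiv_apply_one_eq_deriv, hdet]
  simp only [Matrix.adjugate_fin_three, Matrix.det_fin_three, Matrix.of_apply, Fin.sum_univ_three,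
    pd]
  simp
  ring

theorem smooth_pushDensity {r : Space → ℝ} (h : ∀ᶠ y in 𝓝 x, IsLocalFlow χ ψ s y)
    (hr : ContDiffAt ℝ ∞ r (ψ s x)) : SmoothAt (pushDensity ψ r) s x := by
  have h0 := h.self_of_nhds
  have h1 : SmoothAt (fun s x => r (ψ s x)) s x :=
    SmoothAt.comp (f := fun _ X => r X) (SmoothAt.of_contDiffAt hr) h0.smooth_inv
  refine h1.mul ?_
  exact ContDiffAt.comp (s, x) (g := fun a : ℝ => |a|)
    (f := fun p : ℝ × Space => (fderiv ℝ (ψ p.1) p.2).det) (contDiffAt_abs h0.det_ne_zero)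
    (deriv_det h).1

/-- Densities satisfy the continuity equation. -/
theorem deriv_pushDensity {r : Space → ℝ} (h : ∀ᶠ y in 𝓝 x, IsLocalFlow χ ψ s y)
    (hr : ContDiffAt ℝ ∞ r (ψ s x)) : deriv (fun τ => pushDensity ψ r τ x) s
      = -divv (fun y => pushDensity ψ r s y • velocity χ ψ s y) x := by
  have h0 := h.self_of_nhds
  have h1 : SmoothAt (fun s x => r (ψ s x)) s x :=
    SmoothAt.comp (f := fun _ X => r X) (SmoothAt.of_contDiffAt hr) h0.smooth_inv
  obtain ⟨hJ, hJ'⟩ := deriv_det h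
  -- near the point the determinant does not change sign
  obtain ⟨σ, hσ⟩ : ∃ σ : ℝ, ∀ᶠ p : ℝ × Space in 𝓝 (s, x),
      |(fderiv ℝ (ψ p.1) p.2).det| = σ * (fderiv ℝ (ψ p.1) p.2).det := by
    have hc := ContDiffAt.continuousAt hJ
    rcases lt_or_gt_of_ne h0.det_ne_zero with hn | hp
    · refine ⟨-1, ?_⟩
      filter_upwards [hc.eventually (gt_mem_nhds hn)] with p hp
      rw [abs_of_neg hp]; ring
    · refine ⟨1, ?_⟩
      filter_upwards [hc.eventually (lt_mem_nhds hp)] with p hp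
      rw [abs_of_pos hp, one_mul]
  have hw : ∀ k, SmoothAt (fun s y => velocity χ ψ s y k) s x := fun k => h0.smooth_velocity.coord k
  have e1 : (fun τ => pushDensity ψ r τ x) =ᶠ[𝓝 s]
      fun τ => σ * (r (ψ τ x) * (fderiv ℝ (ψ τ) x).det) := by
    filter_upwards [eventually_slice_time hσ] with τ hτ
    rw [pushDensity, hτ]; ring
  have e2 : ∀ k, (fun y => (pushDensity ψ r s y • velocity χ ψ s y) k) =ᶠ[𝓝 x]
      fun y => (σ * r (ψ s y)) * ((fderiv ℝ (ψ s) y).det * velocity χ ψ s y k) := by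
    intro k
    filter_upwards [eventually_slice hσ] with y hy
    rw [PiLp.smul_apply, pushDensity, hy, smul_eq_mul]; ring
  have h2 : deriv (fun τ => r (ψ τ x)) s
      = -∑ k, velocity χ ψ s x k * pd k (fun y => r (ψ s y)) x := by
    rw [h0.deriv_comp_inv (f := fun _ X => r X) (SmoothAt.of_contDiffAt hr), deriv_const, zero_sub,
      fderiv_eq_sum_pd]
  have e3 : ∀ k, pd k (fun y => (σ * r (ψ s y)) * ((fderiv ℝ (ψ s) y).det * velocity χ ψ s y k)) x
      = _ := fun k => pd_mul (h1.dx.const_mul σ) (hJ.dx.mul (hw k).dx)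
  have e4 : ∀ k, pd k (fun y => σ * r (ψ s y)) x = σ * pd k (fun y => r (ψ s y)) x := fun k => by
    simp [pd, fderiv_const_mul h1.dx]
  have e5 : HasDerivAt (fun τ => σ * (r (ψ τ x) * (fderiv ℝ (ψ τ) x).det)) _ s :=
    (h1.ds.hasDerivAt.mul hJ.ds.hasDerivAt).const_mul σ
  rw [e1.deriv_eq, e5.deriv, h2, hJ', divv]
  simp only [fun k => pd_congr (i := k) (e2 k), e3, e4, Fin.sum_univ_three]
  ring

end IsLocalFlow

/-! ### Families depending on a parameter, time and space -/

section ThreeVariables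

variable {V : Type*} [NormedAddCommGroup V] [NormedSpace ℝ V]

/-- `f (ε, t, x)` is smooth near the point `(ε, t, x)`. -/
def SmoothAt₃ (f : ℝ → ℝ → Space → V) (ε t : ℝ) (x : Space) : Prop :=
  ContDiffAt ℝ ∞ (fun p : ℝ × ℝ × Space => f p.1 p.2.1 p.2.2) (ε, t, x)

namespace SmoothAt₃

variable {f : ℝ → ℝ → Space → V} {ε t : ℝ} {x : Space}

theorem slice (h : SmoothAt₃ f ε t x) : SmoothAt (f ε) t x :=
  ContDiffAt.comp (t, x) (f := fun p : ℝ × Space => (ε, p.1, p.2)) h (by fun_prop)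

theorem slice_time (h : SmoothAt₃ f ε t x) : SmoothAt (fun e y => f e t y) ε x :=
  ContDiffAt.comp (ε, x) (f := fun p : ℝ × Space => (p.1, t, p.2)) h (by fun_prop)

theorem of_smoothAt {g : ℝ → Space → V} (h : SmoothAt g t x) : SmoothAt₃ (fun _ => g) ε t x :=
  ContDiffAt.comp (ε, t, x) (g := fun p : ℝ × Space => g p.1 p.2)
    (f := fun p : ℝ × ℝ × Space => p.2) h contDiffAt_snd

theorem hasDerivAt_eps {F : ℝ × ℝ × Space → V} (hF : DifferentiableAt ℝ F (ε, t, x)) :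
    HasDerivAt (fun e => F (e, t, x)) (fderiv ℝ F (ε, t, x) (1, 0, 0)) ε := by
  have h1 : HasFDerivAt (fun e : ℝ => (e, t, x)) (ContinuousLinearMap.inl ℝ ℝ (ℝ × Space)) ε :=
    hasFDerivAt_prodMk_left ε (t, x)
  have h' : HasFDerivAt (fun e => F (e, t, x)) _ ε :=
    HasFDerivAt.comp (g := F) (f := fun e : ℝ => (e, t, x)) ε hF.hasFDerivAt h1
  simpa [← Prod.zero_eq_mk] using h'.hasDerivAt

theorem hasDerivAt_time {F : ℝ × ℝ × Space → V} (hF : DifferentiableAt ℝ F (ε, t, x)) :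
    HasDerivAt (fun τ => F (ε, τ, x)) (fderiv ℝ F (ε, t, x) (0, 1, 0)) t := by
  have h1 : HasFDerivAt (fun τ : ℝ => (ε, τ, x)) ((ContinuousLinearMap.inr ℝ ℝ (ℝ × Space)).comp
      (ContinuousLinearMap.inl ℝ ℝ Space)) t :=
    (hasFDerivAt_prodMk_right ε (t, x)).comp t (hasFDerivAt_prodMk_left t x)
  have h' : HasFDerivAt (fun τ => F (ε, τ, x)) _ t :=
    HasFDerivAt.comp (g := F) (f := fun τ : ℝ => (ε, τ, x)) t hF.hasFDerivAt h1
  simpa using h'.hasDerivAt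

theorem deriv_eps (h : SmoothAt₃ f ε t x) :
    SmoothAt₃ (fun ε t x => deriv (fun e => f e t x) ε) ε t x := by
  have h1 : ContDiffAt ℝ ∞ (fun q => _root_.fderiv ℝ (fun p : ℝ × ℝ × Space => f p.1 p.2.1 p.2.2) q
      (1, 0, 0)) (ε, t, x) := (contDiffAt_fderiv_top h).clm_apply contDiffAt_const
  refine h1.congr_of_eventuallyEq ?_
  filter_upwards [eventually_differentiableAt h] with q hq
  exact (hasDerivAt_eps (ε := q.1) (t := q.2.1) (x := q.2.2) hq).deriv

theorem deriv_time (h : SmoothAt₃ f ε t x) :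
    SmoothAt₃ (fun ε t x => deriv (fun τ => f ε τ x) t) ε t x := by
  have h1 : ContDiffAt ℝ ∞ (fun q => _root_.fderiv ℝ (fun p : ℝ × ℝ × Space => f p.1 p.2.1 p.2.2) q
      (0, 1, 0)) (ε, t, x) := (contDiffAt_fderiv_top h).clm_apply contDiffAt_const
  refine h1.congr_of_eventuallyEq ?_
  filter_upwards [eventually_differentiableAt h] with q hq
  exact (hasDerivAt_time (ε := q.1) (t := q.2.1) (x := q.2.2) hq).deriv

theorem fderiv (h : SmoothAt₃ f ε t x) : SmoothAt₃ (fun ε t x => fderiv ℝ (f ε t) x) ε t x := by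
  have h1 : ContDiffAt ℝ ∞ (fun q => (_root_.fderiv ℝ (fun p : ℝ × ℝ × Space => f p.1 p.2.1 p.2.2)
      q).comp ((ContinuousLinearMap.inr ℝ ℝ (ℝ × Space)).comp (ContinuousLinearMap.inr ℝ ℝ Space)))
      (ε, t, x) := (contDiffAt_fderiv_top h).clm_comp contDiffAt_const
  refine h1.congr_of_eventuallyEq ?_
  filter_upwards [eventually_differentiableAt h] with q hq
  have h2 : HasFDerivAt (fun y : Space => (q.1, q.2.1, y)) ((ContinuousLinearMap.inr ℝ ℝ
      (ℝ × Space)).comp (ContinuousLinearMap.inr ℝ ℝ Space)) q.2.2 :=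
    (hasFDerivAt_prodMk_right q.1 (q.2.1, q.2.2)).comp q.2.2 (hasFDerivAt_prodMk_right q.2.1 q.2.2)
  exact (HasFDerivAt.comp (g := fun p : ℝ × ℝ × Space => f p.1 p.2.1 p.2.2)
    (f := fun y : Space => (q.1, q.2.1, y)) q.2.2 hq.hasFDerivAt h2).fderiv

theorem pd {f : ℝ → ℝ → Space → ℝ} (h : SmoothAt₃ f ε t x) (i : Fin 3) :
    SmoothAt₃ (fun ε t x => pd i (f ε t) x) ε t x :=
  ContDiffAt.clm_apply h.fderiv contDiffAt_const

theorem coord {f : ℝ → ℝ → Space → Space} (h : SmoothAt₃ f ε t x) (i : Fin 3) :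
    SmoothAt₃ (fun ε t x => f ε t x i) ε t x :=
  ContDiffAt.comp (ε, t, x) (g := fun v : Space => v i) (by fun_prop) h

theorem entry {f : ℝ → ℝ → Space → Tensor} (h : SmoothAt₃ f ε t x) (i j : Fin 3) :
    SmoothAt₃ (fun ε t x => f ε t x i j) ε t x :=
  ContDiffAt.comp (ε, t, x) (g := fun v : Tensor => v i j) (by fun_prop) h

theorem comp {g : ℝ → ℝ → Space → Space} (hf : SmoothAt₃ f ε t (g ε t x)) (hg : SmoothAt₃ g ε t x) :
    SmoothAt₃ (fun ε t x => f ε t (g ε t x)) ε t x :=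
  ContDiffAt.comp (ε, t, x) (g := fun p : ℝ × ℝ × Space => f p.1 p.2.1 p.2.2)
    (f := fun p : ℝ × ℝ × Space => (p.1, p.2.1, g p.1 p.2.1 p.2.2)) hf
    (contDiffAt_fst.prodMk ((contDiffAt_fst.comp _ contDiffAt_snd).prodMk hg))

/-- Derivatives in the parameter and in time commute. -/
theorem deriv_deriv_comm (h : SmoothAt₃ f ε t x) :
    deriv (fun e => deriv (fun τ => f e τ x) t) ε
      = deriv (fun τ => deriv (fun e => f e τ x) ε) t := by
  have hd := eventually_differentiableAt h
  set F : ℝ × ℝ × Space → V := fun p => f p.1 p.2.1 p.2.2 with hF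
  have hG : ∀ w, DifferentiableAt ℝ (fun q => _root_.fderiv ℝ F q w) (ε, t, x) := fun w =>
    differentiableAt_of_smooth ((contDiffAt_fderiv_top h).clm_apply contDiffAt_const)
  have e1 : (fun e => deriv (fun τ => f e τ x) t) =ᶠ[𝓝 ε]
      fun e => _root_.fderiv ℝ F (e, t, x) (0, 1, 0) := by
    have hc : Tendsto (fun e : ℝ => (e, t, x)) (𝓝 ε) (𝓝 (ε, t, x)) :=
      (by fun_prop : Continuous fun e : ℝ => (e, t, x)).tendsto ε
    filter_upwards [hc.eventually hd] with e he
    exact (hasDerivAt_time he).deriv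
  have e2 : (fun τ => deriv (fun e => f e τ x) ε) =ᶠ[𝓝 t]
      fun τ => _root_.fderiv ℝ F (ε, τ, x) (1, 0, 0) := by
    have hc : Tendsto (fun τ : ℝ => (ε, τ, x)) (𝓝 t) (𝓝 (ε, t, x)) :=
      (by fun_prop : Continuous fun τ : ℝ => (ε, τ, x)).tendsto t
    filter_upwards [hc.eventually hd] with τ hτ
    exact (hasDerivAt_eps hτ).deriv
  rw [e1.deriv_eq, e2.deriv_eq, (hasDerivAt_eps (hG (0, 1, 0))).deriv,
    (hasDerivAt_time (hG (1, 0, 0))).deriv]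
  exact fderiv_fderiv_comm h _ _

end SmoothAt₃

/-- Variation of the Eulerian velocity: `δu = ∂ₜη + u · ∇η - η · ∇u`. -/
theorem deriv_velocity {χ ψ : ℝ → ℝ → Space → Space} {ε t : ℝ} {x : Space}
    (hχ : SmoothAt₃ χ ε t (ψ ε t x))
    (hε : IsLocalFlow (fun e => χ e t) (fun e => ψ e t) ε x) (ht : IsLocalFlow (χ ε) (ψ ε) t x) :
    deriv (fun e => velocity (χ e) (ψ e) t x) ε
      = deriv (fun τ => velocity (fun e => χ e τ) (fun e => ψ e τ) ε x) t
        + fderiv ℝ (velocity (fun e => χ e t) (fun e => ψ e t) ε) x (velocity (χ ε) (ψ ε) t x)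
        - fderiv ℝ (velocity (χ ε) (ψ ε) t) x
            (velocity (fun e => χ e t) (fun e => ψ e t) ε x) := by
  have h1 := hε.deriv_comp_inv (f := fun e X => deriv (fun τ => χ e τ X) t) hχ.deriv_time.slice_time
  have h2 := ht.deriv_comp_inv (f := fun τ X => deriv (fun e => χ e τ X) ε) hχ.deriv_eps.slice
  have h3 := hχ.deriv_deriv_comm
  rw [eq_sub_iff_add_eq] at h2
  refine h1.trans ?_
  rw [h3, ← h2]
  rfl

end ThreeVariables

/-! ### Motions up to the boundary -/

namespace IsMotion

variable {T : ℝ} {Ω₀ Ω : Set Space} {χ ψ : ℝ → Space → Space} {t : ℝ} {x : Space}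

theorem continuousOn (h : IsMotion T Ω₀ Ω χ ψ) (ht : t ∈ Icc 0 T) :
    ContinuousOn (χ t) (closure Ω₀) := fun X hX =>
  (SmoothAt.slice (h.smooth t ht X hX)).continuousAt.continuousWithinAt

theorem continuousOn_inv (h : IsMotion T Ω₀ Ω χ ψ) (ht : t ∈ Icc 0 T) :
    ContinuousOn (ψ t) (closure Ω) := fun X hX =>
  (SmoothAt.slice (h.smooth_inv t ht X hX)).continuousAt.continuousWithinAt

theorem mapsTo_inv_closure (h : IsMotion T Ω₀ Ω χ ψ) (ht : t ∈ Icc 0 T) :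
    MapsTo (ψ t) (closure Ω) (closure Ω₀) :=
  (h.mapsTo_inv t ht).closure_of_continuousOn (h.continuousOn_inv ht)

theorem apply_inv (h : IsMotion T Ω₀ Ω χ ψ) (ht : t ∈ Icc 0 T) (hx : x ∈ closure Ω) :
    χ t (ψ t x) = x := by
  have h1 : EqOn (fun y => χ t (ψ t y)) id Ω := fun y hy => h.right_inv t ht hy
  exact h1.of_subset_closure ((h.continuousOn ht).comp (h.continuousOn_inv ht)
    (h.mapsTo_inv_closure ht)) continuousOn_id subset_closure subset_rfl hx

/-- The derivative of the inverse motion is inverse to that of the motion up to the boundary. -/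
theorem fderiv_comp_inv (h : IsMotion T Ω₀ Ω χ ψ) (hΩ : IsOpen Ω) (ht : t ∈ Icc 0 T)
    (hx : x ∈ closure Ω) (v : Space) :
    fderiv ℝ (χ t) (ψ t x) (fderiv ℝ (ψ t) x v) = v := by
  have h1 : EqOn (fun y => fderiv ℝ (χ t) (ψ t y) (fderiv ℝ (ψ t) y v)) (fun _ => v) Ω := by
    intro y hy
    have hψ := h.smooth_inv t ht y (subset_closure hy)
    have hχ := h.smooth t ht _ (h.mapsTo_inv_closure ht (subset_closure hy))
    have e : (fun z => χ t (ψ t z)) =ᶠ[𝓝 y] fun z => z := by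
      filter_upwards [hΩ.mem_nhds hy] with z hz using h.right_inv t ht hz
    have e2 := SmoothAt.fderiv_comp hχ hψ v
    rw [e.fderiv_eq, fderiv_fun_id] at e2
    exact e2.symm
  refine h1.of_subset_closure (fun y hy => ?_) continuousOn_const subset_closure subset_rfl hx
  have hψ : SmoothAt ψ t y := h.smooth_inv t ht y hy
  have hχ : SmoothAt χ t (ψ t y) := h.smooth t ht _ (h.mapsTo_inv_closure ht hy)
  exact ((hχ.fderiv.comp hψ).clm_apply (hψ.fderiv.clm_apply
    (SmoothAt.const v))).slice.continuousAt.continuousWithinAt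

theorem det_ne_zero (h : IsMotion T Ω₀ Ω χ ψ) (hΩ : IsOpen Ω) (ht : t ∈ Icc 0 T)
    (hx : x ∈ closure Ω) : (fderiv ℝ (ψ t) x).det ≠ 0 := by
  have e : (fderiv ℝ (χ t) (ψ t x)).comp (fderiv ℝ (ψ t) x) = ContinuousLinearMap.id ℝ Space := by
    ext1 v; exact h.fderiv_comp_inv hΩ ht hx v
  intro h0
  have e3 : LinearMap.det ((fderiv ℝ (χ t) (ψ t x) : Space →ₗ[ℝ] Space) ∘ₗ
      (fderiv ℝ (ψ t) x : Space →ₗ[ℝ] Space)) = LinearMap.det (LinearMap.id : Space →ₗ[ℝ] Space) :=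
    congrArg ContinuousLinearMap.det e
  rw [ContinuousLinearMap.det] at h0
  rw [LinearMap.det_comp, h0, mul_zero, LinearMap.det_id] at e3
  exact zero_ne_one e3

theorem pushDensity_pos (h : IsMotion T Ω₀ Ω χ ψ) (hΩ : IsOpen Ω) {r : Space → ℝ}
    (hr : ∀ X ∈ closure Ω₀, 0 < r X) (ht : t ∈ Icc 0 T) (hx : x ∈ closure Ω) :
    0 < pushDensity ψ r t x :=
  mul_pos (hr _ (h.mapsTo_inv_closure ht hx)) (abs_pos.2 (h.det_ne_zero hΩ ht hx))

theorem finger_symm (χ ψ : ℝ → Space → Space) (t : ℝ) (x : Space) (i j : Fin 3) :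
    finger χ ψ t x i j = finger χ ψ t x j i :=
  Finset.sum_congr rfl fun _ _ => mul_comm _ _

theorem finger_pos (h : IsMotion T Ω₀ Ω χ ψ) (hΩ : IsOpen Ω) (ht : t ∈ Icc 0 T)
    (hx : x ∈ closure Ω) (v : Fin 3 → ℝ) (hv : v ≠ 0) :
    0 < ∑ i, ∑ j, v i * finger χ ψ t x i j * v j := by
  set F : Fin 3 → Fin 3 → ℝ := fun i A => pd A (fun X => χ t X i) (ψ t x) with hF
  have e : ∑ i, ∑ j, v i * finger χ ψ t x i j * v j = ∑ A, (∑ i, v i * F i A) ^ 2 := by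
    simp only [finger, Fin.sum_univ_three, hF]; ring
  rw [e]
  refine lt_of_le_of_ne (Finset.sum_nonneg fun A _ => sq_nonneg _) fun h0 => hv ?_
  have h1 : ∀ A, ∑ i, v i * F i A = 0 := fun A => by
    have := (Finset.sum_eq_zero_iff_of_nonneg fun A _ => sq_nonneg _).1 h0.symm A
      (Finset.mem_univ A)
    exact pow_eq_zero_iff (two_ne_zero) |>.1 this
  -- `v` is orthogonal to the range of the deformation gradient, which is onto
  set w : Space := fderiv ℝ (ψ t) x (WithLp.toLp 2 v) with hw
  have h2 : ∀ i, v i = ∑ A, w A * F i A := fun i => by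
    have h3 := congrArg (fun z : Space => z i) (h.fderiv_comp_inv hΩ ht hx (WithLp.toLp 2 v))
    have hχ : SmoothAt χ t (ψ t x) := h.smooth t ht _ (h.mapsTo_inv_closure ht hx)
    rw [fderiv_coord_eq_sum hχ.dx] at h3
    exact h3.symm
  have h4 : ∑ i, v i * v i = 0 := by
    have h5 : ∑ i, v i * v i = ∑ A, w A * ∑ i, v i * F i A := by
      have h6 : ∑ i, v i * v i = ∑ i, v i * ∑ A, w A * F i A :=
        Finset.sum_congr rfl fun i _ => by rw [← h2 i]
      rw [h6]
      simp only [Fin.sum_univ_three]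
      ring
    rw [h5]; simp [h1]
  funext i
  exact mul_self_eq_zero.1
    ((Finset.sum_eq_zero_iff_of_nonneg fun i _ => mul_self_nonneg (v i)).1 h4 i (Finset.mem_univ i))

/-- At interior points a motion is a local flow. -/
theorem isLocalFlow (h : IsMotion T Ω₀ Ω χ ψ) (hΩ₀ : IsOpen Ω₀) (hΩ : IsOpen Ω) (ht : t ∈ Ioo 0 T)
    (hx : x ∈ Ω) : IsLocalFlow χ ψ t x where
  smooth := h.smooth t (Ioo_subset_Icc_self ht) _
    (subset_closure (h.mapsTo_inv t (Ioo_subset_Icc_self ht) hx))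
  smooth_inv := h.smooth_inv t (Ioo_subset_Icc_self ht) x (subset_closure hx)
  right_inv := by
    filter_upwards [(isOpen_Ioo.prod hΩ).mem_nhds (mk_mem_prod ht hx)] with p hp
    exact h.right_inv p.1 (Ioo_subset_Icc_self hp.1) hp.2
  left_inv := by
    filter_upwards [(isOpen_Ioo.prod hΩ₀).mem_nhds
      (mk_mem_prod ht (h.mapsTo_inv t (Ioo_subset_Icc_self ht) hx))] with p hp
    exact h.left_inv p.1 (Ioo_subset_Icc_self hp.1) hp.2

end IsMotion

theorem contDiff_det : ContDiff ℝ ∞ (fun A : Space →L[ℝ] Space => A.det) := by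
  have e : (fun A : Space →L[ℝ] Space => A.det) = fun A => Matrix.det
      (Matrix.of fun i j : Fin 3 => A (EuclideanSpace.single j 1) i) := by
    funext A
    rw [ContinuousLinearMap.det,
      ← LinearMap.det_toMatrix (EuclideanSpace.basisFun (Fin 3) ℝ).toBasis]
    congr 1
  rw [e]
  simp only [Matrix.det_fin_three, Matrix.of_apply]
  fun_prop

/-- A family of motions of one medium that depends smoothly on the parameter. -/
structure IsMotionFamily (a T : ℝ) (Ω₀ Ω : Set Space) (χ ψ : ℝ → ℝ → Space → Space) : Prop where
  Ω₀_open : IsOpen Ω₀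
  Ω_open : IsOpen Ω
  motion : ∀ ε ∈ Ioo (-a) a, IsMotion T Ω₀ Ω (χ ε) (ψ ε)
  smooth : SmoothEST a T Ω₀ χ
  smooth_inv : SmoothEST a T Ω ψ

namespace IsMotionFamily

variable {a T : ℝ} {Ω₀ Ω : Set Space} {χ ψ : ℝ → ℝ → Space → Space} {ε t : ℝ} {x : Space}

theorem smoothAt₃ (h : IsMotionFamily a T Ω₀ Ω χ ψ) (hε : ε ∈ Ioo (-a) a) (ht : t ∈ Icc 0 T)
    (hx : x ∈ closure Ω) : SmoothAt₃ χ ε t (ψ ε t x) :=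
  h.smooth ε hε t ht _ ((h.motion ε hε).mapsTo_inv_closure ht hx)

theorem smoothAt₃_inv (h : IsMotionFamily a T Ω₀ Ω χ ψ) (hε : ε ∈ Ioo (-a) a) (ht : t ∈ Icc 0 T)
    (hx : x ∈ closure Ω) : SmoothAt₃ ψ ε t x := h.smooth_inv ε hε t ht x hx

theorem smooth_velocity (h : IsMotionFamily a T Ω₀ Ω χ ψ) :
    SmoothEST a T Ω (fun ε => velocity (χ ε) (ψ ε)) := fun _ hε _ ht _ hx =>
  (h.smoothAt₃ hε ht hx).deriv_time.comp (h.smoothAt₃_inv hε ht hx)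

/-- The displacement field `η` is smooth up to the boundary. -/
theorem smooth_eta (h : IsMotionFamily a T Ω₀ Ω χ ψ) (hε : ε ∈ Ioo (-a) a) :
    SmoothST T Ω (fun t => velocity (fun e => χ e t) (fun e => ψ e t) ε) := fun _ ht _ hx =>
  ((h.smoothAt₃ hε ht hx).deriv_eps.comp (h.smoothAt₃_inv hε ht hx)).slice

theorem smooth_pushDensity (h : IsMotionFamily a T Ω₀ Ω χ ψ) {r : Space → ℝ}
    (hr : ∀ X ∈ closure Ω₀, ContDiffAt ℝ ∞ r X) :
    SmoothEST a T Ω (fun ε => pushDensity (ψ ε) r) := by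
  intro ε hε t ht x hx
  have hψ := h.smoothAt₃_inv hε ht hx
  have h1 : SmoothAt₃ (fun ε t x => r (ψ ε t x)) ε t x :=
    ContDiffAt.comp (ε, t, x) (g := r) (f := fun p : ℝ × ℝ × Space => ψ p.1 p.2.1 p.2.2)
      (hr _ ((h.motion ε hε).mapsTo_inv_closure ht hx)) hψ
  have h2 : SmoothAt₃ (fun ε t x => (fderiv ℝ (ψ ε t) x).det) ε t x :=
    contDiff_det.contDiffAt.comp (ε, t, x) hψ.fderiv
  exact ContDiffAt.mul h1 (ContDiffAt.comp (ε, t, x) (g := fun a : ℝ => |a|)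
    (f := fun p : ℝ × ℝ × Space => (fderiv ℝ (ψ p.1 p.2.1) p.2.2).det)
    (contDiffAt_abs ((h.motion ε hε).det_ne_zero h.Ω_open ht hx)) h2)

theorem smooth_finger (h : IsMotionFamily a T Ω₀ Ω χ ψ) :
    SmoothEST a T Ω (fun ε => finger (χ ε) (ψ ε)) := by
  intro ε hε t ht x hx
  have h1 : ∀ i A, SmoothAt₃ (fun ε t x => pd A (fun X => χ ε t X i) (ψ ε t x)) ε t x := fun i A =>
    (((h.smoothAt₃ hε ht hx).coord i).pd A).comp (h.smoothAt₃_inv hε ht hx)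
  exact contDiffAt_pi.2 fun i => contDiffAt_pi.2 fun j =>
    ContDiffAt.sum fun A _ => ContDiffAt.mul (h1 i A) (h1 j A)

/-- At a fixed time the parameter generates a local flow. -/
theorem isLocalFlow (h : IsMotionFamily a T Ω₀ Ω χ ψ) (hε : ε ∈ Ioo (-a) a) (ht : t ∈ Icc 0 T)
    (hx : x ∈ Ω) : IsLocalFlow (fun e => χ e t) (fun e => ψ e t) ε x where
  smooth := (h.smoothAt₃ hε ht (subset_closure hx)).slice_time
  smooth_inv := (h.smoothAt₃_inv hε ht (subset_closure hx)).slice_time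
  right_inv := by
    filter_upwards [(isOpen_Ioo.prod h.Ω_open).mem_nhds (mk_mem_prod hε hx)] with p hp
    exact (h.motion p.1 hp.1).right_inv t ht hp.2
  left_inv := by
    filter_upwards [(isOpen_Ioo.prod h.Ω₀_open).mem_nhds
      (mk_mem_prod hε ((h.motion ε hε).mapsTo_inv t ht hx))] with p hp
    exact (h.motion p.1 hp.1).left_inv t ht hp.2

end IsMotionFamily

/-! ### States of configurations -/

section States

variable {D : Setup} {a : ℝ} {c : ℝ → Config}

theorem IsVariation.family_f (h : IsVariation D a c) :
    IsMotionFamily a D.T D.Ωf D.Ω (fun ε => (c ε).χf) (fun ε => (c ε).ψf) where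
  Ω₀_open := D.Ωf_open
  Ω_open := D.Ω_open
  motion ε hε := (h.admissible ε hε).motion_f
  smooth := h.χf_smooth
  smooth_inv := h.ψf_smooth

theorem IsVariation.family_s (h : IsVariation D a c) :
    IsMotionFamily a D.T D.Ωs D.Ω (fun ε => (c ε).χs) (fun ε => (c ε).ψs) where
  Ω₀_open := D.Ωs_open
  Ω_open := D.Ω_open
  motion ε hε := (h.admissible ε hε).motion_s
  smooth := h.χs_smooth
  smooth_inv := h.ψs_smooth

theorem IsVariation.zero_mem (h : IsVariation D a c) : (0 : ℝ) ∈ Ioo (-a) a :=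
  ⟨neg_neg_iff_pos.2 h.a_pos, h.a_pos⟩

theorem IsVariation.smoothFamily (h : IsVariation D a c) {sf ss : ℝ → ℝ → Space → ℝ}
    (hf : SmoothEST a D.T D.Ω sf) (hs : SmoothEST a D.T D.Ω ss) :
    SmoothFamily a D.T D.Ω (fun ε t => (c ε).state D (sf ε) (ss ε) t) where
  uf := h.family_f.smooth_velocity
  us := h.family_s.smooth_velocity
  ρf := h.family_f.smooth_pushDensity D.ρf0_smooth
  ρs := h.family_s.smooth_pushDensity D.ρs0_smooth
  sf := hf
  ss := hs
  b := h.family_s.smooth_finger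
  φ := h.φ_smooth

theorem Config.IsAdmissible.isPhysical {c : Config} (h : c.IsAdmissible D) {t : ℝ}
    (ht : t ∈ Icc 0 D.T) (sf ss : ℝ → Space → ℝ) : (c.state D sf ss t).IsPhysical D.Ω where
  ρf_pos _ hx := h.motion_f.pushDensity_pos D.Ω_open D.ρf0_pos ht hx
  ρs_pos _ hx := h.motion_s.pushDensity_pos D.Ω_open D.ρs0_pos ht hx
  φ_pos := h.φ_pos t ht
  φ_lt_one := h.φ_lt_one t ht
  b_symm _ _ := IsMotion.finger_symm _ _ _ _
  b_pos _ hx := h.motion_s.finger_pos D.Ω_open ht hx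

/-- The trivial variation. -/
theorem Config.IsAdmissible.const {c : Config} (h : c.IsAdmissible D) :
    IsVariation D 1 (fun _ => c) where
  a_pos := one_pos
  admissible _ _ := h
  χf_smooth _ _ t ht x hx := SmoothAt₃.of_smoothAt (h.motion_f.smooth t ht x hx)
  ψf_smooth _ _ t ht x hx := SmoothAt₃.of_smoothAt (h.motion_f.smooth_inv t ht x hx)
  χs_smooth _ _ t ht x hx := SmoothAt₃.of_smoothAt (h.motion_s.smooth t ht x hx)
  ψs_smooth _ _ t ht x hx := SmoothAt₃.of_smoothAt (h.motion_s.smooth_inv t ht x hx)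
  φ_smooth _ _ t ht x hx := SmoothAt₃.of_smoothAt (h.φ_smooth t ht x hx)
  μf_smooth _ _ t ht x hx := SmoothAt₃.of_smoothAt (h.μf_smooth t ht x hx)
  μs_smooth _ _ t ht x hx := SmoothAt₃.of_smoothAt (h.μs_smooth t ht x hx)
  ends_f _ _ := by simp [etaF]
  ends_s _ _ := by simp [etaS]

/-- Every smooth density is transported by a variation of the motion with `-div (ρ η)`. -/
theorem IsMotionFamily.hasDerivAt_pushDensity {a T : ℝ} {Ω₀ Ω : Set Space}
    {χ ψ : ℝ → ℝ → Space → Space} (h : IsMotionFamily a T Ω₀ Ω χ ψ) {ε t : ℝ} {x : Space}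
    (hε : ε ∈ Ioo (-a) a) (ht : t ∈ Icc 0 T) (hx : x ∈ Ω) {r : Space → ℝ}
    (hr : ∀ X ∈ closure Ω₀, ContDiffAt ℝ ∞ r X) :
    HasDerivAt (fun e => pushDensity (ψ e) r t x)
      (-divv (fun y => pushDensity (ψ ε) r t y •
        velocity (fun e => χ e t) (fun e => ψ e t) ε y) x) ε := by
  have h1 : ∀ᶠ y in 𝓝 x, IsLocalFlow (fun e => χ e t) (fun e => ψ e t) ε y := by
    filter_upwards [h.Ω_open.mem_nhds hx] with y hy using h.isLocalFlow hε ht hy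
  have hr' : ContDiffAt ℝ ∞ r (ψ ε t x) :=
    hr _ ((h.motion ε hε).mapsTo_inv_closure ht (subset_closure hx))
  have h2 := IsLocalFlow.deriv_pushDensity (r := r) h1 hr'
  have h3 := (IsLocalFlow.smooth_pushDensity (r := r) h1 hr').ds.hasDerivAt
  rw [h2] at h3
  exact h3

theorem divv_congr {v w : Space → Space} {Ω : Set Space} (hΩ : IsOpen Ω) (h : ∀ y ∈ Ω, v y = w y)
    {x : Space} (hx : x ∈ Ω) : divv v x = divv w x := by
  refine Finset.sum_congr rfl fun i _ => pd_congr ?_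
  filter_upwards [hΩ.mem_nhds hx] with y hy
  rw [h y hy]

end States

/-! ### Integrals depending on parameters -/

/-- The open space-time cylinder. -/
def Setup.cyl (D : Setup) : Set (ℝ × Space) := Ioo 0 D.T ×ˢ D.Ω

theorem Setup.isOpen_cyl (D : Setup) : IsOpen D.cyl := isOpen_Ioo.prod D.Ω_open

theorem Setup.isCompact_closure (D : Setup) : IsCompact (closure D.Ω) :=
  D.Ω_bdd.isCompact_closure

theorem Setup.isCompact_cyl (D : Setup) : IsCompact (Icc 0 D.T ×ˢ closure D.Ω) :=
  isCompact_Icc.prod D.isCompact_closure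

theorem Setup.cyl_subset (D : Setup) : D.cyl ⊆ Icc 0 D.T ×ˢ closure D.Ω :=
  prod_mono Ioo_subset_Icc_self subset_closure

theorem volume_lt_top_of_isBounded {Ω : Set Space} (h : Bornology.IsBounded Ω) :
    volume Ω < ⊤ := h.measure_lt_top

section Parametric

variable {D : Setup} {f : ℝ → Space → ℝ}

theorem SmoothST.continuousOn {V : Type*} [NormedAddCommGroup V] [NormedSpace ℝ V] {T : ℝ}
    {Ω : Set Space} {f : ℝ → Space → V} (h : SmoothST T Ω f) :
    ContinuousOn (fun p : ℝ × Space => f p.1 p.2) (Icc 0 T ×ˢ closure Ω) := fun p hp =>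
  (h p.1 hp.1 p.2 hp.2).continuousAt.continuousWithinAt

theorem integrableOn_slice (hf : ContinuousOn (fun p : ℝ × Space => f p.1 p.2)
    (Icc 0 D.T ×ˢ closure D.Ω)) {t : ℝ} (ht : t ∈ Icc 0 D.T) : IntegrableOn (f t) D.Ω := by
  have h1 : ContinuousOn (f t) (closure D.Ω) := hf.comp (f := fun x => (t, x)) (by fun_prop)
    fun x hx => ⟨ht, hx⟩
  exact (h1.integrableOn_compact D.isCompact_closure).mono_set subset_closure

theorem integrableOn_cyl (hf : ContinuousOn (fun p : ℝ × Space => f p.1 p.2)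
    (Icc 0 D.T ×ˢ closure D.Ω)) : IntegrableOn (fun p : ℝ × Space => f p.1 p.2) D.cyl :=
  (hf.integrableOn_compact D.isCompact_cyl).mono_set D.cyl_subset

theorem continuousOn_integral_slice (hf : ContinuousOn (fun p : ℝ × Space => f p.1 p.2)
    (Icc 0 D.T ×ˢ closure D.Ω)) : ContinuousOn (fun t => ∫ x in D.Ω, f t x) (Icc 0 D.T) := by
  obtain ⟨C, hC⟩ := D.isCompact_cyl.exists_bound_of_continuousOn hf
  have : IsFiniteMeasure (volume.restrict D.Ω) :=
    ⟨by simpa using volume_lt_top_of_isBounded D.Ω_bdd⟩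
  refine continuousOn_of_dominated (bound := fun _ => C) (fun t ht => ?_) (fun t ht => ?_)
    (integrable_const C) ?_
  · exact (integrableOn_slice hf ht).aestronglyMeasurable
  · filter_upwards [ae_restrict_mem D.Ω_open.measurableSet] with x hx
    exact hC (t, x) ⟨ht, subset_closure hx⟩
  · filter_upwards [ae_restrict_mem D.Ω_open.measurableSet] with x hx
    exact hf.comp (f := fun t => (t, x)) (by fun_prop) fun t ht => ⟨ht, subset_closure hx⟩

theorem integral_integral_eq_cyl (hf : ContinuousOn (fun p : ℝ × Space => f p.1 p.2)
    (Icc 0 D.T ×ˢ closure D.Ω)) :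
    ∫ t in (0 : ℝ)..D.T, ∫ x in D.Ω, f t x = ∫ p in D.cyl, f p.1 p.2 := by
  rw [intervalIntegral.integral_of_le D.T_pos.le, integral_Ioc_eq_integral_Ioo, Setup.cyl,
    Measure.volume_eq_prod, setIntegral_prod]
  exact integrableOn_cyl hf

/-- Differentiation under the integral sign on a set of finite measure, with bounded derivative. -/
theorem hasDerivAt_setIntegral {α : Type*} [MeasurableSpace α] {μ : Measure α} {s : Set α}
    (hs : MeasurableSet s) (hμ : μ s < ⊤) {f f' : ℝ → α → ℝ} {ε₀ : ℝ} {u : Set ℝ} (hu : u ∈ 𝓝 ε₀)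
    (hf : ∀ ε ∈ u, IntegrableOn (f ε) s μ) (hf' : AEStronglyMeasurable (f' ε₀) (μ.restrict s))
    {C : ℝ} (hC : ∀ ε ∈ u, ∀ x ∈ s, ‖f' ε x‖ ≤ C)
    (hd : ∀ ε ∈ u, ∀ x ∈ s, HasDerivAt (fun e => f e x) (f' ε x) ε) :
    HasDerivAt (fun e => ∫ x in s, f e x ∂μ) (∫ x in s, f' ε₀ x ∂μ) ε₀ := by
  have : IsFiniteMeasure (μ.restrict s) := ⟨by simpa using hμ⟩
  refine (hasDerivAt_integral_of_dominated_loc_of_deriv_le (bound := fun _ => C) hu ?_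
    (hf ε₀ (mem_of_mem_nhds hu)) hf' ?_ (integrable_const C) ?_).2
  · filter_upwards [hu] with ε hε using (hf ε hε).aestronglyMeasurable
  · filter_upwards [ae_restrict_mem hs] with x hx ε hε using hC ε hε x hx
  · filter_upwards [ae_restrict_mem hs] with x hx ε hε using hd ε hε x hx

end Parametric

section SmoothEST

variable {V : Type*} [NormedAddCommGroup V] [NormedSpace ℝ V] {a T : ℝ} {Ω : Set Space}
  {f : ℝ → ℝ → Space → V}

theorem SmoothEST.slice (h : SmoothEST a T Ω f) {ε : ℝ} (hε : ε ∈ Ioo (-a) a) :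
    SmoothST T Ω (f ε) := fun t ht x hx => SmoothAt₃.slice (h ε hε t ht x hx)

theorem SmoothEST.deriv_eps (h : SmoothEST a T Ω f) :
    SmoothEST a T Ω (fun ε t x => deriv (fun e => f e t x) ε) := fun ε hε t ht x hx =>
  SmoothAt₃.deriv_eps (h ε hε t ht x hx)

theorem SmoothEST.hasDerivAt (h : SmoothEST a T Ω f) {ε t : ℝ} {x : Space} (hε : ε ∈ Ioo (-a) a)
    (ht : t ∈ Icc 0 T) (hx : x ∈ closure Ω) :
    HasDerivAt (fun e => f e t x) (deriv (fun e => f e t x) ε) ε :=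
  (SmoothAt₃.hasDerivAt_eps
    (differentiableAt_of_smooth (h ε hε t ht x hx))).differentiableAt.hasDerivAt

theorem SmoothEST.mul {f g : ℝ → ℝ → Space → ℝ} (hf : SmoothEST a T Ω f) (hg : SmoothEST a T Ω g) :
    SmoothEST a T Ω (fun ε t x => f ε t x * g ε t x) := fun ε hε t ht x hx =>
  ContDiffAt.mul (hf ε hε t ht x hx) (hg ε hε t ht x hx)

theorem SmoothEST.add {f g : ℝ → ℝ → Space → V} (hf : SmoothEST a T Ω f) (hg : SmoothEST a T Ω g) :
    SmoothEST a T Ω (fun ε t x => f ε t x + g ε t x) := fun ε hε t ht x hx =>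
  ContDiffAt.add (hf ε hε t ht x hx) (hg ε hε t ht x hx)

theorem SmoothEST.sub {f g : ℝ → ℝ → Space → V} (hf : SmoothEST a T Ω f) (hg : SmoothEST a T Ω g) :
    SmoothEST a T Ω (fun ε t x => f ε t x - g ε t x) := fun ε hε t ht x hx =>
  ContDiffAt.sub (hf ε hε t ht x hx) (hg ε hε t ht x hx)

theorem SmoothEST.inner {f g : ℝ → ℝ → Space → Space} (hf : SmoothEST a T Ω f)
    (hg : SmoothEST a T Ω g) :
    SmoothEST a T Ω (fun ε t x => inner ℝ (f ε t x) (g ε t x)) := fun ε hε t ht x hx =>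
  ContDiffAt.inner ℝ (hf ε hε t ht x hx) (hg ε hε t ht x hx)

theorem SmoothEST.contract {f g : ℝ → ℝ → Space → Tensor} (hf : SmoothEST a T Ω f)
    (hg : SmoothEST a T Ω g) :
    SmoothEST a T Ω (fun ε t x => contract (f ε t x) (g ε t x)) := fun ε hε t ht x hx =>
  ContDiffAt.sum fun i _ => ContDiffAt.sum fun j _ => ContDiffAt.mul
    (SmoothAt₃.entry (hf ε hε t ht x hx) i j) (SmoothAt₃.entry (hg ε hε t ht x hx) i j)

theorem SmoothEST.const (v : V) : SmoothEST a T Ω (fun _ _ _ => v) := fun _ _ _ _ _ _ =>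
  contDiffAt_const

/-- A smooth function is bounded, uniformly for parameters near zero. -/
theorem SmoothEST.exists_bound (h : SmoothEST a T Ω f) {ε₀ : ℝ}
    (hε₀ : ε₀ ∈ Ioo (-a) a) (hΩ : IsCompact (closure Ω)) :
    ∃ u ∈ 𝓝 ε₀, u ⊆ Ioo (-a) a ∧ ∃ C, ∀ ε ∈ u, ∀ t ∈ Icc 0 T, ∀ x ∈ closure Ω, ‖f ε t x‖ ≤ C := by
  obtain ⟨u, hu, hus, huc⟩ := local_compact_nhds (isOpen_Ioo.mem_nhds hε₀)
  have hc : ContinuousOn (fun p : ℝ × ℝ × Space => f p.1 p.2.1 p.2.2)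
      (u ×ˢ (Icc 0 T ×ˢ closure Ω)) := fun p hp =>
    (h p.1 (hus hp.1) p.2.1 hp.2.1 p.2.2 hp.2.2).continuousAt.continuousWithinAt
  obtain ⟨C, hC⟩ := (huc.prod (isCompact_Icc.prod hΩ)).exists_bound_of_continuousOn hc
  exact ⟨u, hu, hus, C, fun ε hε t ht x hx => hC (ε, t, x) ⟨hε, ht, hx⟩⟩

end SmoothEST

variable {D : Setup} {a : ℝ}

theorem SmoothEST.hasDerivAt_integral {f : ℝ → ℝ → Space → ℝ} (h : SmoothEST a D.T D.Ω f)
    {ε t : ℝ} (hε : ε ∈ Ioo (-a) a) (ht : t ∈ Icc 0 D.T) :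
    HasDerivAt (fun e => ∫ x in D.Ω, f e t x) (∫ x in D.Ω, deriv (fun e => f e t x) ε) ε := by
  obtain ⟨u, hu, hus, C, hC⟩ := h.deriv_eps.exists_bound hε D.isCompact_closure
  refine hasDerivAt_setIntegral (f' := fun ε x => deriv (fun e => f e t x) ε)
    D.Ω_open.measurableSet (volume_lt_top_of_isBounded D.Ω_bdd) hu (fun e he => ?_) ?_
    (fun e he x hx => hC e he t ht x (subset_closure hx))
    (fun e he x hx => h.hasDerivAt (hus he) ht (subset_closure hx))
  · exact integrableOn_slice (h.slice (hus he)).continuousOn ht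
  · exact (integrableOn_slice (f := fun t x => deriv (fun e => f e t x) ε)
      (h.deriv_eps.slice hε).continuousOn ht).aestronglyMeasurable

/-! ### Derivatives of actions -/

/-- The integrand of `pairing`. -/
def pairingDensity (G : Fields) (F : ℝ → Fields) (ε : ℝ) (x : Space) : ℝ :=
  inner ℝ (G.uf x) (deriv (fun e => (F e).uf x) ε)
    + inner ℝ (G.us x) (deriv (fun e => (F e).us x) ε)
    + G.ρf x * deriv (fun e => (F e).ρf x) ε + G.ρs x * deriv (fun e => (F e).ρs x) ε
    + G.sf x * deriv (fun e => (F e).sf x) ε + G.ss x * deriv (fun e => (F e).ss x) ε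
    + contract (G.b x) (deriv (fun e => (F e).b x) ε)
    + G.φ x * deriv (fun e => (F e).φ x) ε

theorem SmoothFamily.pairingDensity {T : ℝ} {Ω : Set Space} {F G : ℝ → ℝ → Fields}
    (hF : SmoothFamily a T Ω F) (hG : SmoothFamily a T Ω G) :
    SmoothEST a T Ω (fun ε t x => pairingDensity (G ε t) (fun e => F e t) ε x) :=
  (((((((hG.uf.inner hF.uf.deriv_eps).add (hG.us.inner hF.us.deriv_eps)).add
    (hG.ρf.mul hF.ρf.deriv_eps)).add (hG.ρs.mul hF.ρs.deriv_eps)).add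
    (hG.sf.mul hF.sf.deriv_eps)).add (hG.ss.mul hF.ss.deriv_eps)).add
    (hG.b.contract hF.b.deriv_eps)).add (hG.φ.mul hF.φ.deriv_eps)

/-- A functional with smooth derivatives is continuous in time along smooth families of states.
The path is reparametrized by `t = T sin² e`, so that the family parameter `e` runs through all of
`[0, T]`, end points included. -/
theorem IsFunctionalDeriv.continuousOn {T : ℝ} (hT : 0 < T) {Ω : Set Space} {l : Fields → ℝ}
    {dl : Fields → Fields} (hl : IsFunctionalDeriv T Ω l dl) {F : ℝ → ℝ → Fields}
    (hF : SmoothFamily a T Ω F)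
    (hph : ∀ ε ∈ Ioo (-a) a, ∀ t ∈ Icc 0 T, (F ε t).IsPhysical Ω) {ε : ℝ} (hε : ε ∈ Ioo (-a) a) :
    ContinuousOn (fun t => l (F ε t)) (Icc 0 T) := by
  have hmem : ∀ e : ℝ, T * Real.sin e ^ 2 ∈ Icc 0 T := fun e =>
    ⟨by positivity, by nlinarith [Real.sin_sq_le_one e]⟩
  have hS : ∀ {V : Type} [NormedAddCommGroup V] [NormedSpace ℝ V] {f : ℝ → ℝ → Space → V},
      SmoothEST a T Ω f → SmoothEST 2 T Ω (fun e _ => f ε (T * Real.sin e ^ 2)) := by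
    intro V _ _ f hf e _ t _ x hx
    refine ContDiffAt.comp (e, t, x) (g := fun p : ℝ × ℝ × Space => f p.1 p.2.1 p.2.2)
      (f := fun p : ℝ × ℝ × Space => (ε, T * Real.sin p.1 ^ 2, p.2.2)) ?_ (by fun_prop)
    exact hf ε hε _ (hmem e) x hx
  have h1 := hl 2 (fun e _ => F ε (T * Real.sin e ^ 2))
    ⟨hS hF.uf, hS hF.us, hS hF.ρf, hS hF.ρs, hS hF.sf, hS hF.ss, hS hF.b, hS hF.φ⟩
    (fun e _ t _ => hph ε hε _ (hmem e))
  have h2 : ∀ e ∈ Ioo (-2 : ℝ) 2, ContinuousAt (fun e => l (F ε (T * Real.sin e ^ 2))) e :=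
    fun e he => (h1.2 e he 0 ⟨le_rfl, hT.le⟩).2.continuousAt
  intro t ht
  have harc : ∀ s ∈ Icc 0 T, T * Real.sin (Real.arcsin √(s / T)) ^ 2 = s := fun s hs => by
    have h0 : 0 ≤ s / T := div_nonneg hs.1 hT.le
    rw [Real.sin_arcsin (by linarith [Real.sqrt_nonneg (s / T)])
      (Real.sqrt_le_one.2 ((div_le_one hT).2 hs.2)), Real.sq_sqrt h0]
    field_simp
  have hb : Real.arcsin √(t / T) ∈ Ioo (-2 : ℝ) 2 := by
    have h3 := Real.neg_pi_div_two_le_arcsin √(t / T)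
    have h4 := Real.arcsin_le_pi_div_two √(t / T)
    constructor <;> linarith [Real.pi_lt_four]
  have hc : ContinuousAt (fun s => Real.arcsin √(s / T)) t := by fun_prop
  have h5 : ContinuousAt (fun s => l (F ε (T * Real.sin (Real.arcsin √(s / T)) ^ 2))) t :=
    ContinuousAt.comp (g := fun e => l (F ε (T * Real.sin e ^ 2))) (h2 _ hb) hc
  refine h5.continuousWithinAt.congr (fun s hs => ?_) ?_
  · rw [harc s hs]
  · rw [harc t ht]

/-- The first variation of an action that consists of a Lagrangian with smooth functional
derivatives and of the integral of a density. -/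
theorem IsFunctionalDeriv.hasDerivAt_action {l : Fields → ℝ} {dl : Fields → Fields}
    (hl : IsFunctionalDeriv D.T D.Ω l dl) (ha : 0 < a) {F : ℝ → ℝ → Fields}
    (hF : SmoothFamily a D.T D.Ω F)
    (hph : ∀ ε ∈ Ioo (-a) a, ∀ t ∈ Icc 0 D.T, (F ε t).IsPhysical D.Ω) {g : ℝ → ℝ → Space → ℝ}
    (hg : SmoothEST a D.T D.Ω g) :
    IntegrableOn (fun p : ℝ × Space => pairingDensity (dl (F 0 p.1)) (fun e => F e p.1) 0 p.2
      + deriv (fun e => g e p.1 p.2) 0) D.cyl ∧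
    HasDerivAt (fun ε => ∫ t in (0 : ℝ)..D.T, (l (F ε t) + ∫ x in D.Ω, g ε t x))
      (∫ p in D.cyl, (pairingDensity (dl (F 0 p.1)) (fun e => F e p.1) 0 p.2
        + deriv (fun e => g e p.1 p.2) 0)) 0 := by
  obtain ⟨hG, hd⟩ := hl a F hF hph
  have hP := (hF.pairingDensity hG).add hg.deriv_eps
  have h0 : (0 : ℝ) ∈ Ioo (-a) a := ⟨neg_neg_iff_pos.2 ha, ha⟩
  refine ⟨integrableOn_cyl (f := fun t x => pairingDensity (dl (F 0 t)) (fun e => F e t) 0 x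
        + deriv (fun e => g e t x) 0) (hP.slice h0).continuousOn, ?_⟩
  rw [← integral_integral_eq_cyl (f := fun t x => pairingDensity (dl (F 0 t)) (fun e => F e t) 0 x
        + deriv (fun e => g e t x) 0) (hP.slice h0).continuousOn]
  simp only [intervalIntegral.integral_of_le D.T_pos.le, integral_Ioc_eq_integral_Ioo]
  obtain ⟨u, hu, hus, C, hC⟩ := hP.exists_bound h0 D.isCompact_closure
  have hsub : Ioo 0 D.T ⊆ Icc 0 D.T := Ioo_subset_Icc_self
  refine hasDerivAt_setIntegral (f := fun ε t => l (F ε t) + ∫ x in D.Ω, g ε t x)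
    (f' := fun ε t => ∫ x in D.Ω, (pairingDensity (dl (F ε t)) (fun e => F e t) ε x
      + deriv (fun e => g e t x) ε)) (C := C * volume.real D.Ω)
    measurableSet_Ioo (by simp) hu (fun e he => ?_) ?_
    (fun e he t ht => ?_) (fun e he t ht => ?_)
  · have h1 : ContinuousOn (fun t => l (F e t) + ∫ x in D.Ω, g e t x) (Icc 0 D.T) :=
      (hl.continuousOn D.T_pos hF hph (hus he)).add
        (continuousOn_integral_slice (hg.slice (hus he)).continuousOn)
    exact (h1.integrableOn_compact isCompact_Icc).mono_set hsub
  · exact ((continuousOn_integral_slice (hP.slice h0).continuousOn).mono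
      hsub).aestronglyMeasurable measurableSet_Ioo
  · exact norm_setIntegral_le_of_norm_le_const (volume_lt_top_of_isBounded D.Ω_bdd)
      fun x hx => hC e he t (hsub ht) x (subset_closure hx)
  · have h1 := (hd e (hus he) t (hsub ht)).2.add (hg.hasDerivAt_integral (hus he) (hsub ht))
    rw [integral_add]
    · exact h1
    · exact integrableOn_slice (f := fun t x => pairingDensity (dl (F e t)) (fun e => F e t) e x)
        ((hF.pairingDensity hG).slice (hus he)).continuousOn (hsub ht)
    · exact integrableOn_slice (f := fun t x => deriv (fun e => g e t x) e)
        (hg.deriv_eps.slice (hus he)).continuousOn (hsub ht)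

/-! ### Integration by parts in the space-time cylinder -/

section TestFunctions

variable {D : Setup} {V : Type*} [NormedAddCommGroup V] [NormedSpace ℝ V]

/-- Smooth in the open space-time cylinder. -/
def SmoothIn (D : Setup) (f : ℝ → Space → V) : Prop :=
  ∀ t ∈ Ioo 0 D.T, ∀ x ∈ D.Ω, SmoothAt f t x

theorem SmoothST.smoothIn {f : ℝ → Space → V} (h : SmoothST D.T D.Ω f) : SmoothIn D f :=
  fun t ht x hx => h t (Ioo_subset_Icc_self ht) x (subset_closure hx)

/-- Smooth in the open cylinder and vanishing there outside a compact subset. -/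
structure IsTest (D : Setup) (f : ℝ → Space → V) : Prop where
  smooth : SmoothIn D f
  support : ∃ K : Set (ℝ × Space), IsCompact K ∧ K ⊆ D.cyl ∧
    ∀ p ∈ D.cyl, p ∉ K → f p.1 p.2 = 0

theorem IsTest.of_supportedInside {f : ℝ → Space → V} (h : SmoothST D.T D.Ω f)
    (hs : SupportedInside D f) : IsTest D f where
  smooth := h.smoothIn
  support := by
    obtain ⟨K, hK, hKs, h0⟩ := hs
    exact ⟨K, hK, hKs, fun p hp hpK => h0 p.1 (Ioo_subset_Icc_self hp.1) p.2
      (subset_closure hp.2) hpK⟩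

theorem IsTest.mul {f g : ℝ → Space → ℝ} (hg : IsTest D g) (hf : SmoothIn D f) :
    IsTest D (fun t x => f t x * g t x) where
  smooth t ht x hx := (hf t ht x hx).mul (hg.smooth t ht x hx)
  support := by
    obtain ⟨K, hK, hKs, h0⟩ := hg.support
    exact ⟨K, hK, hKs, fun p hp hpK => by simp [h0 p hp hpK]⟩

theorem IsTest.coord {f : ℝ → Space → Space} (hf : IsTest D f) (i : Fin 3) :
    IsTest D (fun t x => f t x i) where
  smooth t ht x hx := (hf.smooth t ht x hx).coord i
  support := by
    obtain ⟨K, hK, hKs, h0⟩ := hf.support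
    exact ⟨K, hK, hKs, fun p hp hpK => by simp [h0 p hp hpK]⟩

/-- A function that is integrable over the cylinder with vanishing integral. -/
def IsNull (D : Setup) (h : ℝ → Space → ℝ) : Prop :=
  IntegrableOn (fun p : ℝ × Space => h p.1 p.2) D.cyl ∧ ∫ p in D.cyl, h p.1 p.2 = 0

namespace IsNull

variable {f g : ℝ → Space → ℝ}

theorem congr (hf : IsNull D f) (h : ∀ t ∈ Ioo 0 D.T, ∀ x ∈ D.Ω, g t x = f t x) : IsNull D g := by
  have h1 : EqOn (fun p : ℝ × Space => f p.1 p.2) (fun p => g p.1 p.2) D.cyl := fun p hp =>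
    (h p.1 hp.1 p.2 hp.2).symm
  have hm := D.isOpen_cyl.measurableSet
  exact ⟨hf.1.congr_fun h1 hm, (setIntegral_congr_fun hm h1).symm.trans hf.2⟩

theorem add (hf : IsNull D f) (hg : IsNull D g) : IsNull D (fun t x => f t x + g t x) :=
  ⟨hf.1.add hg.1, by rw [integral_add hf.1 hg.1, hf.2, hg.2, add_zero]⟩

theorem sub (hf : IsNull D f) (hg : IsNull D g) : IsNull D (fun t x => f t x - g t x) :=
  ⟨hf.1.sub hg.1, by rw [integral_sub hf.1 hg.1, hf.2, hg.2, sub_zero]⟩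

theorem sum {ι : Type*} {u : Finset ι} {f : ι → ℝ → Space → ℝ} (hf : ∀ i ∈ u, IsNull D (f i)) :
    IsNull D (fun t x => ∑ i ∈ u, f i t x) :=
  ⟨integrable_finsetSum u fun i hi => (hf i hi).1, by
    rw [integral_finsetSum u fun i hi => (hf i hi).1]
    exact Finset.sum_eq_zero fun i hi => (hf i hi).2⟩

end IsNull

/-- A test function, extended by zero, is smooth on the whole space-time; the integral of each of
its derivatives vanishes. -/
theorem IsTest.integral_fderiv {f : ℝ → Space → ℝ} (hf : IsTest D f) (v : ℝ × Space) :
    IsNull D (fun t x => fderiv ℝ (fun p : ℝ × Space => f p.1 p.2) (t, x) v) := by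
  obtain ⟨K, hK, hKs, h0⟩ := hf.support
  set B : ℝ × Space → ℝ := D.cyl.indicator (fun p => f p.1 p.2) with hB
  have hz : ∀ p, p ∉ K → B p = 0 := fun p hp => by
    by_cases hc : p ∈ D.cyl
    · rw [hB, indicator_of_mem hc, h0 p hc hp]
    · rw [hB, indicator_of_notMem hc]
  have he : ∀ p ∈ D.cyl, B =ᶠ[𝓝 p] fun p => f p.1 p.2 := fun p hp => by
    filter_upwards [D.isOpen_cyl.mem_nhds hp] with q hq using indicator_of_mem hq _
  have hc : ContDiff ℝ ∞ B := contDiff_iff_contDiffAt.2 fun p => by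
    by_cases hp : p ∈ D.cyl
    · exact ContDiffAt.congr_of_eventuallyEq (hf.smooth p.1 hp.1 p.2 hp.2) (he p hp)
    · have h1 : B =ᶠ[𝓝 p] fun _ => 0 := by
        filter_upwards [hK.isClosed.isOpen_compl.mem_nhds fun h => hp (hKs h)] with q hq
          using hz q hq
      exact contDiffAt_const.congr_of_eventuallyEq h1
  have hsupp : HasCompactSupport B := HasCompactSupport.intro hK fun p hp => hz p hp
  have hint : Integrable (fun p => fderiv ℝ B p v) := by
    refine Continuous.integrable_of_hasCompactSupport ?_ (hsupp.fderiv_apply ℝ v)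
    exact (hc.continuous_fderiv (by simp)).clm_apply continuous_const
  have hint0 : ∫ p, fderiv ℝ B p v = 0 := by
    have : (volume : Measure (ℝ × Space)).IsAddHaarMeasure := by
      rw [Measure.volume_eq_prod]; infer_instance
    -- integration by parts against the constant function `1`
    have h1 := integral_mul_fderiv_eq_neg_fderiv_mul_of_integrable
      (μ := (volume : Measure (ℝ × Space))) (f := fun _ => (1 : ℝ)) (g := B) (v := v) (by simp)
      (by simpa using hint)
      (by simpa using hc.continuous.integrable_of_hasCompactSupport hsupp) (by simp)
      (fun p _ => hc.differentiable (by simp) p)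
    simpa using h1
  have hm := D.isOpen_cyl.measurableSet
  have hEq : EqOn (fun p => fderiv ℝ B p v)
      (fun p => fderiv ℝ (fun p : ℝ × Space => f p.1 p.2) p v) D.cyl := fun p hp => by
    simp only [(he p hp).fderiv_eq]
  refine ⟨hint.integrableOn.congr_fun hEq hm, ?_⟩
  have h2 := (setIntegral_congr_fun (μ := volume) hm hEq).symm
  refine h2.trans ?_
  rw [setIntegral_eq_integral_of_forall_compl_eq_zero, hint0]
  intro p hp
  have h1 : B =ᶠ[𝓝 p] fun _ => 0 := by
    filter_upwards [hK.isClosed.isOpen_compl.mem_nhds fun h => hp (hKs h)] with q hq using hz q hq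
  rw [h1.fderiv_eq]
  simp

theorem IsTest.isNull_deriv {f : ℝ → Space → ℝ} (hf : IsTest D f) :
    IsNull D (fun t x => deriv (fun τ => f τ x) t) :=
  (hf.integral_fderiv (1, 0)).congr fun t ht x hx =>
    (hasDerivAt_slice_left (differentiableAt_of_smooth (hf.smooth t ht x hx))).deriv

theorem IsTest.isNull_pd {f : ℝ → Space → ℝ} (hf : IsTest D f) (i : Fin 3) :
    IsNull D (fun t x => pd i (f t) x) :=
  (hf.integral_fderiv (0, EuclideanSpace.single i 1)).congr fun t ht x hx =>
    fderiv_slice_right (differentiableAt_of_smooth (hf.smooth t ht x hx)) _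

variable {f : ℝ → Space → ℝ} {h : ℝ → Space → ℝ}

theorem IsTest.isNull_mul_deriv (hh : IsTest D h) (hf : SmoothIn D f) :
    IsNull D (fun t x => f t x * deriv (fun τ => h τ x) t + deriv (fun τ => f τ x) t * h t x) :=
  (hh.mul hf).isNull_deriv.congr fun t ht x hx => by
    rw [deriv_fun_mul (hf t ht x hx).ds (hh.smooth t ht x hx).ds]; ring

theorem IsTest.isNull_mul_pd (hh : IsTest D h) (hf : SmoothIn D f) (i : Fin 3) :
    IsNull D (fun t x => f t x * pd i (h t) x + pd i (f t) x * h t x) :=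
  ((hh.mul hf).isNull_pd i).congr fun t ht x hx => by
    rw [pd_mul (hf t ht x hx).dx (hh.smooth t ht x hx).dx]; ring

/-- `∫ g div (r η) = -∫ r η · ∇g`. -/
theorem IsTest.isNull_divv {η : ℝ → Space → Space} (hη : IsTest D η) {g r : ℝ → Space → ℝ}
    (hg : SmoothIn D g) (hr : SmoothIn D r) :
    IsNull D (fun t x => g t x * divv (fun y => r t y • η t y) x
      + r t x * inner ℝ (η t x) (gradient (g t) x)) :=
  (IsNull.sum (u := Finset.univ) fun i _ =>
    ((hη.coord i).mul hr).isNull_mul_pd hg i).congr fun t _ x _ => by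
    simp only [divv, inner_eq_sum, gradient_apply, Fin.sum_univ_three, PiLp.smul_apply, smul_eq_mul]
    ring

/-- Integration by parts of the variation of a velocity against a momentum. -/
theorem IsTest.isNull_velocity {η : ℝ → Space → Space} (hη : IsTest D η) {m u : ℝ → Space → Space}
    (hm : SmoothIn D m) (hu : SmoothIn D u) :
    IsNull D (fun t x => inner ℝ (m t x) (deriv (fun τ => η τ x) t + fderiv ℝ (η t) x (u t x)
        - fderiv ℝ (u t) x (η t x))
      + inner ℝ (deriv (fun τ => m τ x) t + lieMomentum (u t) (m t) x) (η t x)) := by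
  have hmc : ∀ i, SmoothIn D (fun t x => m t x i) := fun i t ht x hx => (hm t ht x hx).coord i
  have huc : ∀ i, SmoothIn D (fun t x => u t x i) := fun i t ht x hx => (hu t ht x hx).coord i
  have h1 := IsNull.sum (u := Finset.univ) fun i _ => (hη.coord i).isNull_mul_deriv (hmc i)
  have h2 := IsNull.sum (u := Finset.univ) fun i _ => IsNull.sum (u := Finset.univ) fun j _ =>
    (hη.coord i).isNull_mul_pd (f := fun t x => m t x i * u t x j)
      (fun t ht x hx => (hmc i t ht x hx).mul (huc j t ht x hx)) j
  refine (h1.add h2).congr fun t ht x hx => ?_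
  have e : ∀ i j, pd j (fun y => m t y i * u t y j) x = _ := fun i j =>
    pd_mul (hmc i t ht x hx).dx (huc j t ht x hx).dx
  simp only [inner_eq_sum, PiLp.add_apply, PiLp.sub_apply, lieMomentum, divv, e,
    deriv_coord (hη.smooth t ht x hx).ds, deriv_coord (hm t ht x hx).ds,
    fderiv_coord_eq_sum (hη.smooth t ht x hx).dx, fderiv_coord_eq_sum (hu t ht x hx).dx]
  simp only [Fin.sum_univ_three]
  ring

/-- `∫ S : ∇η = -∫ div S · η`. -/
theorem IsTest.isNull_stress {η : ℝ → Space → Space} (hη : IsTest D η) {S : ℝ → Space → Tensor}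
    (hS : SmoothIn D S) :
    IsNull D (fun t x => contract (S t x) (gradV (η t) x) + inner ℝ (divT (S t) x) (η t x)) :=
  (IsNull.sum (u := Finset.univ) fun i _ => IsNull.sum (u := Finset.univ) fun j _ =>
    (hη.coord i).isNull_mul_pd (f := fun t x => S t x i j)
      (fun t ht x hx => (hS t ht x hx).entry i j) j).congr fun t _ x _ => by
    simp only [contract, gradV, divT, inner_eq_sum, Fin.sum_univ_three]
    ring

/-- Integration by parts of the variation of the Finger tensor against a symmetric tensor. -/
theorem IsTest.isNull_lieTensor {η : ℝ → Space → Space} (hη : IsTest D η)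
    {P b : ℝ → Space → Tensor} (hP : SmoothIn D P) (hb : SmoothIn D b)
    (hPs : ∀ t ∈ Ioo 0 D.T, ∀ x ∈ D.Ω, ∀ i j, P t x i j = P t x j i)
    (hbs : ∀ t ∈ Ioo 0 D.T, ∀ x ∈ D.Ω, ∀ i j, b t x i j = b t x j i) :
    IsNull D (fun t x => contract (P t x) (-lieTensor (η t) (b t) x)
      + inner ℝ (contractGrad (P t x) (b t) x
          + (2 : ℝ) • divT (fun y => tmul (P t y) (b t y)) x) (η t x)) := by
  have hPb : SmoothIn D (fun t x => tmul (P t x) (b t x)) := fun t ht x hx =>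
    SmoothAt.of_entry fun i j => SmoothAt.sum fun k _ =>
      ((hP t ht x hx).entry i k).mul ((hb t ht x hx).entry k j)
  refine ((hη.isNull_stress hPb).add (hη.isNull_stress hPb)).congr fun t ht x hx => ?_
  have hp := hPs t ht x hx
  have hbb := hbs t ht x hx
  simp only [inner_eq_sum, PiLp.add_apply, PiLp.smul_apply, smul_eq_mul, contractGrad, contract,
    lieTensor, gradV, tmul, Pi.neg_apply, Fin.sum_univ_three, hp 1 0, hp 2 0, hp 2 1, hbb 1 0,
    hbb 2 0, hbb 2 1]
  ring

theorem Dt_eq (u : ℝ → Space → Space) (g : ℝ → Space → ℝ) (t : ℝ) (x : Space) :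
    Dt u g t x = deriv (fun τ => g τ x) t + ∑ i, u t x i * pd i (g t) x := by
  simp only [Dt, inner_eq_sum, gradient_apply]

/-- Integration by parts of the material derivative. -/
theorem IsTest.isNull_Dt {g : ℝ → Space → ℝ} (hg : IsTest D g) {θ : ℝ → Space → ℝ}
    {u : ℝ → Space → Space} (hθ : SmoothIn D θ) (hu : SmoothIn D u) :
    IsNull D (fun t x => θ t x * Dt u g t x + Dbar u θ t x * g t x) := by
  have h2 := IsNull.sum (u := Finset.univ) fun i _ =>
    hg.isNull_mul_pd (f := fun t x => θ t x * u t x i)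
      (fun t ht x hx => (hθ t ht x hx).mul ((hu t ht x hx).coord i)) i
  refine ((hg.isNull_mul_deriv hθ).add h2).congr fun t ht x hx => ?_
  simp only [Dt_eq, Dbar, divv, Fin.sum_univ_three, PiLp.smul_apply, smul_eq_mul]
  ring

/-- The momentum density `θ ∇γ` is transported by the rates of `θ` and `γ`. -/
theorem deriv_add_lieMomentum_smul_gradient {θ γ : ℝ → Space → ℝ} {u : ℝ → Space → Space} {t : ℝ}
    {x : Space} (hθ : SmoothAt θ t x) (hγ : SmoothAt γ t x) (hu : SmoothAt u t x) :
    deriv (fun τ => θ τ x • gradient (γ τ) x) t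
        + lieMomentum (u t) (fun y => θ t y • gradient (γ t) y) x
      = Dbar u θ t x • gradient (γ t) x + θ t x • gradient (Dt u γ t) x := by
  have hg : SmoothAt (fun t x => gradient (γ t) x) t x := SmoothAt.of_coord fun i => by
    simpa only [gradient_apply] using hγ.pd i
  have hd : SmoothAt (fun t x => θ t x • gradient (γ t) x) t x := hθ.smul hg
  have e1 : ∀ i j, pd j (fun y => θ t y * pd i (γ t) y) x = _ := fun i j =>
    pd_mul hθ.dx (hγ.pd i).dx
  have e2 : ∀ i j, pd j (fun y => θ t y * u t y i) x = _ := fun i j =>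
    pd_mul hθ.dx (hu.coord i).dx
  have e3 : ∀ i, pd i (fun y => deriv (fun τ => γ τ y) t + ∑ k, u t y k * pd k (γ t) y) x
      = pd i (fun y => deriv (fun τ => γ τ y) t) x
        + ∑ k, pd i (fun y => u t y k * pd k (γ t) y) x := fun i => by
      rw [pd_add hγ.deriv.dx
        (SmoothAt.sum (u := Finset.univ) fun k _ => (hu.coord k).mul (hγ.pd k)).dx]
      rw [pd_sum fun k _ => ((hu.coord k).mul (hγ.pd k)).dx]
  have e4 : ∀ i k, pd i (fun y => u t y k * pd k (γ t) y) x = _ := fun i k =>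
    pd_mul (hu.coord k).dx (hγ.pd k).dx
  have e5 : ∀ i, deriv (fun τ => θ τ x * pd i (γ τ) x) t = _ := fun i =>
    (hθ.ds.hasDerivAt.mul (hγ.pd i).ds.hasDerivAt).deriv
  have e6 : ∀ i j, pd i (fun y => pd j (γ t) y) x = pd j (fun y => pd i (γ t) y) x := fun i j =>
    pd_comm hγ.slice
  have hD : Dt u γ t = fun y => deriv (fun τ => γ τ y) t + ∑ k, u t y k * pd k (γ t) y :=
    funext fun y => Dt_eq u γ t y
  ext i
  simp only [PiLp.add_apply, deriv_coord hd.ds, lieMomentum, PiLp.smul_apply, smul_eq_mul,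
    gradient_apply, Dbar, divv, hD, e1, e2, e3, e4, e5, hγ.deriv_pd_comm]
  fin_cases i <;> simp only [Fin.sum_univ_three, Fin.zero_eta, Fin.mk_one, Fin.reduceFinMk,
    e6 1 0, e6 2 0, e6 2 1] <;> ring

/-- A smooth function with compact support in the cylinder whose size and Lipschitz constant are
at most `δ`. -/
structure IsSmallTest (D : Setup) (δ : NNReal) (w : ℝ × Space → V) : Prop where
  contDiff : ContDiff ℝ ∞ w
  compact : HasCompactSupport w
  support : tsupport w ⊆ D.cyl
  bound : ∀ p, ‖w p‖ ≤ δ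
  lipschitz : LipschitzWith δ w

theorem IsSmallTest.zero (D : Setup) (δ : NNReal) : IsSmallTest D δ (fun _ => (0 : V)) where
  contDiff := contDiff_const
  compact := HasCompactSupport.zero
  support := by simp [tsupport, Function.support]
  bound p := by simp
  lipschitz := (LipschitzWith.const 0).weaken zero_le

theorem IsSmallTest.mono {δ δ' : NNReal} {w : ℝ × Space → V} (h : IsSmallTest D δ w)
    (hδ : δ ≤ δ') : IsSmallTest D δ' w where
  contDiff := h.contDiff
  compact := h.compact
  support := h.support
  bound p := (h.bound p).trans hδ
  lipschitz := h.lipschitz.weaken hδ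

theorem IsSmallTest.smoothST {δ : NNReal} {w : ℝ × Space → V} (h : IsSmallTest D δ w) :
    SmoothST D.T D.Ω (fun t x => w (t, x)) := fun _ _ _ _ => h.contDiff.contDiffAt

theorem IsSmallTest.supportedInside {δ : NNReal} {w : ℝ × Space → V} (h : IsSmallTest D δ w) :
    SupportedInside D (fun t x => w (t, x)) :=
  ⟨tsupport w, h.compact, h.support, fun _ _ _ _ hp => image_eq_zero_of_notMem_tsupport hp⟩

theorem IsSmallTest.apply_eq_zero {δ : NNReal} {w : ℝ × Space → V} (h : IsSmallTest D δ w)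
    {p : ℝ × Space} (hp : p ∉ D.cyl) : w p = 0 :=
  image_eq_zero_of_notMem_tsupport fun hq => hp (h.support hq)

/-- A small test function in a coordinate direction. -/
theorem IsSmallTest.smul_single {δ : NNReal} {g : ℝ × Space → ℝ} (h : IsSmallTest D δ g)
    (i : Fin 3) : IsSmallTest D δ (fun p => g p • (EuclideanSpace.single i 1 : Space)) where
  contDiff := h.contDiff.smul contDiff_const
  compact := h.compact.smul_right
  support := (tsupport_smul_subset_left g _).trans h.support
  bound p := by simpa [norm_smul] using h.bound p
  lipschitz := LipschitzWith.of_dist_le_mul fun p q => by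
    rw [dist_eq_norm, ← sub_smul, norm_smul, ← dist_eq_norm]
    simpa using h.lipschitz.dist_le_mul p q

/-- The fundamental lemma of the calculus of variations, tested with small functions only. -/
theorem SmoothIn.eq_zero_of_integral {h : ℝ → Space → ℝ} (hh : SmoothIn D h) {δ : NNReal}
    (hδ : 0 < δ)
    (h0 : ∀ g : ℝ × Space → ℝ, IsSmallTest D δ g → ∫ p in D.cyl, h p.1 p.2 * g p = 0) :
    ∀ t ∈ Ioo 0 D.T, ∀ x ∈ D.Ω, h t x = 0 := by
  have hc : ContinuousOn (fun p : ℝ × Space => h p.1 p.2) D.cyl := fun p hp =>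
    (hh p.1 hp.1 p.2 hp.2).continuousAt.continuousWithinAt
  have h1 : ∀ᵐ p : ℝ × Space, p ∈ D.cyl → h p.1 p.2 = 0 := by
    refine D.isOpen_cyl.ae_eq_zero_of_integral_contDiff_smul_eq_zero
      (hc.locallyIntegrableOn D.isOpen_cyl.measurableSet) fun g hg hgs hgc => ?_
    obtain ⟨C, hC⟩ := hg.continuous.bounded_above_of_compact_support hgs
    obtain ⟨L, hL⟩ := hg.lipschitzWith_of_hasCompactSupport hgs (by simp)
    -- an arbitrary test function becomes admissible after multiplication by a small constant
    set κ : NNReal := δ / (1 + ‖C‖₊ + L) with hκ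
    have hden : 0 < 1 + ‖C‖₊ + L := by positivity
    have hκ0 : 0 < κ := div_pos hδ hden
    have hκd : κ * (1 + ‖C‖₊ + L) = δ := div_mul_cancel₀ _ hden.ne'
    have hκd' : (κ : ℝ) * (1 + ‖C‖ + L) = δ := by
      rw [← hκd]; simp
    have h2 := h0 (fun p => (κ : ℝ) * g p) ⟨contDiff_const.mul hg, hgs.mul_left,
      (tsupport_mul_subset_right (f := fun _ => (κ : ℝ)) (g := g)).trans hgc, fun p => ?_, ?_⟩
    · have h3 : ∫ p in D.cyl, h p.1 p.2 * ((κ : ℝ) * g p)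
          = (κ : ℝ) * ∫ p, g p • h p.1 p.2 := by
        rw [← integral_const_mul, setIntegral_eq_integral_of_forall_compl_eq_zero]
        · refine integral_congr_ae (Eventually.of_forall fun p => ?_)
          simp only [smul_eq_mul]; ring
        · intro p hp
          rw [image_eq_zero_of_notMem_tsupport fun hq => hp (hgc hq)]; simp
      rw [h3] at h2
      exact (mul_eq_zero.1 h2).resolve_left (by exact_mod_cast hκ0.ne')
    · rw [norm_mul, Real.norm_of_nonneg κ.coe_nonneg, ← hκd']
      refine mul_le_mul_of_nonneg_left ?_ κ.2
      have := hC p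
      have := Real.le_norm_self C
      linarith [L.coe_nonneg]
    · refine LipschitzWith.weaken (K := κ * L) ?_ ?_
      · refine LipschitzWith.of_dist_le_mul fun p q => ?_
        have := hL.dist_le_mul p q
        rw [Real.dist_eq, ← mul_sub, abs_mul, abs_of_nonneg κ.coe_nonneg, NNReal.coe_mul, mul_assoc]
        exact mul_le_mul_of_nonneg_left this κ.2
      · rw [← hκd]
        gcongr
        exact le_add_of_nonneg_left zero_le
  have h2 := Measure.eqOn_open_of_ae_eq (μ := (volume : Measure (ℝ × Space)))
    (f := fun p : ℝ × Space => h p.1 p.2) (g := fun _ => (0 : ℝ))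
    ((ae_restrict_iff' D.isOpen_cyl.measurableSet).2 h1) D.isOpen_cyl hc continuousOn_const
  exact fun t ht x hx => h2 (mk_mem_prod ht hx)

end TestFunctions

/-! ### Construction of variations -/

/-- A small smooth Lipschitz perturbation of the identity is a diffeomorphism. -/
theorem exists_contDiff_inverse {E : Type*} [NormedAddCommGroup E] [NormedSpace ℝ E]
    [CompleteSpace E] [Nontrivial E] {r : E → E} (hr : ContDiff ℝ ∞ r)
    (hL : LipschitzWith (1 / 2) r) :
    ∃ G : E → E, ContDiff ℝ ∞ G ∧ (∀ p, G (p + r p) = p) ∧ ∀ p, G p + r (G p) = p := by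
  have hA : ApproximatesLinearOn (fun p => p + r p)
      ((ContinuousLinearEquiv.refl ℝ E : E ≃L[ℝ] E) : E →L[ℝ] E) univ (1 / 2 : NNReal) := by
    intro p _ q _
    have h := hL.dist_le_mul p q
    rw [dist_eq_norm, dist_eq_norm] at h
    have e : p + r p - (q + r q)
        - ((ContinuousLinearEquiv.refl ℝ E : E ≃L[ℝ] E) : E →L[ℝ] E) (p - q) = r p - r q := by
      simp; abel
    rw [e]; exact h
  have hc : (1 / 2 : NNReal) <
      ‖(((ContinuousLinearEquiv.refl ℝ E : E ≃L[ℝ] E).symm : E ≃L[ℝ] E) : E →L[ℝ] E)‖₊⁻¹ := by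
    have h1 : ‖(((ContinuousLinearEquiv.refl ℝ E : E ≃L[ℝ] E).symm : E ≃L[ℝ] E) : E →L[ℝ] E)‖₊
        = 1 := by
      ext
      exact ContinuousLinearMap.norm_id
    rw [h1, inv_one]
    exact NNReal.half_lt_self one_ne_zero
  set H : E ≃ₜ E := hA.toHomeomorph _ (Or.inr hc) with hH
  have hHe : ∀ p, H p = p + r p := fun p => rfl
  have hd : ∀ p, ∃ L : E ≃L[ℝ] E, HasFDerivAt H (L : E →L[ℝ] E) p := fun p => by
    have h1 : ‖-fderiv ℝ r p‖ < 1 := by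
      rw [norm_neg]
      refine (norm_fderiv_le_of_lipschitz ℝ hL).trans_lt ?_
      norm_num
    refine ⟨ContinuousLinearEquiv.ofUnit (Units.oneSub _ h1), ?_⟩
    have h2 : HasFDerivAt (fun p => p + r p) (ContinuousLinearMap.id ℝ E + fderiv ℝ r p) p :=
      (hasFDerivAt_id p).add (hr.differentiable (by simp) p).hasFDerivAt
    have e : ((ContinuousLinearEquiv.ofUnit (Units.oneSub _ h1) : E ≃L[ℝ] E) : E →L[ℝ] E)
        = ContinuousLinearMap.id ℝ E + fderiv ℝ r p := by
      ext v
      change (1 - -fderiv ℝ r p) v = _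
      simp
    rw [e]
    exact h2
  choose L hL' using hd
  exact ⟨H.symm, H.contDiff_symm hL' (contDiff_id.add hr), fun p => H.symm_apply_apply p,
    fun p => H.apply_symm_apply p⟩

/-- The displacement `x + sin ε w (t, x)`; the sine keeps it close to the identity for all `ε`. -/
def shift (w : ℝ × Space → Space) (ε t : ℝ) (x : Space) : Space := x + Real.sin ε • w (t, x)

section Shift

variable {D : Setup} {w : ℝ × Space → Space}

theorem contDiff_shift (hw : ContDiff ℝ ∞ w) :
    ContDiff ℝ ∞ (fun p : ℝ × ℝ × Space => shift w p.1 p.2.1 p.2.2) := by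
  unfold shift
  have h1 : ContDiff ℝ ∞ (fun p : ℝ × ℝ × Space => w (p.2.1, p.2.2)) := hw.comp (by fun_prop)
  have h2 : ContDiff ℝ ∞ (fun p : ℝ × ℝ × Space => Real.sin p.1) := by fun_prop
  exact (by fun_prop : ContDiff ℝ ∞ (fun p : ℝ × ℝ × Space => p.2.2)).add (h2.smul h1)

/-- The displacements have inverses that depend smoothly on parameter, time and space jointly: the
map `(ε, t, x) ↦ (ε, t, shift w ε t x)` is a small Lipschitz perturbation of the identity. -/
theorem IsSmallTest.exists_shift_inverse (hw : IsSmallTest D (1 / 4) w) :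
    ∃ Θ : ℝ → ℝ → Space → Space,
      ContDiff ℝ ∞ (fun p : ℝ × ℝ × Space => Θ p.1 p.2.1 p.2.2) ∧
      (∀ ε t x, Θ ε t (shift w ε t x) = x) ∧ ∀ ε t x, shift w ε t (Θ ε t x) = x := by
  set r : ℝ × ℝ × Space → ℝ × ℝ × Space := fun p => (0, 0, Real.sin p.1 • w p.2) with hr
  have hrc : ContDiff ℝ ∞ r := by
    have h1 : ContDiff ℝ ∞ (fun p : ℝ × ℝ × Space => w p.2) := hw.contDiff.comp (by fun_prop)
    have h2 : ContDiff ℝ ∞ (fun p : ℝ × ℝ × Space => Real.sin p.1) := by fun_prop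
    exact contDiff_const.prodMk (contDiff_const.prodMk (h2.smul h1))
  have hrL : LipschitzWith (1 / 2) r := LipschitzWith.of_dist_le_mul fun p q => by
    have e : dist (r p) (r q) = ‖Real.sin p.1 • w p.2 - Real.sin q.1 • w q.2‖ := by
      simp [hr, dist_eq_norm]
    have e2 : Real.sin p.1 • w p.2 - Real.sin q.1 • w q.2
        = (Real.sin p.1 - Real.sin q.1) • w p.2 + Real.sin q.1 • (w p.2 - w q.2) := by
      rw [sub_smul, smul_sub]; abel
    have h1 : |Real.sin p.1 - Real.sin q.1| ≤ dist p q :=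
      (Real.abs_sin_sub_sin_le p.1 q.1).trans (by
        rw [Prod.dist_eq, ← Real.dist_eq]; exact le_max_left _ _)
    have h2 : ‖w p.2 - w q.2‖ ≤ 1 / 4 * dist p q := by
      have := hw.lipschitz.dist_le_mul p.2 q.2
      rw [dist_eq_norm] at this
      refine this.trans ?_
      rw [Prod.dist_eq (x := p)]
      have := le_max_right (dist p.1 q.1) (dist p.2 q.2)
      push_cast
      linarith
    have h3 : ‖w p.2‖ ≤ 1 / 4 := by simpa using hw.bound p.2
    have h4 := Real.abs_sin_le_one q.1
    rw [e, e2]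
    refine (norm_add_le _ _).trans ?_
    rw [norm_smul, norm_smul, Real.norm_eq_abs, Real.norm_eq_abs]
    have h5 := mul_le_mul h1 h3 (norm_nonneg _) dist_nonneg
    have h6 := mul_le_mul h4 h2 (norm_nonneg _) zero_le_one
    push_cast
    linarith
  obtain ⟨G, hG, hG1, hG2⟩ := exists_contDiff_inverse hrc hrL
  have e1 : ∀ ε t x, ((ε, t, x) : ℝ × ℝ × Space) + r (ε, t, x) = (ε, t, shift w ε t x) :=
    fun ε t x => by simp [hr, shift]
  refine ⟨fun ε t x => (G (ε, t, x)).2.2, by fun_prop, fun ε t x => ?_, fun ε t x => ?_⟩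
  · change (G (ε, t, shift w ε t x)).2.2 = x
    rw [← e1, hG1]
  · have h1 := hG2 (ε, t, x)
    have h2 : G (ε, t, x) = (ε, t, (G (ε, t, x)).2.2) := by
      have ha := congrArg Prod.fst h1
      have hb := congrArg (fun q => q.2.1) h1
      simp only [hr, Prod.fst_add, Prod.snd_add, add_zero] at ha hb
      exact Prod.ext ha (Prod.ext hb rfl)
    rw [h2, e1] at h1
    exact congrArg (fun q => q.2.2) h1

theorem shift_zero (w : ℝ × Space → Space) (t : ℝ) (x : Space) : shift w 0 t x = x := by
  simp [shift]

/-- Composition of a motion with small displacements supported in the interior: every small test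
field is the displacement field of a family of motions, since `sin` has derivative `1` at `0`. -/
theorem IsMotion.exists_family {Ω₀ : Set Space} (hΩ₀ : IsOpen Ω₀) {χ ψ : ℝ → Space → Space}
    (h : IsMotion D.T Ω₀ D.Ω χ ψ) (hw : IsSmallTest D (1 / 4) w) :
    ∃ X Ψ : ℝ → ℝ → Space → Space, IsMotionFamily 1 D.T Ω₀ D.Ω X Ψ ∧ X 0 = χ ∧ Ψ 0 = ψ ∧
      ∀ t ∈ Icc 0 D.T, ∀ x ∈ closure D.Ω,
        velocity (fun e => X e t) (fun e => Ψ e t) 0 x = w (t, x) := by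
  obtain ⟨Θ, hΘ, hΘ1, hΘ2⟩ := hw.exists_shift_inverse
  have hs := contDiff_shift hw.contDiff
  have hout : ∀ ε t x, t ∈ Icc 0 D.T → x ∉ D.Ω → shift w ε t x = x := fun ε t x _ hx => by
    rw [shift, hw.apply_eq_zero fun hq => hx hq.2, smul_zero, add_zero]
  -- the displacements fix all points outside the interior, hence preserve the interior
  have hmΘ : ∀ ε, ∀ t ∈ Icc 0 D.T, MapsTo (Θ ε t) D.Ω D.Ω := fun ε t ht x hx => by
    by_contra hn
    have := hout ε t _ ht hn
    rw [hΘ2] at this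
    exact hn (this ▸ hx)
  have hm : ∀ ε, ∀ t ∈ Icc 0 D.T, MapsTo (shift w ε t) D.Ω D.Ω := fun ε t ht x hx => by
    by_contra hn
    have h1 := hout ε t _ ht hn
    have h2 := congrArg (Θ ε t) h1
    rw [hΘ1, hΘ1] at h2
    rw [h2] at hn
    exact hn hx
  have hΘx : ∀ ε t, Continuous (Θ ε t) := fun ε t =>
    hΘ.continuous.comp (f := fun x => (ε, t, x)) (by fun_prop)
  have hmc : ∀ ε, ∀ t ∈ Icc 0 D.T, MapsTo (Θ ε t) (closure D.Ω) (closure D.Ω) := fun ε t ht =>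
    (hmΘ ε t ht).closure (hΘx ε t)
  have hΘ0 : ∀ t x, Θ 0 t x = x := fun t x => by
    have := hΘ1 0 t x
    rwa [shift_zero] at this
  have hX : SmoothEST 1 D.T Ω₀ (fun ε t X => shift w ε t (χ t X)) := fun ε _ t ht x hx =>
    SmoothAt₃.comp (f := shift w) hs.contDiffAt (SmoothAt₃.of_smoothAt (h.smooth t ht x hx))
  have hΨ : SmoothEST 1 D.T D.Ω (fun ε t x => ψ t (Θ ε t x)) := fun ε _ t ht x hx =>
    SmoothAt₃.comp (f := fun _ => ψ) (SmoothAt₃.of_smoothAt (h.smooth_inv t ht _ (hmc ε t ht hx)))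
      hΘ.contDiffAt
  refine ⟨fun ε t X => shift w ε t (χ t X), fun ε t x => ψ t (Θ ε t x),
    ⟨hΩ₀, D.Ω_open, fun ε hε => ⟨hX.slice hε, hΨ.slice hε, ?_, ?_, ?_, ?_⟩, hX, hΨ⟩, ?_, ?_, ?_⟩
  · exact fun t ht x hx => hm ε t ht (h.mapsTo t ht hx)
  · exact fun t ht x hx => h.mapsTo_inv t ht (hmΘ ε t ht hx)
  · intro t ht x hx
    simp only [hΘ1]
    exact h.left_inv t ht hx
  · intro t ht x hx
    simp only [h.right_inv t ht (hmΘ ε t ht hx), hΘ2]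
  · funext t X; exact shift_zero w t _
  · funext t x; exact congrArg (ψ t) (hΘ0 t x)
  · intro t ht x hx
    simp only [velocity, hΘ0, h.apply_inv ht hx, shift]
    have h1 : HasDerivAt (fun ε => x + Real.sin ε • w (t, x)) (Real.cos 0 • w (t, x)) 0 :=
      ((Real.hasDerivAt_sin 0).smul_const _).const_add x
    rw [h1.deriv, Real.cos_zero, one_smul]

end Shift

/-- Variations with prescribed displacements and prescribed variations of the other unknowns. -/
theorem Config.IsAdmissible.exists_variation {D : Setup} {c : Config} (hc : c.IsAdmissible D) :
    ∃ δ : NNReal, 0 < δ ∧ ∀ (wf ws : ℝ × Space → Space) (g hf hs : ℝ × Space → ℝ),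
      IsSmallTest D δ wf → IsSmallTest D δ ws → IsSmallTest D δ g → IsSmallTest D δ hf →
      IsSmallTest D δ hs → ∃ C : ℝ → Config, IsVariation D 1 C ∧ C 0 = c ∧
        (∀ t ∈ Icc 0 D.T, ∀ x ∈ closure D.Ω, etaF C t x = wf (t, x) ∧ etaS C t x = ws (t, x)) ∧
        ∀ ε t x, (C ε).φ t x = c.φ t x + ε * g (t, x) ∧ (C ε).μf t x = c.μf t x + ε * hf (t, x) ∧
          (C ε).μs t x = c.μs t x + ε * hs (t, x) := by
  -- by compactness `φ` keeps a distance from `0` and `1`, which bounds the variations of `φ`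
  obtain ⟨δ₁, hδ₁, hb⟩ : ∃ δ₁ : ℝ, 0 < δ₁ ∧ ∀ t ∈ Icc 0 D.T, ∀ x ∈ closure D.Ω,
      δ₁ ≤ c.φ t x ∧ δ₁ ≤ 1 - c.φ t x := by
    rcases (Icc 0 D.T ×ˢ closure D.Ω).eq_empty_or_nonempty with he | hne
    · refine ⟨1, one_pos, fun t ht x hx => ?_⟩
      exact absurd (he ▸ mk_mem_prod ht hx : (t, x) ∈ (∅ : Set (ℝ × Space))) (notMem_empty _)
    · have hcont : ContinuousOn (fun p : ℝ × Space => min (c.φ p.1 p.2) (1 - c.φ p.1 p.2))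
          (Icc 0 D.T ×ˢ closure D.Ω) :=
        ContinuousOn.inf hc.φ_smooth.continuousOn
          (continuousOn_const.sub hc.φ_smooth.continuousOn)
      obtain ⟨p, hp, hmin⟩ := D.isCompact_cyl.exists_isMinOn hne hcont
      refine ⟨min (c.φ p.1 p.2) (1 - c.φ p.1 p.2), lt_min (hc.φ_pos _ hp.1 _ hp.2)
        (sub_pos.2 (hc.φ_lt_one _ hp.1 _ hp.2)), fun t ht x hx => ?_⟩
      exact le_min_iff.1 (hmin (mk_mem_prod ht hx))
  refine ⟨min (1 / 4) ⟨δ₁, hδ₁.le⟩, lt_min (by norm_num) hδ₁, ?_⟩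
  intro wf ws g hf hs hwf hws hg hhf hhs
  have h4 : min (1 / 4) (⟨δ₁, hδ₁.le⟩ : NNReal) ≤ 1 / 4 := min_le_left _ _
  obtain ⟨Xf, Ψf, hFf, hXf, hΨf, hηf⟩ := hc.motion_f.exists_family D.Ωf_open (hwf.mono h4)
  obtain ⟨Xs, Ψs, hFs, hXs, hΨs, hηs⟩ := hc.motion_s.exists_family D.Ωs_open (hws.mono h4)
  have hlin : ∀ {f : ℝ → Space → ℝ} {q : ℝ × Space → ℝ}, SmoothST D.T D.Ω f → ContDiff ℝ ∞ q →
      SmoothEST 1 D.T D.Ω (fun ε t x => f t x + ε * q (t, x)) := by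
    intro f q hf hq ε _ t ht x hx
    refine ContDiffAt.add (SmoothAt₃.of_smoothAt (hf t ht x hx)) ?_
    exact contDiffAt_fst.mul (hq.contDiffAt.comp (ε, t, x) contDiffAt_snd)
  have hgb : ∀ p, ‖g p‖ ≤ δ₁ := fun p => (hg.bound p).trans (by
    exact_mod_cast min_le_right (1 / 4) (⟨δ₁, hδ₁.le⟩ : NNReal))
  have hφ := hlin hc.φ_smooth hg.contDiff
  have hμf := hlin hc.μf_smooth hhf.contDiff
  have hμs := hlin hc.μs_smooth hhs.contDiff
  have hεg : ∀ ε ∈ Ioo (-1 : ℝ) 1, ∀ p, |ε * g p| < δ₁ := fun ε hε p => by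
    rw [abs_mul]
    have h1 : |ε| < 1 := abs_lt.2 hε
    have h2 : |g p| ≤ δ₁ := hgb p
    nlinarith [abs_nonneg ε, abs_nonneg (g p)]
  set C : ℝ → Config := fun ε =>
    { χf := Xf ε, ψf := Ψf ε, χs := Xs ε, ψs := Ψs ε
      φ := fun t x => c.φ t x + ε * g (t, x)
      μf := fun t x => c.μf t x + ε * hf (t, x)
      μs := fun t x => c.μs t x + ε * hs (t, x) } with hC
  have hend : ∀ {w : ℝ × Space → Space}, IsSmallTest D (min (1 / 4) ⟨δ₁, hδ₁.le⟩) w → ∀ x,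
      w (0, x) = 0 ∧ w (D.T, x) = 0 := fun hw x =>
    ⟨hw.apply_eq_zero fun h => lt_irrefl _ h.1.1, hw.apply_eq_zero fun h => lt_irrefl _ h.1.2⟩
  have h0 : (0 : ℝ) ∈ Icc 0 D.T := ⟨le_rfl, D.T_pos.le⟩
  have hT : D.T ∈ Icc 0 D.T := ⟨D.T_pos.le, le_rfl⟩
  have heta : ∀ t ∈ Icc 0 D.T, ∀ x ∈ closure D.Ω,
      etaF C t x = wf (t, x) ∧ etaS C t x = ws (t, x) := fun t ht x hx =>
    ⟨hηf t ht x hx, hηs t ht x hx⟩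
  refine ⟨C, ?_, ?_, heta, fun ε t x => ⟨rfl, rfl, rfl⟩⟩
  · exact
      { a_pos := one_pos
        admissible := fun ε hε =>
          { motion_f := hFf.motion ε hε
            motion_s := hFs.motion ε hε
            φ_smooth := hφ.slice hε
            μf_smooth := hμf.slice hε
            μs_smooth := hμs.slice hε
            φ_pos := fun t ht x hx => by
              have h1 := (hb t ht x hx).1
              have h2 := (abs_lt.1 (hεg ε hε (t, x))).1
              change 0 < c.φ t x + ε * g (t, x)
              linarith
            φ_lt_one := fun t ht x hx => by
              have h1 := (hb t ht x hx).2
              have h2 := (abs_lt.1 (hεg ε hε (t, x))).2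
              change c.φ t x + ε * g (t, x) < 1
              linarith }
        χf_smooth := hFf.smooth
        ψf_smooth := hFf.smooth_inv
        χs_smooth := hFs.smooth
        ψs_smooth := hFs.smooth_inv
        φ_smooth := hφ
        μf_smooth := hμf
        μs_smooth := hμs
        ends_f := fun x hx => by
          rw [(heta 0 h0 x hx).1, (heta D.T hT x hx).1]; exact hend hwf x
        ends_s := fun x hx => by
          rw [(heta 0 h0 x hx).2, (heta D.T hT x hx).2]; exact hend hws x }
  · simp [hC, hXf, hΨf, hXs, hΨs]

/-- Displacements that agree with a test function satisfy the conditions of every class. -/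
theorem VariationClass.allows_of_isSmallTest {D : Setup} (bc : VariationClass) {δ : NNReal}
    {wf ws : ℝ × Space → Space} (hf : IsSmallTest D δ wf) (hs : IsSmallTest D δ ws)
    {ηf ηs : ℝ → Space → Space} (h : ∀ t ∈ Icc 0 D.T, ∀ x ∈ closure D.Ω,
      ηf t x = wf (t, x) ∧ ηs t x = ws (t, x)) : bc.Allows D ηf ηs := by
  have hfr : ∀ {δ : NNReal} {w : ℝ × Space → Space}, IsSmallTest D δ w → ∀ t, ∀ x ∈ frontier D.Ω,
      w (t, x) = 0 := fun hw t x hx => hw.apply_eq_zero fun hq =>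
    (D.Ω_open.frontier_eq ▸ hx).2 hq.2
  have hsup : ∀ {w : ℝ × Space → Space} {η : ℝ → Space → Space}, IsSmallTest D δ w →
      (∀ t ∈ Icc 0 D.T, ∀ x ∈ closure D.Ω, η t x = w (t, x)) → SupportedInside D η := by
    intro w η hw hη
    obtain ⟨K, hK, hKs, h0⟩ := hw.supportedInside
    exact ⟨K, hK, hKs, fun t ht x hx hp => (hη t ht x hx).trans (h0 t ht x hx hp)⟩
  cases bc
  · trivial
  · intro t ht x hx
    rw [(h t ht x (frontier_subset_closure hx)).1, (h t ht x (frontier_subset_closure hx)).2]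
    exact ⟨hfr hf t x hx, hfr hs t x hx⟩
  · intro t ht x hx
    rw [(h t ht x (frontier_subset_closure hx)).2]
    exact hfr hs t x hx
  · exact ⟨hsup hf fun t ht x hx => (h t ht x hx).1, hsup hs fun t ht x hx => (h t ht x hx).2⟩

/-! ### The first variation -/

/-- Fluid momentum balance without the entropy and external forces: what multiplies `η_f` after
integration by parts, when `r` is the density attached to the multiplier `μ`. -/
def residualF (F G : ℝ → Fields) (r μ : ℝ → Space → ℝ) (t : ℝ) (x : Space) : Space :=
  (F t).ρf x • gradient (G t).ρf x - r t x • gradient (μ t) x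
    - (deriv (fun τ => (G τ).uf x) t + lieMomentum (F t).uf (G t).uf x)

/-- Solid momentum balance without the entropy and external forces. -/
def residualS (F G : ℝ → Fields) (r μ : ℝ → Space → ℝ) (t : ℝ) (x : Space) : Space :=
  (F t).ρs x • gradient (G t).ρs x - r t x • gradient (μ t) x
    - (contractGrad ((G t).b x) (F t).b x
      + (2 : ℝ) • divT (fun y => tmul ((G t).b y) ((F t).b y)) x)
    - (deriv (fun τ => (G τ).us x) t + lieMomentum (F t).us (G t).us x)

section

variable {D : Setup} {a : ℝ} {c : ℝ → Config}

theorem Incompressible.solid_smooth (k : Incompressible) {μ : ℝ → ℝ → Space → ℝ}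
    (h : SmoothEST a D.T D.Ω μ) : SmoothEST a D.T D.Ω (fun ε => k.solid (μ ε)) := by
  cases k
  · exact SmoothEST.const 0
  · exact h

/-- The reference volume fraction of the fluid in spatial coordinates. -/
def Config.pushF (D : Setup) (c : Config) : ℝ → Space → ℝ := pushDensity c.ψf D.φf0

/-- The reference volume fraction of the solid in spatial coordinates. -/
def Config.pushS (D : Setup) (c : Config) : ℝ → Space → ℝ :=
  pushDensity c.ψs (fun X => 1 - D.φs0 X)

theorem Setup.one_sub_φs0_smooth (D : Setup) :
    ∀ X ∈ closure D.Ωs, ContDiffAt ℝ ∞ (fun X => 1 - D.φs0 X) X := fun X hX =>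
  contDiffAt_const.sub (D.φs0_smooth X hX)

/-- The integrand of the constraint terms. -/
def constraintDensity (D : Setup) (k : Incompressible) (c : Config) (t : ℝ) (x : Space) : ℝ :=
  c.μf t x * (c.φ t x - c.pushF D t x) + k.solid c.μs t x * ((1 - c.φ t x) - c.pushS D t x)

theorem IsVariation.smooth_pushF (h : IsVariation D a c) :
    SmoothEST a D.T D.Ω (fun ε => (c ε).pushF D) := h.family_f.smooth_pushDensity D.φf0_smooth

theorem IsVariation.smooth_pushS (h : IsVariation D a c) :
    SmoothEST a D.T D.Ω (fun ε => (c ε).pushS D) :=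
  h.family_s.smooth_pushDensity D.one_sub_φs0_smooth

theorem IsVariation.smooth_constraint (h : IsVariation D a c) (k : Incompressible) :
    SmoothEST a D.T D.Ω (fun ε => constraintDensity D k (c ε)) :=
  (h.μf_smooth.mul (h.φ_smooth.sub h.smooth_pushF)).add
    ((k.solid_smooth h.μs_smooth).mul (((SmoothEST.const 1).sub h.φ_smooth).sub h.smooth_pushS))

theorem IsVariation.constraintTerm_eq (h : IsVariation D a c) (k : Incompressible) {ε t : ℝ}
    (hε : ε ∈ Ioo (-a) a) (ht : t ∈ Icc 0 D.T) :
    constraintTerm D k (c ε) t = ∫ x in D.Ω, constraintDensity D k (c ε) t x := by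
  unfold constraintDensity
  rw [integral_add]
  · rfl
  · exact integrableOn_slice (f := fun t x => (c ε).μf t x * ((c ε).φ t x - (c ε).pushF D t x))
      ((h.μf_smooth.mul (h.φ_smooth.sub h.smooth_pushF)).slice hε).continuousOn ht
  · exact integrableOn_slice
      (f := fun t x => k.solid (c ε).μs t x * ((1 - (c ε).φ t x) - (c ε).pushS D t x))
      (((k.solid_smooth h.μs_smooth).mul
        (((SmoothEST.const 1).sub h.φ_smooth).sub h.smooth_pushS)).slice hε).continuousOn ht

theorem IsVariation.smooth_etaF (h : IsVariation D a c) : SmoothST D.T D.Ω (etaF c) :=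
  h.family_f.smooth_eta h.zero_mem

theorem IsVariation.smooth_etaS (h : IsVariation D a c) : SmoothST D.T D.Ω (etaS c) :=
  h.family_s.smooth_eta h.zero_mem

variable {sf ss : ℝ → ℝ → Space → ℝ} {l : Fields → ℝ} {dl : Fields → Fields}

/-- The density of the first variation after integration by parts. -/
def variationDensity (D : Setup) (k : Incompressible) (dl : Fields → Fields) (c : ℝ → Config)
    (sf ss : ℝ → ℝ → Space → ℝ) (t : ℝ) (x : Space) : ℝ :=
  inner ℝ (residualF ((c 0).state D (sf 0) (ss 0)) (fun t => dl ((c 0).state D (sf 0) (ss 0) t))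
      ((c 0).pushF D) (c 0).μf t x) (etaF c t x)
    + inner ℝ (residualS ((c 0).state D (sf 0) (ss 0))
      (fun t => dl ((c 0).state D (sf 0) (ss 0) t)) ((c 0).pushS D) (k.solid (c 0).μs) t x)
      (etaS c t x)
    + (dl ((c 0).state D (sf 0) (ss 0) t)).sf x * deriv (fun e => sf e t x) 0
    + (dl ((c 0).state D (sf 0) (ss 0) t)).ss x * deriv (fun e => ss e t x) 0
    + ((dl ((c 0).state D (sf 0) (ss 0) t)).φ x + (c 0).μf t x - k.solid (c 0).μs t x)
      * deriv (fun e => (c e).φ t x) 0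
    + ((c 0).φ t x - (c 0).pushF D t x) * deriv (fun e => (c e).μf t x) 0
    + ((1 - (c 0).φ t x) - (c 0).pushS D t x) * deriv (fun e => k.solid (c e).μs t x) 0

/-- Before and after integration by parts the densities of the first variation differ by a
function with vanishing integral. -/
theorem IsVariation.isNull_sub (h : IsVariation D a c) (hl : IsFunctionalDeriv D.T D.Ω l dl)
    (k : Incompressible) (hsf : SmoothEST a D.T D.Ω sf) (hss : SmoothEST a D.T D.Ω ss)
    (hηf : IsTest D (etaF c)) (hηs : IsTest D (etaS c)) :
    IsNull D (fun t x => pairingDensity (dl ((c 0).state D (sf 0) (ss 0) t))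
        (fun e => (c e).state D (sf e) (ss e) t) 0 x
      + deriv (fun e => constraintDensity D k (c e) t x) 0
      - variationDensity D k dl c sf ss t x) := by
  set F : ℝ → ℝ → Fields := fun ε t => (c ε).state D (sf ε) (ss ε) t with hF
  have hFs : SmoothFamily a D.T D.Ω F := h.smoothFamily hsf hss
  have h0 := h.zero_mem
  obtain ⟨hG, hd⟩ := hl a F hFs fun ε hε t ht => (h.admissible ε hε).isPhysical ht _ _
  have hm := fun {V : Type} [NormedAddCommGroup V] [NormedSpace ℝ V] {f : ℝ → ℝ → Space → V}
    (hf : SmoothEST a D.T D.Ω f) => (hf.slice h0).smoothIn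
  -- one integration by parts for each term of the first variation that contains `η_f` or `η_s`
  have n1 := hηf.isNull_velocity (hm hG.uf) (hm hFs.uf)
  have n2 := hηs.isNull_velocity (hm hG.us) (hm hFs.us)
  have n3 := hηf.isNull_divv (hm hG.ρf) (hm hFs.ρf)
  have n4 := hηs.isNull_divv (hm hG.ρs) (hm hFs.ρs)
  have n5 := hηf.isNull_divv (hm h.μf_smooth) (hm h.smooth_pushF)
  have n6 := hηs.isNull_divv (hm (k.solid_smooth h.μs_smooth)) (hm h.smooth_pushS)
  have n7 := hηs.isNull_lieTensor (hm hG.b) (hm hFs.b)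
    (fun t ht x hx => (hd 0 h0 t (Ioo_subset_Icc_self ht)).1 x (subset_closure hx))
    (fun t _ x _ => IsMotion.finger_symm _ _ _ _)
  refine ((((((n1.add n2).sub n3).sub n4).add n5).add n6).add n7).congr fun t ht x hx => ?_
  have ht' := Ioo_subset_Icc_self ht
  have hx' := subset_closure hx
  have hmf := (h.admissible 0 h0).motion_f
  have hms := (h.admissible 0 h0).motion_s
  -- the variations of the Eulerian fields
  have e1 : deriv (fun e => (F e t).uf x) 0 = deriv (fun τ => etaF c τ x) t
      + fderiv ℝ (etaF c t) x ((F 0 t).uf x) - fderiv ℝ (F 0 t).uf x (etaF c t x) :=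
    deriv_velocity (h.family_f.smoothAt₃ h0 ht' hx') (h.family_f.isLocalFlow h0 ht' hx)
      (hmf.isLocalFlow D.Ωf_open D.Ω_open ht hx)
  have e2 : deriv (fun e => (F e t).us x) 0 = deriv (fun τ => etaS c τ x) t
      + fderiv ℝ (etaS c t) x ((F 0 t).us x) - fderiv ℝ (F 0 t).us x (etaS c t x) :=
    deriv_velocity (h.family_s.smoothAt₃ h0 ht' hx') (h.family_s.isLocalFlow h0 ht' hx)
      (hms.isLocalFlow D.Ωs_open D.Ω_open ht hx)
  have e3 : deriv (fun e => (F e t).ρf x) 0 = -divv (fun y => (F 0 t).ρf y • etaF c t y) x :=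
    (h.family_f.hasDerivAt_pushDensity h0 ht' hx D.ρf0_smooth).deriv
  have e4 : deriv (fun e => (F e t).ρs x) 0 = -divv (fun y => (F 0 t).ρs y • etaS c t y) x :=
    (h.family_s.hasDerivAt_pushDensity h0 ht' hx D.ρs0_smooth).deriv
  have e5 : deriv (fun e => (F e t).b x) 0 = -lieTensor (etaS c t) (F 0 t).b x :=
    (h.family_s.isLocalFlow h0 ht' hx).deriv_finger
  have p1 : HasDerivAt (fun e => (c e).pushF D t x)
      (-divv (fun y => (c 0).pushF D t y • etaF c t y) x) 0 :=
    h.family_f.hasDerivAt_pushDensity h0 ht' hx D.φf0_smooth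
  have p2 : HasDerivAt (fun e => (c e).pushS D t x)
      (-divv (fun y => (c 0).pushS D t y • etaS c t y) x) 0 :=
    h.family_s.hasDerivAt_pushDensity h0 ht' hx D.one_sub_φs0_smooth
  have p3 := h.φ_smooth.hasDerivAt h0 ht' hx'
  have p4 := h.μf_smooth.hasDerivAt h0 ht' hx'
  have p5 := (k.solid_smooth h.μs_smooth).hasDerivAt h0 ht' hx'
  have e6 : deriv (fun e => constraintDensity D k (c e) t x) 0 = _ :=
    ((p4.mul (p3.sub p1)).add (p5.mul ((p3.const_sub 1).sub p2))).deriv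
  rw [e6]
  change pairingDensity (dl (F 0 t)) (fun e => F e t) 0 x + _
    - variationDensity D k dl c sf ss t x = _
  simp only [pairingDensity, e1, e2, e3, e4, e5]
  change _ - (inner ℝ (residualF (F 0) (fun t => dl (F 0 t)) ((c 0).pushF D) (c 0).μf t x)
      (etaF c t x)
    + inner ℝ (residualS (F 0) (fun t => dl (F 0 t)) ((c 0).pushS D) (k.solid (c 0).μs) t x)
      (etaS c t x)
    + (dl (F 0 t)).sf x * deriv (fun e => (F e t).sf x) 0
    + (dl (F 0 t)).ss x * deriv (fun e => (F e t).ss x) 0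
    + ((dl (F 0 t)).φ x + (c 0).μf t x - k.solid (c 0).μs t x) * deriv (fun e => (F e t).φ x) 0
    + ((c 0).φ t x - (c 0).pushF D t x) * deriv (fun e => (c e).μf t x) 0
    + ((1 - (c 0).φ t x) - (c 0).pushS D t x) * deriv (fun e => k.solid (c e).μs t x) 0) = _
  have e7 : deriv (fun e => (c e).φ t x) 0 = deriv (fun e => (F e t).φ x) 0 := rfl
  have sF : ∀ v, inner ℝ v (etaF c t x) = inner ℝ (etaF c t x) v := fun v => real_inner_comm _ _
  have sS : ∀ v, inner ℝ v (etaS c t x) = inner ℝ (etaS c t x) v := fun v => real_inner_comm _ _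
  simp only [residualF, residualS, Pi.sub_apply, e7, sF, sS, inner_sub_right (etaF c t x),
    inner_sub_right (etaS c t x), inner_add_right (etaF c t x), inner_add_right (etaS c t x),
    real_inner_smul_right (etaF c t x), real_inner_smul_right (etaS c t x)]
  ring

/-- The first variation of an action with constraint terms and a further density `q`. -/
theorem IsVariation.hasDerivAt_action (h : IsVariation D a c)
    (hl : IsFunctionalDeriv D.T D.Ω l dl) (k : Incompressible) (hsf : SmoothEST a D.T D.Ω sf)
    (hss : SmoothEST a D.T D.Ω ss) (hηf : IsTest D (etaF c)) (hηs : IsTest D (etaS c))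
    {q : ℝ → ℝ → Space → ℝ} (hq : SmoothEST a D.T D.Ω q) :
    IntegrableOn (fun p : ℝ × Space => variationDensity D k dl c sf ss p.1 p.2
      + deriv (fun e => q e p.1 p.2) 0) D.cyl ∧
    HasDerivAt (fun ε => ∫ t in (0 : ℝ)..D.T, (l ((c ε).state D (sf ε) (ss ε) t)
        + constraintTerm D k (c ε) t + ∫ x in D.Ω, q ε t x))
      (∫ p in D.cyl, (variationDensity D k dl c sf ss p.1 p.2
        + deriv (fun e => q e p.1 p.2) 0)) 0 := by
  have h0 := h.zero_mem
  have hcs := h.smooth_constraint k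
  obtain ⟨hi, hd⟩ := hl.hasDerivAt_action h.a_pos (h.smoothFamily hsf hss)
    (fun ε hε t ht => (h.admissible ε hε).isPhysical ht _ _) (hcs.add hq)
  have hn := h.isNull_sub hl k hsf hss hηf hηs
  have hder : ∀ p ∈ D.cyl, deriv (fun e => constraintDensity D k (c e) p.1 p.2 + q e p.1 p.2) 0
      = deriv (fun e => constraintDensity D k (c e) p.1 p.2) 0 + deriv (fun e => q e p.1 p.2) 0 :=
    fun p hp => deriv_fun_add
      (hcs.hasDerivAt h0 (Ioo_subset_Icc_self hp.1) (subset_closure hp.2)).differentiableAt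
      (hq.hasDerivAt h0 (Ioo_subset_Icc_self hp.1) (subset_closure hp.2)).differentiableAt
  have hm := D.isOpen_cyl.measurableSet
  have hE : EqOn (fun p : ℝ × Space => pairingDensity (dl ((c 0).state D (sf 0) (ss 0) p.1))
        (fun e => (c e).state D (sf e) (ss e) p.1) 0 p.2
      + deriv (fun e => constraintDensity D k (c e) p.1 p.2 + q e p.1 p.2) 0
      - (pairingDensity (dl ((c 0).state D (sf 0) (ss 0) p.1))
        (fun e => (c e).state D (sf e) (ss e) p.1) 0 p.2
      + deriv (fun e => constraintDensity D k (c e) p.1 p.2) 0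
      - variationDensity D k dl c sf ss p.1 p.2))
      (fun p => variationDensity D k dl c sf ss p.1 p.2 + deriv (fun e => q e p.1 p.2) 0) D.cyl :=
    fun p hp => by
      simp only [hder p hp]; ring
  refine ⟨(hi.sub hn.1).congr_fun hE hm, ?_⟩
  have hv := setIntegral_congr_fun (μ := volume) hm hE
  rw [integral_sub hi hn.1, hn.2, sub_zero] at hv
  rw [← hv]
  refine hd.congr_of_eventuallyEq ?_
  filter_upwards [isOpen_Ioo.mem_nhds h0] with ε hε
  refine intervalIntegral.integral_congr fun t ht => ?_
  rw [uIcc_of_le D.T_pos.le] at ht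
  rw [h.constraintTerm_eq k hε ht, integral_add, add_assoc]
  · exact integrableOn_slice (f := constraintDensity D k (c ε)) (hcs.slice hε).continuousOn ht
  · exact integrableOn_slice (f := q ε) (hq.slice hε).continuousOn ht

/-! ### Balance of momentum -/

/-- The force density on the fluid, without external forces. -/
def Config.forceF (D : Setup) (dl : Fields → Fields) (c : Config) (F : ℝ → Fields) (t : ℝ)
    (x : Space) : Space :=
  residualF F (fun t => dl (F t)) (c.pushF D) c.μf t x + (F t).sf x • gradient (dl (F t)).sf x

/-- The force density on the solid, without external forces. -/
def Config.forceS (D : Setup) (k : Incompressible) (dl : Fields → Fields) (c : Config)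
    (F : ℝ → Fields) (t : ℝ) (x : Space) : Space :=
  residualS F (fun t => dl (F t)) (c.pushS D) (k.solid c.μs) t x
    + (F t).ss x • gradient (dl (F t)).ss x

/-- The density of the first variation in terms of the force densities. -/
def balanceDensity (D : Setup) (k : Incompressible) (c : ℝ → Config) (P : ℝ → Space → ℝ)
    (Af As : ℝ → Space → Space) (t : ℝ) (x : Space) : ℝ :=
  inner ℝ (Af t x) (etaF c t x) + inner ℝ (As t x) (etaS c t x)
    + P t x * deriv (fun e => (c e).φ t x) 0
    + ((c 0).φ t x - (c 0).pushF D t x) * deriv (fun e => (c e).μf t x) 0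
    + ((1 - (c 0).φ t x) - (c 0).pushS D t x) * deriv (fun e => k.solid (c e).μs t x) 0

/-- The expression whose vanishing is the condition from `δφ`. -/
def Config.fraction (k : Incompressible) (dl : Fields → Fields) (c : Config) (F : ℝ → Fields)
    (t : ℝ) (x : Space) : ℝ := (dl (F t)).φ x + c.μf t x - k.solid c.μs t x

/-- The momentum equations say that the force densities balance, once the constraints hold. -/
theorem generalMomentum_iff {c : Config} {k : Incompressible} {F : ℝ → Fields}
    (hF : ∀ t, (F t).φ = c.φ t)
    (hf : ∀ t ∈ Ioo 0 D.T, ∀ x ∈ D.Ω, c.φ t x = c.pushF D t x)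
    (hs : k = .both → ∀ t ∈ Ioo 0 D.T, ∀ x ∈ D.Ω, 1 - c.φ t x = c.pushS D t x)
    {Ff Fs : ℝ → Space → Space} :
    GeneralMomentum D F (fun t => dl (F t)) c.μf (k.solid c.μs) Ff Fs ↔
      ∀ t ∈ Ioo 0 D.T, ∀ x ∈ D.Ω, c.forceF D dl F t x + Ff t x = 0 ∧
        c.forceS D k dl F t x + Fs t x = 0 ∧ c.fraction k dl F t x = 0 := by
  have hS : ∀ t ∈ Ioo 0 D.T, ∀ x ∈ D.Ω, c.pushS D t x • gradient (k.solid c.μs t) x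
      = (1 - (F t).φ x) • gradient (k.solid c.μs t) x := by
    intro t ht x hx
    cases k
    · have : gradient (fun _ : Space => (0 : ℝ)) x = 0 := by simp [gradient]
      change _ • gradient (fun _ : Space => (0 : ℝ)) x = _ • gradient (fun _ : Space => (0 : ℝ)) x
      rw [this, smul_zero, smul_zero]
    · rw [← hs rfl t ht x hx, hF]
  have eF : ∀ t ∈ Ioo 0 D.T, ∀ x ∈ D.Ω, c.forceF D dl F t x + Ff t x
      = ((F t).ρf x • gradient (dl (F t)).ρf x + (F t).sf x • gradient (dl (F t)).sf x
        - (F t).φ x • gradient (c.μf t) x + Ff t x)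
        - (deriv (fun τ => (dl (F τ)).uf x) t + lieMomentum (F t).uf (dl (F t)).uf x) := by
    intro t ht x hx
    rw [Config.forceF, residualF, ← hf t ht x hx, hF]
    abel
  have eS : ∀ t ∈ Ioo 0 D.T, ∀ x ∈ D.Ω, c.forceS D k dl F t x + Fs t x
      = ((F t).ρs x • gradient (dl (F t)).ρs x + (F t).ss x • gradient (dl (F t)).ss x
        - (1 - (F t).φ x) • gradient (k.solid c.μs t) x
        - contractGrad ((dl (F t)).b x) (F t).b x
        - (2 : ℝ) • divT (fun y => tmul ((dl (F t)).b y) ((F t).b y)) x + Fs t x)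
        - (deriv (fun τ => (dl (F τ)).us x) t + lieMomentum (F t).us (dl (F t)).us x) := by
    intro t ht x hx
    rw [Config.forceS, residualS, hS t ht x hx]
    abel
  constructor
  · intro h t ht x hx
    refine ⟨?_, ?_, h.fraction t ht x hx⟩
    · rw [eF t ht x hx, h.fluid t ht x hx, sub_self]
    · rw [eS t ht x hx, h.solid t ht x hx, sub_self]
  · intro h
    refine ⟨fun t ht x hx => ?_, fun t ht x hx => ?_, fun t ht x hx => (h t ht x hx).2.2⟩
    · exact (sub_eq_zero.1 ((eF t ht x hx).symm.trans (h t ht x hx).1)).symm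
    · exact (sub_eq_zero.1 ((eS t ht x hx).symm.trans (h t ht x hx).2.1)).symm

/-! ### Kinematic equations -/

theorem deriv_pushDensity_add_divv {Ω₀ : Set Space} (hΩ₀ : IsOpen Ω₀) {χ ψ : ℝ → Space → Space}
    (h : IsMotion D.T Ω₀ D.Ω χ ψ) {r : Space → ℝ} (hr : ∀ X ∈ closure Ω₀, ContDiffAt ℝ ∞ r X)
    {t : ℝ} (ht : t ∈ Ioo 0 D.T) {x : Space} (hx : x ∈ D.Ω) :
    deriv (fun τ => pushDensity ψ r τ x) t
      + divv (fun y => pushDensity ψ r t y • velocity χ ψ t y) x = 0 := by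
  rw [IsLocalFlow.deriv_pushDensity (χ := χ), neg_add_cancel]
  · filter_upwards [D.Ω_open.mem_nhds hx] with y hy using h.isLocalFlow hΩ₀ D.Ω_open ht hy
  · exact hr _ (h.mapsTo_inv_closure (Ioo_subset_Icc_self ht) (subset_closure hx))

theorem Config.IsAdmissible.kinematicEqs {c : Config} (h : c.IsAdmissible D)
    (sf ss : ℝ → Space → ℝ) : KinematicEqs D (c.state D sf ss) where
  mass_f _ ht _ hx := deriv_pushDensity_add_divv D.Ωf_open h.motion_f D.ρf0_smooth ht hx
  mass_s _ ht _ hx := deriv_pushDensity_add_divv D.Ωs_open h.motion_s D.ρs0_smooth ht hx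
  strain t ht x hx := by
    have h1 := (h.motion_s.isLocalFlow D.Ωs_open D.Ω_open ht hx).deriv_finger
    exact eq_neg_iff_add_eq_zero.1 h1

theorem Config.IsAdmissible.entropyAdvection {c : Config} (h : c.IsAdmissible D) :
    EntropyAdvection D (c.advState D) where
  fluid _ ht _ hx := deriv_pushDensity_add_divv D.Ωf_open h.motion_f D.sf0_smooth ht hx
  solid _ ht _ hx := deriv_pushDensity_add_divv D.Ωs_open h.motion_s D.ss0_smooth ht hx

theorem Config.IsAdmissible.volumeEqs {c : Config} (h : c.IsAdmissible D) {k : Incompressible}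
    (hf : ∀ t ∈ Ioo 0 D.T, ∀ x ∈ D.Ω, c.φ t x = c.pushF D t x)
    (hs : k = .both → ∀ t ∈ Ioo 0 D.T, ∀ x ∈ D.Ω, 1 - c.φ t x = c.pushS D t x) :
    VolumeEqs D k c where
  constraint_f := hf
  transport_f t ht x hx := by
    have e1 : (fun τ => c.φ τ x) =ᶠ[𝓝 t] fun τ => c.pushF D τ x := by
      filter_upwards [isOpen_Ioo.mem_nhds ht] with τ hτ using hf τ hτ x hx
    rw [e1.deriv_eq, divv_congr (w := fun y => c.pushF D t y • c.uf t y) D.Ω_open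
      (fun y hy => by rw [hf t ht y hy]) hx]
    exact deriv_pushDensity_add_divv D.Ωf_open h.motion_f D.φf0_smooth ht hx
  constraint_s := hs
  transport_s hk t ht x hx := by
    have e1 : (fun τ => 1 - c.φ τ x) =ᶠ[𝓝 t] fun τ => c.pushS D τ x := by
      filter_upwards [isOpen_Ioo.mem_nhds ht] with τ hτ using hs hk τ hτ x hx
    rw [e1.deriv_eq, divv_congr (w := fun y => c.pushS D t y • c.us t y) D.Ω_open
      (fun y hy => by rw [hs hk t ht y hy]) hx]
    exact deriv_pushDensity_add_divv D.Ωs_open h.motion_s D.one_sub_φs0_smooth ht hx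

end

/-! ### Smoothness of the force densities -/

section SmoothOperators

variable {V : Type*} [NormedAddCommGroup V] [NormedSpace ℝ V] {t : ℝ} {x : Space}

theorem SmoothAt.gradient {f : ℝ → Space → ℝ} (h : SmoothAt f t x) :
    SmoothAt (fun t x => gradient (f t) x) t x := SmoothAt.of_coord fun i => by
  simpa only [gradient_apply] using h.pd i

theorem SmoothAt.divv {v : ℝ → Space → Space} (h : SmoothAt v t x) :
    SmoothAt (fun t x => divv (v t) x) t x := SmoothAt.sum fun i _ => (h.coord i).pd i

theorem SmoothAt.divT {S : ℝ → Space → Tensor} (h : SmoothAt S t x) :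
    SmoothAt (fun t x => divT (S t) x) t x :=
  SmoothAt.of_coord fun i => by
    change SmoothAt (fun t x => ∑ j, PorousMedia.pd j (fun y => S t y i j) x) t x
    exact SmoothAt.sum fun j _ => (h.entry i j).pd j

theorem SmoothAt.tmul {A B : ℝ → Space → Tensor} (hA : SmoothAt A t x) (hB : SmoothAt B t x) :
    SmoothAt (fun t x => tmul (A t x) (B t x)) t x :=
  SmoothAt.of_entry fun i k => SmoothAt.sum fun j _ => (hA.entry i j).mul (hB.entry j k)

theorem SmoothAt.contract {A B : ℝ → Space → Tensor} (hA : SmoothAt A t x) (hB : SmoothAt B t x) :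
    SmoothAt (fun t x => contract (A t x) (B t x)) t x :=
  SmoothAt.sum fun i _ => SmoothAt.sum fun j _ => (hA.entry i j).mul (hB.entry i j)

theorem SmoothAt.gradV {v : ℝ → Space → Space} (h : SmoothAt v t x) :
    SmoothAt (fun t x => gradV (v t) x) t x := SmoothAt.of_entry fun i j => (h.coord i).pd j

theorem SmoothAt.contractGrad {A B : ℝ → Space → Tensor} (hA : SmoothAt A t x)
    (hB : SmoothAt B t x) : SmoothAt (fun t x => contractGrad (A t x) (B t) x) t x :=
  SmoothAt.of_coord fun i => by
    change SmoothAt (fun t x => ∑ j, ∑ k, A t x j k * PorousMedia.pd i (fun y => B t y j k) x) t x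
    exact SmoothAt.sum fun j _ => SmoothAt.sum fun k _ => (hA.entry j k).mul ((hB.entry j k).pd i)

theorem SmoothAt.lieMomentum {u m : ℝ → Space → Space} (hu : SmoothAt u t x) (hm : SmoothAt m t x) :
    SmoothAt (fun t x => lieMomentum (u t) (m t) x) t x :=
  SmoothAt.of_coord fun i =>
    ((SmoothAt.sum fun j _ => (hu.coord j).mul ((hm.coord i).pd j)).add
      (SmoothAt.sum fun j _ => (hm.coord j).mul ((hu.coord j).pd i))).add
      ((hm.coord i).mul hu.divv)

theorem SmoothAt.Dt {u : ℝ → Space → Space} {g : ℝ → Space → ℝ} (hu : SmoothAt u t x)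
    (hg : SmoothAt g t x) : SmoothAt (Dt u g) t x := hg.deriv.add (hu.inner hg.gradient)

theorem SmoothAt.Dbar {u : ℝ → Space → Space} {g : ℝ → Space → ℝ} (hu : SmoothAt u t x)
    (hg : SmoothAt g t x) : SmoothAt (Dbar u g) t x := hg.deriv.add (hg.smul hu).divv

end SmoothOperators

section

variable {D : Setup} {c : Config} {l : Fields → ℝ} {dl : Fields → Fields}
  {sf ss : ℝ → Space → ℝ}

/-- The fields of an admissible configuration and its functional derivatives are smooth. -/
theorem Config.IsAdmissible.smooth_state (hc : c.IsAdmissible D)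
    (hl : IsFunctionalDeriv D.T D.Ω l dl) (hsf : SmoothST D.T D.Ω sf) (hss : SmoothST D.T D.Ω ss) :
    SmoothFamily 1 D.T D.Ω (fun _ t => c.state D sf ss t) ∧
    SmoothFamily 1 D.T D.Ω (fun _ t => dl (c.state D sf ss t)) := by
  have h1 : SmoothFamily 1 D.T D.Ω (fun _ t => c.state D sf ss t) := hc.const.smoothFamily
    (sf := fun _ => sf) (ss := fun _ => ss)
    (fun _ _ t ht x hx => SmoothAt₃.of_smoothAt (hsf t ht x hx))
    (fun _ _ t ht x hx => SmoothAt₃.of_smoothAt (hss t ht x hx))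
  exact ⟨h1, (hl 1 _ h1 fun ε _ t ht => hc.isPhysical ht sf ss).1⟩

theorem SmoothEST.smoothIn {V : Type*} [NormedAddCommGroup V] [NormedSpace ℝ V] {a : ℝ}
    {f : ℝ → ℝ → Space → V} (h : SmoothEST a D.T D.Ω f) {ε : ℝ} (hε : ε ∈ Ioo (-a) a) :
    SmoothIn D (f ε) := (h.slice hε).smoothIn

theorem Config.IsAdmissible.smoothIn_pushF (hc : c.IsAdmissible D) : SmoothIn D (c.pushF D) :=
  hc.const.smooth_pushF.smoothIn hc.const.zero_mem

theorem Config.IsAdmissible.smoothIn_pushS (hc : c.IsAdmissible D) : SmoothIn D (c.pushS D) :=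
  hc.const.smooth_pushS.smoothIn hc.const.zero_mem

theorem Config.IsAdmissible.smoothIn_solid (hc : c.IsAdmissible D) (k : Incompressible) :
    SmoothIn D (k.solid c.μs) := by
  cases k
  · exact fun t _ x _ => SmoothAt.const 0
  · exact hc.μs_smooth.smoothIn

theorem Config.IsAdmissible.smoothIn_forceF (hc : c.IsAdmissible D)
    (hl : IsFunctionalDeriv D.T D.Ω l dl) (hsf : SmoothST D.T D.Ω sf) (hss : SmoothST D.T D.Ω ss) :
    SmoothIn D (c.forceF D dl (c.state D sf ss)) := by
  obtain ⟨hF, hG⟩ := hc.smooth_state hl hsf hss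
  have h0 := hc.const.zero_mem
  intro t ht x hx
  have hGu : SmoothAt (fun t => (dl (c.state D sf ss t)).uf) t x := hG.uf.smoothIn h0 t ht x hx
  have hGr : SmoothAt (fun t => (dl (c.state D sf ss t)).ρf) t x := hG.ρf.smoothIn h0 t ht x hx
  have hGs : SmoothAt (fun t => (dl (c.state D sf ss t)).sf) t x := hG.sf.smoothIn h0 t ht x hx
  have hFu : SmoothAt (fun t => (c.state D sf ss t).uf) t x := hF.uf.smoothIn h0 t ht x hx
  have hFr : SmoothAt (fun t => (c.state D sf ss t).ρf) t x := hF.ρf.smoothIn h0 t ht x hx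
  have hFs : SmoothAt (fun t => (c.state D sf ss t).sf) t x := hF.sf.smoothIn h0 t ht x hx
  exact (((hFr.smul hGr.gradient).sub ((hc.smoothIn_pushF t ht x hx).smul
    (hc.μf_smooth.smoothIn t ht x hx).gradient)).sub (hGu.deriv.add (hFu.lieMomentum hGu))).add
    (hFs.smul hGs.gradient)

theorem Config.IsAdmissible.smoothIn_forceS (hc : c.IsAdmissible D) (k : Incompressible)
    (hl : IsFunctionalDeriv D.T D.Ω l dl) (hsf : SmoothST D.T D.Ω sf) (hss : SmoothST D.T D.Ω ss) :
    SmoothIn D (c.forceS D k dl (c.state D sf ss)) := by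
  obtain ⟨hF, hG⟩ := hc.smooth_state hl hsf hss
  have h0 := hc.const.zero_mem
  intro t ht x hx
  have hGu : SmoothAt (fun t => (dl (c.state D sf ss t)).us) t x := hG.us.smoothIn h0 t ht x hx
  have hGr : SmoothAt (fun t => (dl (c.state D sf ss t)).ρs) t x := hG.ρs.smoothIn h0 t ht x hx
  have hGs : SmoothAt (fun t => (dl (c.state D sf ss t)).ss) t x := hG.ss.smoothIn h0 t ht x hx
  have hGb : SmoothAt (fun t => (dl (c.state D sf ss t)).b) t x := hG.b.smoothIn h0 t ht x hx
  have hFu : SmoothAt (fun t => (c.state D sf ss t).us) t x := hF.us.smoothIn h0 t ht x hx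
  have hFr : SmoothAt (fun t => (c.state D sf ss t).ρs) t x := hF.ρs.smoothIn h0 t ht x hx
  have hFs : SmoothAt (fun t => (c.state D sf ss t).ss) t x := hF.ss.smoothIn h0 t ht x hx
  have hFb : SmoothAt (fun t => (c.state D sf ss t).b) t x := hF.b.smoothIn h0 t ht x hx
  exact ((((hFr.smul hGr.gradient).sub ((hc.smoothIn_pushS t ht x hx).smul
    (hc.smoothIn_solid k t ht x hx).gradient)).sub ((hGb.contractGrad hFb).add
    ((SmoothAt.const (2 : ℝ)).smul (hGb.tmul hFb).divT))).sub
    (hGu.deriv.add (hFu.lieMomentum hGu))).add (hFs.smul hGs.gradient)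

theorem Config.IsAdmissible.smoothIn_fraction (hc : c.IsAdmissible D) (k : Incompressible)
    (hl : IsFunctionalDeriv D.T D.Ω l dl) (hsf : SmoothST D.T D.Ω sf) (hss : SmoothST D.T D.Ω ss) :
    SmoothIn D (c.fraction k dl (c.state D sf ss)) := by
  obtain ⟨-, hG⟩ := hc.smooth_state hl hsf hss
  intro t ht x hx
  exact (SmoothAt.add (hG.φ.smoothIn hc.const.zero_mem t ht x hx)
    (hc.μf_smooth.smoothIn t ht x hx)).sub (hc.smoothIn_solid k t ht x hx)

/-! ### The principle with advected entropies -/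

theorem IsNull.integral_congr {V N E : ℝ → Space → ℝ} (hN : IsNull D N)
    (hV : IntegrableOn (fun p : ℝ × Space => V p.1 p.2) D.cyl)
    (h : ∀ t ∈ Ioo 0 D.T, ∀ x ∈ D.Ω, E t x = V t x + N t x) :
    IntegrableOn (fun p : ℝ × Space => E p.1 p.2) D.cyl ∧
      ∫ p in D.cyl, V p.1 p.2 = ∫ p in D.cyl, E p.1 p.2 := by
  have hm := D.isOpen_cyl.measurableSet
  have hE : EqOn (fun p : ℝ × Space => V p.1 p.2 + N p.1 p.2) (fun p => E p.1 p.2) D.cyl :=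
    fun p hp => (h p.1 hp.1 p.2 hp.2).symm
  refine ⟨(hV.add hN.1).congr_fun hE hm, ?_⟩
  rw [← setIntegral_congr_fun hm hE, integral_add hV hN.1, hN.2, add_zero]

/-- The fundamental lemma for all mechanical unknowns together. -/
theorem eq_zero_of_integral_balance {Af As : ℝ → Space → Space} {P Q R : ℝ → Space → ℝ}
    (hAf : SmoothIn D Af) (hAs : SmoothIn D As) (hP : SmoothIn D P) (hQ : SmoothIn D Q)
    (hR : SmoothIn D R) {δ : NNReal} (hδ : 0 < δ)
    (h : ∀ (wf ws : ℝ × Space → Space) (g hf hs : ℝ × Space → ℝ), IsSmallTest D δ wf →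
      IsSmallTest D δ ws → IsSmallTest D δ g → IsSmallTest D δ hf → IsSmallTest D δ hs →
      ∫ p in D.cyl, (inner ℝ (Af p.1 p.2) (wf p) + inner ℝ (As p.1 p.2) (ws p) + P p.1 p.2 * g p
        + Q p.1 p.2 * hf p + R p.1 p.2 * hs p) = 0) :
    ∀ t ∈ Ioo 0 D.T, ∀ x ∈ D.Ω, Af t x = 0 ∧ As t x = 0 ∧ P t x = 0 ∧ Q t x = 0 ∧ R t x = 0 := by
  have z1 := IsSmallTest.zero (V := ℝ) D δ
  have z3 := IsSmallTest.zero (V := Space) D δ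
  intro t ht x hx
  refine ⟨?_, ?_, ?_, ?_, ?_⟩
  · ext i
    refine SmoothIn.eq_zero_of_integral (h := fun t x => Af t x i)
      (fun t ht x hx => (hAf t ht x hx).coord i) hδ (fun g hg => ?_) t ht x hx
    simpa [inner_smul_right, EuclideanSpace.inner_single_right, mul_comm] using
      h _ _ _ _ _ (hg.smul_single i) z3 z1 z1 z1
  · ext i
    refine SmoothIn.eq_zero_of_integral (h := fun t x => As t x i)
      (fun t ht x hx => (hAs t ht x hx).coord i) hδ (fun g hg => ?_) t ht x hx
    simpa [inner_smul_right, EuclideanSpace.inner_single_right, mul_comm] using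
      h _ _ _ _ _ z3 (hg.smul_single i) z1 z1 z1
  · exact hP.eq_zero_of_integral hδ
      (fun g hg => by simpa using h _ _ _ _ _ z3 z3 hg z1 z1) t ht x hx
  · exact hQ.eq_zero_of_integral hδ
      (fun g hg => by simpa using h _ _ _ _ _ z3 z3 z1 hg z1) t ht x hx
  · exact hR.eq_zero_of_integral hδ
      (fun g hg => by simpa using h _ _ _ _ _ z3 z3 z1 z1 hg) t ht x hx

/-- The first variation of the action with advected entropies. -/
theorem IsVariation.hasDerivAt_action_adv {a : ℝ} {c : ℝ → Config} (h : IsVariation D a c)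
    (hl : IsFunctionalDeriv D.T D.Ω l dl) (k : Incompressible) (hηf : IsTest D (etaF c))
    (hηs : IsTest D (etaS c)) :
    IntegrableOn (fun p : ℝ × Space => balanceDensity D k c
      ((c 0).fraction k dl ((c 0).advState D)) ((c 0).forceF D dl ((c 0).advState D))
      ((c 0).forceS D k dl ((c 0).advState D)) p.1 p.2) D.cyl ∧
    HasDerivAt (fun ε => action D k l (c ε)) (∫ p in D.cyl, balanceDensity D k c
      ((c 0).fraction k dl ((c 0).advState D)) ((c 0).forceF D dl ((c 0).advState D))
      ((c 0).forceS D k dl ((c 0).advState D)) p.1 p.2) 0 := by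
  have h0 := h.zero_mem
  have hsf : SmoothEST a D.T D.Ω (fun ε => pushDensity (c ε).ψf D.sf0) :=
    h.family_f.smooth_pushDensity D.sf0_smooth
  have hss : SmoothEST a D.T D.Ω (fun ε => pushDensity (c ε).ψs D.ss0) :=
    h.family_s.smooth_pushDensity D.ss0_smooth
  obtain ⟨hi, hd⟩ := h.hasDerivAt_action hl k hsf hss hηf hηs (SmoothEST.const 0)
  obtain ⟨-, hG⟩ := (h.admissible 0 h0).smooth_state hl (hsf.slice h0) (hss.slice h0)
  have n1 := hηf.isNull_divv (hG.sf.smoothIn (ε := 0) (by norm_num)) (hsf.smoothIn h0)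
  have n2 := hηs.isNull_divv (hG.ss.smoothIn (ε := 0) (by norm_num)) (hss.smoothIn h0)
  obtain ⟨hi', he⟩ := (n1.add n2).integral_congr hi (E := fun t x => balanceDensity D k c
      ((c 0).fraction k dl ((c 0).advState D)) ((c 0).forceF D dl ((c 0).advState D))
      ((c 0).forceS D k dl ((c 0).advState D)) t x) fun t ht x hx => by
    have e1 : deriv (fun e => pushDensity (c e).ψf D.sf0 t x) 0
        = -divv (fun y => ((c 0).advState D t).sf y • etaF c t y) x :=
      (h.family_f.hasDerivAt_pushDensity h0 (Ioo_subset_Icc_self ht) hx D.sf0_smooth).deriv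
    have e2 : deriv (fun e => pushDensity (c e).ψs D.ss0 t x) 0
        = -divv (fun y => ((c 0).advState D t).ss y • etaS c t y) x :=
      (h.family_s.hasDerivAt_pushDensity h0 (Ioo_subset_Icc_self ht) hx D.ss0_smooth).deriv
    have sF : ∀ v, inner ℝ v (etaF c t x) = inner ℝ (etaF c t x) v :=
      fun v => real_inner_comm _ _
    have sS : ∀ v, inner ℝ v (etaS c t x) = inner ℝ (etaS c t x) v :=
      fun v => real_inner_comm _ _
    change _ = inner ℝ (residualF ((c 0).advState D) (fun t => dl ((c 0).advState D t))
      ((c 0).pushF D) (c 0).μf t x) (etaF c t x)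
      + inner ℝ (residualS ((c 0).advState D) (fun t => dl ((c 0).advState D t))
      ((c 0).pushS D) (k.solid (c 0).μs) t x) (etaS c t x)
      + (dl ((c 0).advState D t)).sf x * deriv (fun e => pushDensity (c e).ψf D.sf0 t x) 0
      + (dl ((c 0).advState D t)).ss x * deriv (fun e => pushDensity (c e).ψs D.ss0 t x) 0
      + (c 0).fraction k dl ((c 0).advState D) t x * deriv (fun e => (c e).φ t x) 0
      + ((c 0).φ t x - (c 0).pushF D t x) * deriv (fun e => (c e).μf t x) 0
      + ((1 - (c 0).φ t x) - (c 0).pushS D t x)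
        * deriv (fun e => k.solid (c e).μs t x) 0 + deriv (fun _ : ℝ => (0 : ℝ)) 0
      + (((dl ((c 0).advState D t)).sf x
          * divv (fun y => ((c 0).advState D t).sf y • etaF c t y) x
        + ((c 0).advState D t).sf x
          * inner ℝ (etaF c t x) (gradient (dl ((c 0).advState D t)).sf x))
        + ((dl ((c 0).advState D t)).ss x
          * divv (fun y => ((c 0).advState D t).ss y • etaS c t y) x
        + ((c 0).advState D t).ss x
          * inner ℝ (etaS c t x) (gradient (dl ((c 0).advState D t)).ss x)))
    simp only [balanceDensity, Config.forceF, Config.forceS, e1, e2, sF, sS,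
      inner_add_right (etaF c t x), inner_add_right (etaS c t x),
      real_inner_smul_right (etaF c t x), real_inner_smul_right (etaS c t x), deriv_const]
    ring
  refine ⟨hi', ?_⟩
  rw [← he]
  refine hd.congr_of_eventuallyEq (Eventually.of_forall fun ε => ?_)
  simp only [action, integral_zero, add_zero]
  rfl

theorem Incompressible.mul_deriv_solid (k : Incompressible) (R : ℝ → Space → ℝ)
    (μ : ℝ → ℝ → Space → ℝ) (t : ℝ) (x : Space) :
    R t x * deriv (fun e => k.solid (μ e) t x) 0
      = k.solid R t x * deriv (fun e => μ e t x) 0 := by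
  cases k
  · simp [Incompressible.solid]
  · rfl

theorem Incompressible.smoothIn_solid (k : Incompressible) {R : ℝ → Space → ℝ}
    (h : SmoothIn D R) : SmoothIn D (k.solid R) := by
  cases k
  · exact fun _ _ _ _ => SmoothAt.const 0
  · exact h

theorem integral_inner_eta {ff fs ηf ηs : ℝ → Space → Space} (hff : SmoothST D.T D.Ω ff)
    (hfs : SmoothST D.T D.Ω fs) (hηf : SmoothST D.T D.Ω ηf) (hηs : SmoothST D.T D.Ω ηs) :
    IntegrableOn (fun p : ℝ × Space => inner ℝ (ff p.1 p.2) (ηf p.1 p.2)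
      + inner ℝ (fs p.1 p.2) (ηs p.1 p.2)) D.cyl ∧
    ∫ t in (0 : ℝ)..D.T, ∫ x in D.Ω, (inner ℝ (ff t x) (ηf t x) + inner ℝ (fs t x) (ηs t x))
      = ∫ p in D.cyl, (inner ℝ (ff p.1 p.2) (ηf p.1 p.2) + inner ℝ (fs p.1 p.2) (ηs p.1 p.2)) := by
  have h : SmoothST D.T D.Ω
      (fun t x => (inner ℝ (ff t x) (ηf t x) + inner ℝ (fs t x) (ηs t x) : ℝ)) :=
    fun t ht x hx => (SmoothAt.inner (hff t ht x hx) (hηf t ht x hx)).add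
      (SmoothAt.inner (hfs t ht x hx) (hηs t ht x hx))
  exact ⟨integrableOn_cyl (f := fun t x => inner ℝ (ff t x) (ηf t x) + inner ℝ (fs t x) (ηs t x))
    h.continuousOn, integral_integral_eq_cyl h.continuousOn⟩

theorem deriv_add_mul (a b : ℝ) : deriv (fun e : ℝ => a + e * b) 0 = b := by
  simp

/-- Stationarity for any class of variations implies the equations of motion. -/
theorem IsCritical.generalSystem (hl : IsFunctionalDeriv D.T D.Ω l dl) {k : Incompressible}
    {ff fs : ℝ → Space → Space} (hff : SmoothST D.T D.Ω ff) (hfs : SmoothST D.T D.Ω fs)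
    (hc : c.IsAdmissible D) {bc : VariationClass} (h : IsCritical D k bc l ff fs c) :
    GeneralSystem D k dl ff fs c := by
  obtain ⟨δ, hδ, hvar⟩ := hc.exists_variation
  have h01 := hc.const.zero_mem
  have hsf : SmoothST D.T D.Ω (pushDensity c.ψf D.sf0) :=
    (hc.const.family_f.smooth_pushDensity D.sf0_smooth).slice h01
  have hss : SmoothST D.T D.Ω (pushDensity c.ψs D.ss0) :=
    (hc.const.family_s.smooth_pushDensity D.ss0_smooth).slice h01
  have key := eq_zero_of_integral_balance (D := D)
    (Af := fun t x => c.forceF D dl (c.advState D) t x + ff t x)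
    (As := fun t x => c.forceS D k dl (c.advState D) t x + fs t x)
    (P := c.fraction k dl (c.advState D)) (Q := fun t x => c.φ t x - c.pushF D t x)
    (R := k.solid fun t x => (1 - c.φ t x) - c.pushS D t x)
    (fun t ht x hx => (hc.smoothIn_forceF hl hsf hss t ht x hx).add (hff.smoothIn t ht x hx))
    (fun t ht x hx => (hc.smoothIn_forceS k hl hsf hss t ht x hx).add (hfs.smoothIn t ht x hx))
    (hc.smoothIn_fraction k hl hsf hss)
    (fun t ht x hx => (hc.φ_smooth.smoothIn t ht x hx).sub (hc.smoothIn_pushF t ht x hx))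
    (k.smoothIn_solid fun t ht x hx =>
      ((SmoothAt.const 1).sub (hc.φ_smooth.smoothIn t ht x hx)).sub (hc.smoothIn_pushS t ht x hx))
    hδ (fun wf ws g hf hs hwf hws hg hhf hhs => by
      obtain ⟨C, hC, hC0, hη, hlin⟩ := hvar wf ws g hf hs hwf hws hg hhf hhs
      have hall := bc.allows_of_isSmallTest hwf hws hη
      have hint := VariationClass.interior.allows_of_isSmallTest hwf hws hη
      obtain ⟨hi, hd⟩ := hC.hasDerivAt_action_adv hl k
        (IsTest.of_supportedInside hC.smooth_etaF hint.1)
        (IsTest.of_supportedInside hC.smooth_etaS hint.2)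
      obtain ⟨hi2, he2⟩ := integral_inner_eta hff hfs hC.smooth_etaF hC.smooth_etaS
      have hu := hd.unique (h 1 C hC hC0 hall)
      rw [he2, ← add_eq_zero_iff_eq_neg, ← integral_add hi hi2] at hu
      rw [← hu]
      refine setIntegral_congr_fun D.isOpen_cyl.measurableSet fun p hp => ?_
      have hp1 := Ioo_subset_Icc_self hp.1
      have hp2 := subset_closure hp.2
      have hk := k.mul_deriv_solid (fun t x => 1 - c.φ t x - c.pushS D t x)
        (fun e => (C e).μs) p.1 p.2
      simp only [(hlin _ _ _).2.2, deriv_add_mul] at hk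
      simp only [balanceDensity, hk, (hlin _ _ _).1, (hlin _ _ _).2.1, deriv_add_mul,
        (hη _ hp1 _ hp2).1, (hη _ hp1 _ hp2).2, hC0, inner_add_left]
      ring)
  have hcf : ∀ t ∈ Ioo 0 D.T, ∀ x ∈ D.Ω, c.φ t x = c.pushF D t x := fun t ht x hx =>
    sub_eq_zero.1 (key t ht x hx).2.2.2.1
  have hcs : k = .both → ∀ t ∈ Ioo 0 D.T, ∀ x ∈ D.Ω, 1 - c.φ t x = c.pushS D t x := by
    rintro rfl t ht x hx
    exact sub_eq_zero.1 (key t ht x hx).2.2.2.2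
  exact ⟨(generalMomentum_iff (fun _ => rfl) hcf hcs).2 fun t ht x hx =>
    ⟨(key t ht x hx).1, (key t ht x hx).2.1, (key t ht x hx).2.2.1⟩,
    hc.kinematicEqs _ _, hc.entropyAdvection, hc.volumeEqs hcf hcs⟩

/-- The constraints remove the terms with the variations of the multipliers. -/
theorem VolumeEqs.balance_multipliers {k : Incompressible} {c : ℝ → Config}
    (h : VolumeEqs D k (c 0)) {t : ℝ} (ht : t ∈ Ioo 0 D.T) {x : Space} (hx : x ∈ D.Ω) :
    ((c 0).φ t x - (c 0).pushF D t x) * deriv (fun e => (c e).μf t x) 0 = 0 ∧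
    ((1 - (c 0).φ t x) - (c 0).pushS D t x) * deriv (fun e => k.solid (c e).μs t x) 0 = 0 := by
  refine ⟨?_, ?_⟩
  · have : (c 0).φ t x = (c 0).pushF D t x := h.constraint_f t ht x hx
    rw [this, sub_self, zero_mul]
  · cases k
    · simp [Incompressible.solid]
    · have : 1 - (c 0).φ t x = (c 0).pushS D t x := h.constraint_s rfl t ht x hx
      rw [this, sub_self, zero_mul]

/-- The equations of motion imply stationarity for interior variations. -/
theorem GeneralSystem.isCritical (hl : IsFunctionalDeriv D.T D.Ω l dl) {k : Incompressible}
    {ff fs : ℝ → Space → Space} (hff : SmoothST D.T D.Ω ff) (hfs : SmoothST D.T D.Ω fs)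
    (h : GeneralSystem D k dl ff fs c) : IsCritical D k .interior l ff fs c := by
  intro a C hC hC0 hall
  subst hC0
  obtain ⟨hi, hd⟩ := hC.hasDerivAt_action_adv hl k
    (IsTest.of_supportedInside hC.smooth_etaF hall.1)
    (IsTest.of_supportedInside hC.smooth_etaS hall.2)
  obtain ⟨hi2, he2⟩ := integral_inner_eta hff hfs hC.smooth_etaF hC.smooth_etaS
  have hM := (generalMomentum_iff (fun _ => rfl) h.volume.constraint_f h.volume.constraint_s).1
    h.momentum
  rw [he2, ← integral_neg]
  convert hd using 1
  refine setIntegral_congr_fun D.isOpen_cyl.measurableSet fun p hp => ?_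
  obtain ⟨h1, h2, h3⟩ := hM p.1 hp.1 p.2 hp.2
  obtain ⟨h4, h5⟩ := h.volume.balance_multipliers hp.1 hp.2
  simp only [balanceDensity, h3, h4, h5, eq_neg_of_add_eq_zero_left h1,
    eq_neg_of_add_eq_zero_left h2, inner_neg_left, zero_mul, add_zero]
  ring

end

/-! ### Variation of the terms that couple entropies and thermal displacements -/

section Coupling

variable {D : Setup} {a T : ℝ} {Ω : Set Space}

theorem IsNull.neg {f : ℝ → Space → ℝ} (hf : IsNull D f) : IsNull D (fun t x => -f t x) :=
  ⟨hf.1.neg, by rw [integral_neg, hf.2, neg_zero]⟩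

theorem SmoothAt₃.dt {u : ℝ → ℝ → Space → Space} {g : ℝ → ℝ → Space → ℝ} {ε t : ℝ} {x : Space}
    (hu : SmoothAt₃ u ε t x) (hg : SmoothAt₃ g ε t x) :
    SmoothAt₃ (fun ε => Dt (u ε) (g ε)) ε t x := by
  have h : (fun ε => Dt (u ε) (g ε)) = fun ε t x => deriv (fun τ => g ε τ x) t
      + ∑ i, u ε t x i * PorousMedia.pd i (g ε t) x := by
    funext ε t x; exact Dt_eq _ _ _ _
  rw [h]
  exact ContDiffAt.add hg.deriv_time (ContDiffAt.sum fun i _ =>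
    ContDiffAt.mul (hu.coord i) (hg.pd i))

/-- The variation of a material derivative. -/
theorem SmoothAt₃.deriv_dt {u : ℝ → ℝ → Space → Space} {g : ℝ → ℝ → Space → ℝ} {ε t : ℝ}
    {x : Space} (hu : SmoothAt₃ u ε t x) (hg : SmoothAt₃ g ε t x) :
    deriv (fun e => Dt (u e) (g e) t x) ε
      = Dt (u ε) (fun t x => deriv (fun e => g e t x) ε) t x
        + inner ℝ (deriv (fun e => u e t x) ε) (gradient (g ε t) x) := by
  have h1 : ∀ i, HasDerivAt (fun e => u e t x i) (deriv (fun e => u e t x) ε i) ε := fun i => by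
    rw [deriv_coord hu.slice_time.ds]
    exact (hu.slice_time.coord i).ds.hasDerivAt
  have h2 : ∀ i, HasDerivAt (fun e => PorousMedia.pd i (g e t) x)
      (PorousMedia.pd i (fun y => deriv (fun e => g e t y) ε) x) ε := fun i => by
    rw [← hg.slice_time.deriv_pd_comm i]
    exact (hg.slice_time.pd i).ds.hasDerivAt
  have h3 : HasDerivAt (fun e => deriv (fun τ => g e τ x) t)
      (deriv (fun τ => deriv (fun e => g e τ x) ε) t) ε := by
    rw [← hg.deriv_deriv_comm]
    exact (SmoothAt₃.slice_time hg.deriv_time).ds.hasDerivAt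
  have h4 := h3.add (HasDerivAt.fun_sum fun i (_ : i ∈ Finset.univ) => (h1 i).mul (h2 i))
  rw [(h4.congr_of_eventuallyEq (Eventually.of_forall fun e => Dt_eq (u e) (g e) t x)).deriv,
    Dt_eq, inner_eq_sum]
  simp only [gradient_apply, Finset.sum_add_distrib]
  ring

theorem SmoothEST.dt {u : ℝ → ℝ → Space → Space} {g : ℝ → ℝ → Space → ℝ}
    (hu : SmoothEST a T Ω u) (hg : SmoothEST a T Ω g) :
    SmoothEST a T Ω (fun ε => Dt (u ε) (g ε)) := fun ε hε t ht x hx =>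
  SmoothAt₃.dt (hu ε hε t ht x hx) (hg ε hε t ht x hx)

theorem Dbar_sub {u : ℝ → Space → Space} {f g : ℝ → Space → ℝ} {t : ℝ} {x : Space}
    (hu : SmoothAt u t x) (hf : SmoothAt f t x) (hg : SmoothAt g t x) :
    Dbar u (fun t x => f t x - g t x) t x = Dbar u f t x - Dbar u g t x := by
  have e : ∀ i, PorousMedia.pd i (fun y => (f t y - g t y) * u t y i) x = _ := fun i =>
    pd_mul (hf.sub hg).dx (hu.coord i).dx
  have e1 : ∀ i, PorousMedia.pd i (fun y => f t y * u t y i) x = _ := fun i =>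
    pd_mul hf.dx (hu.coord i).dx
  have e2 : ∀ i, PorousMedia.pd i (fun y => g t y * u t y i) x = _ := fun i =>
    pd_mul hg.dx (hu.coord i).dx
  simp only [Dbar, divv, PiLp.smul_apply, smul_eq_mul, e, e1, e2, pd_sub hf.dx hg.dx,
    deriv_fun_sub hf.ds hg.ds, Fin.sum_univ_three]
  ring

/-- Variation of `θ D_t γ`, integrated by parts. -/
theorem IsMotionFamily.isNull_coupling {Ω₀ : Set Space} {χ ψ : ℝ → ℝ → Space → Space}
    (h : IsMotionFamily a D.T Ω₀ D.Ω χ ψ) (h0 : (0 : ℝ) ∈ Ioo (-a) a) {η : ℝ → Space → Space}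
    (hη : η = fun t => velocity (fun e => χ e t) (fun e => ψ e t) 0) (hηt : IsTest D η)
    {θ γ : ℝ → ℝ → Space → ℝ} (hθ : SmoothEST a D.T D.Ω θ) (hγ : SmoothEST a D.T D.Ω γ)
    (hδ : IsTest D (fun t x => deriv (fun e => γ e t x) 0)) :
    IsNull D (fun t x => deriv (fun e => θ e t x * Dt (velocity (χ e) (ψ e)) (γ e) t x) 0
      - (deriv (fun e => θ e t x) 0 * Dt (velocity (χ 0) (ψ 0)) (γ 0) t x
        - Dbar (velocity (χ 0) (ψ 0)) (θ 0) t x * Ddelta η γ t x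
        - θ 0 t x * inner ℝ (η t x) (gradient (Dt (velocity (χ 0) (ψ 0)) (γ 0) t) x))) := by
  have hu := h.smooth_velocity
  have hu0 := hu.smoothIn h0
  have hθ0 := hθ.smoothIn h0
  have hγ0 := hγ.smoothIn h0
  have n1 := hδ.isNull_Dt hθ0 hu0
  have n2 := hηt.isNull_velocity (m := fun t x => θ 0 t x • gradient (γ 0 t) x)
    (fun t ht x hx => (hθ0 t ht x hx).smul (hγ0 t ht x hx).gradient) hu0
  refine (n1.add n2).congr fun t ht x hx => ?_
  have ht' := Ioo_subset_Icc_self ht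
  have hx' := subset_closure hx
  have e1 : deriv (fun e => velocity (χ e) (ψ e) t x) 0 = deriv (fun τ => η τ x) t
      + fderiv ℝ (η t) x (velocity (χ 0) (ψ 0) t x)
      - fderiv ℝ (velocity (χ 0) (ψ 0) t) x (η t x) := by
    subst hη
    exact deriv_velocity (h.smoothAt₃ h0 ht' hx') (h.isLocalFlow h0 ht' hx)
      ((h.motion 0 h0).isLocalFlow h.Ω₀_open h.Ω_open ht hx)
  have e2 : deriv (fun e => θ e t x * Dt (velocity (χ e) (ψ e)) (γ e) t x) 0 = _ :=
    ((hθ.hasDerivAt h0 ht' hx').mul ((hu.dt hγ).hasDerivAt h0 ht' hx')).deriv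
  rw [e2, SmoothAt₃.deriv_dt (u := fun ε => velocity (χ ε) (ψ ε)) (hu 0 h0 t ht' x hx')
      (hγ 0 h0 t ht' x hx'), ← e1,
    deriv_add_lieMomentum_smul_gradient (hθ0 t ht x hx) (hγ0 t ht x hx) (hu0 t ht x hx)]
  have s : ∀ v, inner ℝ v (η t x) = inner ℝ (η t x) v := fun v => real_inner_comm _ _
  generalize deriv (fun e => velocity (χ e) (ψ e) t x) 0 = w
  simp only [Ddelta, real_inner_smul_left, s, inner_add_right (η t x),
    real_inner_smul_right (η t x), real_inner_comm (gradient (γ 0 t) x) w]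
  ring

end Coupling

section

variable {D : Setup} {a : ℝ} {c : ℝ → ThermoConfig} {l : Fields → ℝ} {dl : Fields → Fields}
  {k : Incompressible} {R : Friction}

/-! ### The first variation with irreversible processes -/

/-- The density of the first variation after integration by parts, before the variational
constraints are used. -/
def thermoDensity (D : Setup) (k : Incompressible) (dl : Fields → Fields) (c : ℝ → ThermoConfig)
    (t : ℝ) (x : Space) : ℝ :=
  variationDensity D k dl (fun ε => (c ε).toConfig) (fun ε => (c ε).sf) (fun ε => (c ε).ss) t x
    + (deriv (fun e => (c e).sf t x - (c e).σf t x) 0 * Dt (c 0).uf (c 0).γf t x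
      - Dbar (c 0).uf (fun t x => (c 0).sf t x - (c 0).σf t x) t x
        * Ddelta (thermoEtaF c) (fun ε => (c ε).γf) t x
      - ((c 0).sf t x - (c 0).σf t x)
        * inner ℝ (thermoEtaF c t x) (gradient (Dt (c 0).uf (c 0).γf t) x))
    + (deriv (fun e => (c e).ss t x - (c e).σs t x) 0 * Dt (c 0).us (c 0).γs t x
      - Dbar (c 0).us (fun t x => (c 0).ss t x - (c 0).σs t x) t x
        * Ddelta (thermoEtaS c) (fun ε => (c ε).γs) t x
      - ((c 0).ss t x - (c 0).σs t x)
        * inner ℝ (thermoEtaS c t x) (gradient (Dt (c 0).us (c 0).γs t) x))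

/-- Variations whose displacements are test functions. -/
structure IsThermoTest (D : Setup) (c : ℝ → ThermoConfig) : Prop where
  ηf : IsTest D (thermoEtaF c)
  ηs : IsTest D (thermoEtaS c)
  γf : IsTest D (fun t x => deriv (fun e => (c e).γf t x) 0)
  γs : IsTest D (fun t x => deriv (fun e => (c e).γs t x) 0)

theorem IsThermoVariation.hasDerivAt_action (h : IsThermoVariation D a c)
    (hl : IsFunctionalDeriv D.T D.Ω l dl) (k : Incompressible) (hc : IsThermoTest D c) :
    IntegrableOn (fun p : ℝ × Space => thermoDensity D k dl c p.1 p.2) D.cyl ∧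
    HasDerivAt (fun ε => thermoAction D k l (c ε))
      (∫ p in D.cyl, thermoDensity D k dl c p.1 p.2) 0 := by
  have h0 := h.config.zero_mem
  have hθf := h.sf_smooth.sub h.σf_smooth
  have hθs := h.ss_smooth.sub h.σs_smooth
  have hqf := hθf.mul (h.config.family_f.smooth_velocity.dt h.γf_smooth)
  have hqs := hθs.mul (h.config.family_s.smooth_velocity.dt h.γs_smooth)
  obtain ⟨hi, hd⟩ := h.config.hasDerivAt_action hl k h.sf_smooth h.ss_smooth hc.ηf hc.ηs
    (hqf.add hqs)
  have n1 := h.config.family_f.isNull_coupling h0 (η := thermoEtaF c) rfl hc.ηf hθf h.γf_smooth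
    hc.γf
  have n2 := h.config.family_s.isNull_coupling h0 (η := thermoEtaS c) rfl hc.ηs hθs h.γs_smooth
    hc.γs
  have hN : IsNull D (fun t x => thermoDensity D k dl c t x
      - (variationDensity D k dl (fun ε => (c ε).toConfig) (fun ε => (c ε).sf)
            (fun ε => (c ε).ss) t x
        + deriv (fun e => ((c e).sf t x - (c e).σf t x)
            * Dt (velocity (c e).χf (c e).ψf) (c e).γf t x
          + ((c e).ss t x - (c e).σs t x) * Dt (velocity (c e).χs (c e).ψs) (c e).γs t x) 0)) := by
    refine (n1.add n2).neg.congr fun t ht x hx => ?_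
    have e1 : deriv (fun e => ((c e).sf t x - (c e).σf t x)
            * Dt (velocity (c e).χf (c e).ψf) (c e).γf t x
          + ((c e).ss t x - (c e).σs t x) * Dt (velocity (c e).χs (c e).ψs) (c e).γs t x) 0 = _ :=
      deriv_fun_add
        (hqf.hasDerivAt h0 (Ioo_subset_Icc_self ht) (subset_closure hx)).differentiableAt
        (hqs.hasDerivAt h0 (Ioo_subset_Icc_self ht) (subset_closure hx)).differentiableAt
    rw [e1]
    simp only [thermoDensity, Config.uf, Config.us]
    ring
  obtain ⟨hi', he⟩ := hN.integral_congr (V := fun t x => variationDensity D k dl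
      (fun ε => (c ε).toConfig) (fun ε => (c ε).sf) (fun ε => (c ε).ss) t x
        + deriv (fun e => ((c e).sf t x - (c e).σf t x)
            * Dt (velocity (c e).χf (c e).ψf) (c e).γf t x
          + ((c e).ss t x - (c e).σs t x) * Dt (velocity (c e).χs (c e).ψs) (c e).γs t x) 0)
    hi (E := thermoDensity D k dl c) fun t _ x _ => by ring
  refine ⟨hi', ?_⟩
  rw [← he]
  refine hd.congr_of_eventuallyEq ?_
  filter_upwards [isOpen_Ioo.mem_nhds h0] with ε hε
  refine intervalIntegral.integral_congr fun t ht => ?_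
  rw [uIcc_of_le D.T_pos.le] at ht
  exact (add_assoc _ _ _).trans (congrArg _ (integral_add
    (integrableOn_slice (f := fun t x => ((c ε).sf t x - (c ε).σf t x) * Dt (c ε).uf (c ε).γf t x)
      (hqf.slice hε).continuousOn ht)
    (integrableOn_slice (f := fun t x => ((c ε).ss t x - (c ε).σs t x) * Dt (c ε).us (c ε).γs t x)
      (hqs.slice hε).continuousOn ht)).symm)

end

section

variable {D : Setup} {a : ℝ} {c : ℝ → ThermoConfig} {l : Fields → ℝ} {dl : Fields → Fields}
  {k : Incompressible} {R : Friction}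

theorem gradient_eq_neg {f g : Space → ℝ} (h : ∀ y ∈ D.Ω, f y = -g y) {x : Space} (hx : x ∈ D.Ω) :
    gradient f x = -gradient g x := by
  ext i
  simp only [gradient_apply, PiLp.neg_apply]
  rw [pd_congr (g := fun y => -g y), pd_neg]
  filter_upwards [D.Ω_open.mem_nhds hx] with y hy using h y hy

/-- The density of the first variation once the variational constraints and `D_t γ_k = -δℓ/δs_k`
have been used. -/
def thermoBalance (D : Setup) (k : Incompressible) (dl : Fields → Fields) (R : Friction)
    (c : ℝ → ThermoConfig) (t : ℝ) (x : Space) : ℝ :=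
  balanceDensity D k (fun ε => (c ε).toConfig) ((c 0).fraction k dl ((c 0).thermoState D))
      (fun t x => (c 0).forceF D dl ((c 0).thermoState D) t x + (divT (R.τf t) x + R.ff t x))
      (fun t x => (c 0).forceS D k dl ((c 0).thermoState D) t x + (divT (R.τs t) x + R.fs t x)) t x
    - Dbar (c 0).uf (fun t x => (c 0).sf t x - (c 0).σf t x) t x
      * Ddelta (thermoEtaF c) (fun ε => (c ε).γf) t x
    - Dbar (c 0).us (fun t x => (c 0).ss t x - (c 0).σs t x) t x
      * Ddelta (thermoEtaS c) (fun ε => (c ε).γs) t x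

/-- The first variation under the variational constraints.  The heat exchange terms of the two
constraints cancel, because `J_fs = J_sf = -J_ff = -J_ss`. -/
theorem IsThermoVariation.hasDerivAt_action_constrained (h : IsThermoVariation D a c)
    (hl : IsFunctionalDeriv D.T D.Ω l dl) (k : Incompressible) (hc : IsThermoTest D c)
    (hR : R.IsSmooth D)
    (hγf : ∀ t ∈ Ioo 0 D.T, ∀ x ∈ D.Ω, Dt (c 0).uf (c 0).γf t x
      = -(dl ((c 0).thermoState D t)).sf x)
    (hγs : ∀ t ∈ Ioo 0 D.T, ∀ x ∈ D.Ω, Dt (c 0).us (c 0).γs t x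
      = -(dl ((c 0).thermoState D t)).ss x)
    (hV : VariationalConstraint D dl R c) :
    IntegrableOn (fun p : ℝ × Space => thermoBalance D k dl R c p.1 p.2) D.cyl ∧
    HasDerivAt (fun ε => thermoAction D k l (c ε))
      (∫ p in D.cyl, thermoBalance D k dl R c p.1 p.2) 0 := by
  have h0 := h.config.zero_mem
  obtain ⟨hi, hd⟩ := h.hasDerivAt_action hl k hc
  obtain ⟨-, hG⟩ := (h.config.admissible 0 h0).smooth_state hl (h.sf_smooth.slice h0)
    (h.ss_smooth.slice h0)
  have n1 := hc.ηf.isNull_stress hR.τf.smoothIn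
  have n2 := hc.ηs.isNull_stress hR.τs.smoothIn
  have n3 := hc.ηf.isNull_divv (hG.sf.smoothIn (ε := 0) (by norm_num)) (h.σf_smooth.smoothIn h0)
  have n4 := hc.ηs.isNull_divv (hG.ss.smoothIn (ε := 0) (by norm_num)) (h.σs_smooth.smoothIn h0)
  obtain ⟨hi', he⟩ := (((n1.add n2).add n3).add n4).integral_congr hi
    (E := thermoBalance D k dl R c) fun t ht x hx => by
    have ht' := Ioo_subset_Icc_self ht
    have hx' := subset_closure hx
    have hvf := hV.fluid t ht x hx
    have hvs := hV.solid t ht x hx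
    have e1 : deriv (fun e => (c e).sf t x - (c e).σf t x) 0 = _ :=
      deriv_fun_sub (h.sf_smooth.hasDerivAt h0 ht' hx').differentiableAt
        (h.σf_smooth.hasDerivAt h0 ht' hx').differentiableAt
    have e2 : deriv (fun e => (c e).ss t x - (c e).σs t x) 0 = _ :=
      deriv_fun_sub (h.ss_smooth.hasDerivAt h0 ht' hx').differentiableAt
        (h.σs_smooth.hasDerivAt h0 ht' hx').differentiableAt
    have g1 := gradient_eq_neg (D := D) (hγf t ht) hx
    have g2 := gradient_eq_neg (D := D) (hγs t ht) hx
    have sF : ∀ v, inner ℝ v (thermoEtaF c t x) = inner ℝ (thermoEtaF c t x) v :=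
      fun v => real_inner_comm _ _
    have sS : ∀ v, inner ℝ v (thermoEtaS c t x) = inner ℝ (thermoEtaS c t x) v :=
      fun v => real_inner_comm _ _
    have hB : thermoBalance D k dl R c t x = inner ℝ ((residualF ((c 0).thermoState D)
        (fun t => dl ((c 0).thermoState D t)) ((c 0).pushF D) (c 0).μf t x
          + (c 0).sf t x • gradient (dl ((c 0).thermoState D t)).sf x)
          + (divT (R.τf t) x + R.ff t x)) (thermoEtaF c t x)
      + inner ℝ ((residualS ((c 0).thermoState D) (fun t => dl ((c 0).thermoState D t))
        ((c 0).pushS D) (k.solid (c 0).μs) t x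
          + (c 0).ss t x • gradient (dl ((c 0).thermoState D t)).ss x)
          + (divT (R.τs t) x + R.fs t x)) (thermoEtaS c t x)
      + ((dl ((c 0).thermoState D t)).φ x + (c 0).μf t x - k.solid (c 0).μs t x)
        * deriv (fun e => (c e).φ t x) 0
      + ((c 0).φ t x - (c 0).pushF D t x) * deriv (fun e => (c e).μf t x) 0
      + ((1 - (c 0).φ t x) - (c 0).pushS D t x) * deriv (fun e => k.solid (c e).μs t x) 0
      - Dbar (c 0).uf (fun t x => (c 0).sf t x - (c 0).σf t x) t x
        * Ddelta (thermoEtaF c) (fun ε => (c ε).γf) t x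
      - Dbar (c 0).us (fun t x => (c 0).ss t x - (c 0).σs t x) t x
        * Ddelta (thermoEtaS c) (fun ε => (c ε).γs) t x := rfl
    have hT : thermoDensity D k dl c t x = inner ℝ (residualF ((c 0).thermoState D)
        (fun t => dl ((c 0).thermoState D t)) ((c 0).pushF D) (c 0).μf t x) (thermoEtaF c t x)
      + inner ℝ (residualS ((c 0).thermoState D) (fun t => dl ((c 0).thermoState D t))
        ((c 0).pushS D) (k.solid (c 0).μs) t x) (thermoEtaS c t x)
      + (dl ((c 0).thermoState D t)).sf x * deriv (fun e => (c e).sf t x) 0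
      + (dl ((c 0).thermoState D t)).ss x * deriv (fun e => (c e).ss t x) 0
      + ((dl ((c 0).thermoState D t)).φ x + (c 0).μf t x - k.solid (c 0).μs t x)
        * deriv (fun e => (c e).φ t x) 0
      + ((c 0).φ t x - (c 0).pushF D t x) * deriv (fun e => (c e).μf t x) 0
      + ((1 - (c 0).φ t x) - (c 0).pushS D t x) * deriv (fun e => k.solid (c e).μs t x) 0
      + (deriv (fun e => (c e).sf t x - (c e).σf t x) 0 * Dt (c 0).uf (c 0).γf t x
        - Dbar (c 0).uf (fun t x => (c 0).sf t x - (c 0).σf t x) t x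
          * Ddelta (thermoEtaF c) (fun ε => (c ε).γf) t x
        - ((c 0).sf t x - (c 0).σf t x)
          * inner ℝ (thermoEtaF c t x) (gradient (Dt (c 0).uf (c 0).γf t) x))
      + (deriv (fun e => (c e).ss t x - (c e).σs t x) 0 * Dt (c 0).us (c 0).γs t x
        - Dbar (c 0).us (fun t x => (c 0).ss t x - (c 0).σs t x) t x
          * Ddelta (thermoEtaS c) (fun ε => (c ε).γs) t x
        - ((c 0).ss t x - (c 0).σs t x)
          * inner ℝ (thermoEtaS c t x) (gradient (Dt (c 0).us (c 0).γs t) x)) := rfl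
    change _ = _ + (contract (R.τf t x) (gradV (thermoEtaF c t) x)
        + inner ℝ (divT (R.τf t) x) (thermoEtaF c t x)
      + (contract (R.τs t x) (gradV (thermoEtaS c t) x)
        + inner ℝ (divT (R.τs t) x) (thermoEtaS c t x))
      + ((dl ((c 0).thermoState D t)).sf x * divv (fun y => (c 0).σf t y • thermoEtaF c t y) x
        + (c 0).σf t x
          * inner ℝ (thermoEtaF c t x) (gradient (dl ((c 0).thermoState D t)).sf x))
      + ((dl ((c 0).thermoState D t)).ss x * divv (fun y => (c 0).σs t y • thermoEtaS c t y) x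
        + (c 0).σs t x
          * inner ℝ (thermoEtaS c t x) (gradient (dl ((c 0).thermoState D t)).ss x)))
    rw [hB, hT, e1, e2, g1, g2, hγf t ht x hx, hγs t ht x hx]
    simp only [DdeltaBar, sF, sS] at hvf hvs
    simp only [sF, sS, inner_add_right (thermoEtaF c t x), inner_add_right (thermoEtaS c t x),
      real_inner_smul_right (thermoEtaF c t x), real_inner_smul_right (thermoEtaS c t x),
      inner_neg_right (thermoEtaF c t x), inner_neg_right (thermoEtaS c t x)]
    -- the heat exchange terms of the two constraints are opposite and drop out of the sum
    linear_combination -hvf - hvs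
  exact ⟨hi', he ▸ hd⟩

/-- The equations of motion imply the thermodynamic principle for interior variations. -/
theorem GeneralThermoSystem.isThermoCritical {c : ThermoConfig}
    (hl : IsFunctionalDeriv D.T D.Ω l dl) (hR : R.IsSmooth D) (hc : c.IsAdmissible D)
    (h : GeneralThermoSystem D k dl R c) : IsThermoCritical D k .interior l dl R c := by
  have hu : SmoothIn D c.uf := hc.config.const.family_f.smooth_velocity.smoothIn
    hc.config.const.zero_mem
  have hv : SmoothIn D c.us := hc.config.const.family_s.smooth_velocity.smoothIn
    hc.config.const.zero_mem
  refine ⟨⟨fun t ht x hx => ?_, fun t ht x hx => ?_⟩, fun a C hC hC0 hall hγ hV => ?_⟩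
  · rw [h.generated_f t ht x hx, h.entropy_f t ht x hx, h.displacement_f t ht x hx,
      h.displacement_s t ht x hx]
    ring
  · rw [h.generated_s t ht x hx, h.entropy_s t ht x hx, h.displacement_f t ht x hx,
      h.displacement_s t ht x hx]
    ring
  · subst hC0
    have h0 := hC.config.zero_mem
    have htest : IsThermoTest D C :=
      ⟨IsTest.of_supportedInside hC.config.smooth_etaF hall.1,
        IsTest.of_supportedInside hC.config.smooth_etaS hall.2,
        IsTest.of_supportedInside (hC.γf_smooth.deriv_eps.slice h0) (hγ rfl).1,
        IsTest.of_supportedInside (hC.γs_smooth.deriv_eps.slice h0) (hγ rfl).2⟩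
    obtain ⟨-, hd⟩ := hC.hasDerivAt_action_constrained hl k htest hR h.displacement_f
      h.displacement_s hV
    have hM := (generalMomentum_iff (fun _ => rfl) h.volume.constraint_f h.volume.constraint_s).1
      h.momentum
    convert hd using 1
    refine (setIntegral_eq_zero_of_forall_eq_zero fun p hp => ?_).symm
    obtain ⟨h1, h2, h3⟩ := hM p.1 hp.1 p.2 hp.2
    obtain ⟨h4, h5⟩ := VolumeEqs.balance_multipliers (c := fun ε => (C ε).toConfig) h.volume
      hp.1 hp.2
    have h6 := Dbar_sub (hu p.1 hp.1 p.2 hp.2) (hc.sf_smooth.smoothIn p.1 hp.1 p.2 hp.2)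
      (hc.σf_smooth.smoothIn p.1 hp.1 p.2 hp.2)
    have h7 := Dbar_sub (hv p.1 hp.1 p.2 hp.2) (hc.ss_smooth.smoothIn p.1 hp.1 p.2 hp.2)
      (hc.σs_smooth.smoothIn p.1 hp.1 p.2 hp.2)
    rw [h.generated_f p.1 hp.1 p.2 hp.2, sub_self] at h6
    rw [h.generated_s p.1 hp.1 p.2 hp.2, sub_self] at h7
    simp only [thermoBalance, balanceDensity, h1, h2, h3, h4, h5, h6, h7, inner_zero_left, zero_mul,
      add_zero, sub_zero]

end

section

variable {D : Setup} {c : ThermoConfig} {l : Fields → ℝ} {dl : Fields → Fields}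
  {k : Incompressible} {R : Friction}

/-! ### Variations that satisfy the variational constraints -/

theorem IsThermoVariation.isThermoTest {a : ℝ} {C : ℝ → ThermoConfig} (h : IsThermoVariation D a C)
    (hη : VariationClass.interior.Allows D (thermoEtaF C) (thermoEtaS C))
    (hγ : SupportedInside D (fun t x => deriv (fun ε => (C ε).γf t x) 0) ∧
      SupportedInside D (fun t x => deriv (fun ε => (C ε).γs t x) 0)) : IsThermoTest D C :=
  ⟨IsTest.of_supportedInside h.config.smooth_etaF hη.1,
    IsTest.of_supportedInside h.config.smooth_etaS hη.2,
    IsTest.of_supportedInside (h.γf_smooth.deriv_eps.slice h.config.zero_mem) hγ.1,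
    IsTest.of_supportedInside (h.γs_smooth.deriv_eps.slice h.config.zero_mem) hγ.2⟩

/-- Variations with prescribed displacements and prescribed variations of the other unknowns,
apart from the variational constraints. -/
theorem ThermoConfig.IsAdmissible.exists_variation (hc : c.IsAdmissible D) :
    ∃ δ : NNReal, 0 < δ ∧ ∀ (wf ws : ℝ × Space → Space) (g hf hs rf rs : ℝ × Space → ℝ)
      (pf ps qf qs : ℝ → Space → ℝ), IsSmallTest D δ wf → IsSmallTest D δ ws →
      IsSmallTest D δ g → IsSmallTest D δ hf → IsSmallTest D δ hs → IsSmallTest D δ rf →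
      IsSmallTest D δ rs → SmoothST D.T D.Ω pf → SmoothST D.T D.Ω ps → SmoothST D.T D.Ω qf →
      SmoothST D.T D.Ω qs → ∃ C : ℝ → ThermoConfig, IsThermoVariation D 1 C ∧ C 0 = c ∧
        (∀ t ∈ Icc 0 D.T, ∀ x ∈ closure D.Ω,
          thermoEtaF C t x = wf (t, x) ∧ thermoEtaS C t x = ws (t, x)) ∧
        (∀ bc : VariationClass, bc.Allows D (thermoEtaF C) (thermoEtaS C)) ∧
        (SupportedInside D (fun t x => deriv (fun ε => (C ε).γf t x) 0) ∧
          SupportedInside D (fun t x => deriv (fun ε => (C ε).γs t x) 0)) ∧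
        ∀ t x, (deriv (fun ε => (C ε).φ t x) 0 = g (t, x) ∧
            deriv (fun ε => (C ε).μf t x) 0 = hf (t, x) ∧
            deriv (fun ε => (C ε).μs t x) 0 = hs (t, x)) ∧
          (deriv (fun ε => (C ε).sf t x) 0 = pf t x ∧ deriv (fun ε => (C ε).ss t x) 0 = ps t x) ∧
          (deriv (fun ε => (C ε).σf t x) 0 = qf t x ∧ deriv (fun ε => (C ε).σs t x) 0 = qs t x) ∧
          deriv (fun ε => (C ε).γf t x) 0 = rf (t, x) ∧
          deriv (fun ε => (C ε).γs t x) 0 = rs (t, x) := by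
  obtain ⟨δ, hδ, hvar⟩ := hc.config.exists_variation
  refine ⟨δ, hδ, ?_⟩
  intro wf ws g hf hs rf rs pf ps qf qs hwf hws hg hhf hhs hrf hrs hpf hps hqf hqs
  obtain ⟨C, hC, hC0, hη, hlin⟩ := hvar wf ws g hf hs hwf hws hg hhf hhs
  have hS : ∀ {f q : ℝ → Space → ℝ}, SmoothST D.T D.Ω f → SmoothST D.T D.Ω q →
      SmoothEST 1 D.T D.Ω (fun ε t x => f t x + ε * q t x) := by
    intro f q hf hq ε _ t ht x hx
    exact ContDiffAt.add (SmoothAt₃.of_smoothAt (hf t ht x hx))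
      (contDiffAt_fst.mul (SmoothAt₃.of_smoothAt (hq t ht x hx)))
  have hsup : ∀ {r : ℝ × Space → ℝ} {γ : ℝ → Space → ℝ}, IsSmallTest D δ r →
      SupportedInside D (fun t x => deriv (fun ε : ℝ => γ t x + ε * r (t, x)) 0) := by
    intro r γ hr
    simpa only [deriv_add_mul] using hr.supportedInside
  have hends : ∀ {r : ℝ × Space → ℝ} {γ : ℝ → Space → ℝ}, IsSmallTest D δ r → ∀ x : Space,
      deriv (fun ε : ℝ => γ 0 x + ε * r (0, x)) 0 = 0 ∧
      deriv (fun ε : ℝ => γ D.T x + ε * r (D.T, x)) 0 = 0 := by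
    intro r γ hr x
    simp only [deriv_add_mul]
    exact ⟨hr.apply_eq_zero fun h => lt_irrefl _ h.1.1,
      hr.apply_eq_zero fun h => lt_irrefl _ h.1.2⟩
  refine ⟨fun ε =>
    { toConfig := C ε
      sf := fun t x => c.sf t x + ε * pf t x
      ss := fun t x => c.ss t x + ε * ps t x
      σf := fun t x => c.σf t x + ε * qf t x
      σs := fun t x => c.σs t x + ε * qs t x
      γf := fun t x => c.γf t x + ε * rf (t, x)
      γs := fun t x => c.γs t x + ε * rs (t, x) },
    ⟨hC, hS hc.sf_smooth hpf, hS hc.ss_smooth hps, hS hc.σf_smooth hqf, hS hc.σs_smooth hqs,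
      hS hc.γf_smooth hrf.smoothST, hS hc.γs_smooth hrs.smoothST,
      fun x _ => hends hrf x, fun x _ => hends hrs x⟩, ?_, hη,
    fun bc => bc.allows_of_isSmallTest hwf hws hη, ⟨hsup hrf, hsup hrs⟩, fun t x => ?_⟩
  · simp [hC0]
  · simp only [(hlin _ _ _).1, (hlin _ _ _).2.1, (hlin _ _ _).2.2, deriv_add_mul, and_self]

/-- The variation of the generated entropy that solves the variational constraint
`ls (δσ + div (σ w)) = f · w - τ : ∇w + A`. -/
def solveConstraint (ls σ : ℝ → Space → ℝ) (f : ℝ → Space → Space) (τ : ℝ → Space → Tensor)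
    (w : ℝ × Space → Space) (A : ℝ → Space → ℝ) (t : ℝ) (x : Space) : ℝ :=
  (inner ℝ (f t x) (w (t, x)) - contract (τ t x) (gradV (fun y => w (t, y)) x) + A t x) / ls t x
    - divv (fun y => σ t y • w (t, y)) x

theorem solveConstraint_spec {ls σ : ℝ → Space → ℝ} (f : ℝ → Space → Space)
    (τ : ℝ → Space → Tensor) (w : ℝ × Space → Space) (A : ℝ → Space → ℝ) {t : ℝ} {x : Space}
    (h : ls t x ≠ 0) :
    ls t x * (solveConstraint ls σ f τ w A t x + divv (fun y => σ t y • w (t, y)) x)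
      = inner ℝ (f t x) (w (t, x)) - contract (τ t x) (gradV (fun y => w (t, y)) x) + A t x := by
  rw [solveConstraint, sub_add_cancel, mul_div_cancel₀ _ h]

/-- The solution of the constraint has compact support in the cylinder, where `ls` does not
vanish; therefore it is smooth up to the boundary, whatever the values of `ls` there. -/
theorem smoothST_solveConstraint {ls σ A : ℝ → Space → ℝ} {f : ℝ → Space → Space}
    {τ : ℝ → Space → Tensor} {w : ℝ × Space → Space} {δ : NNReal} (hls : SmoothIn D ls)
    (h0 : ∀ t ∈ Ioo 0 D.T, ∀ x ∈ D.Ω, ls t x ≠ 0) (hσ : SmoothIn D σ) (hf : SmoothIn D f)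
    (hτ : SmoothIn D τ) (hw : IsSmallTest D δ w) (hA : SmoothIn D A) {K : Set (ℝ × Space)}
    (hK : IsClosed K) (hKs : K ⊆ D.cyl) (hA0 : ∀ t x, (t, x) ∉ K → A t x = 0) :
    SmoothST D.T D.Ω (solveConstraint ls σ f τ w A) := by
  intro t _ x _
  by_cases hp : (t, x) ∈ D.cyl
  · have hwx : SmoothAt (fun t x => w (t, x)) t x := hw.contDiff.contDiffAt
    exact ((((hf t hp.1 x hp.2).inner hwx).sub ((hτ t hp.1 x hp.2).contract hwx.gradV)).add
      (hA t hp.1 x hp.2)).div (hls t hp.1 x hp.2) (h0 t hp.1 x hp.2) |>.sub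
      ((hσ t hp.1 x hp.2).smul hwx).divv
  · have hc : IsClosed (tsupport w ∪ K) := (isClosed_tsupport w).union hK
    refine SmoothAt.congr (SmoothAt.const 0) ?_
    filter_upwards [hc.isOpen_compl.mem_nhds fun h => hp (h.elim (fun h => hw.support h)
      fun h => hKs h)] with p hp'
    have hp1 : p ∉ tsupport w := fun h => hp' (Or.inl h)
    have hw0 : ∀ᶠ q in 𝓝 (p.1, p.2), w q = 0 := notMem_tsupport_iff_eventuallyEq.1 hp1
    have hw1 : ∀ᶠ y in 𝓝 p.2, w (p.1, y) = 0 := eventually_slice hw0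
    have e1 : ∀ i j, PorousMedia.pd j (fun y => w (p.1, y) i) p.2 = 0 := fun i j => by
      rw [pd_congr (g := fun _ => 0), pd_const]
      filter_upwards [hw1] with y hy
      rw [hy]; rfl
    have e2 : ∀ i, PorousMedia.pd i (fun y => (σ p.1 y • w (p.1, y)) i) p.2 = 0 := fun i => by
      rw [pd_congr (g := fun _ => 0), pd_const]
      filter_upwards [hw1] with y hy
      rw [hy, smul_zero]; rfl
    simp only [solveConstraint, hw1.self_of_nhds, inner_zero_right, contract, gradV, divv, e1, e2,
      mul_zero, Finset.sum_const_zero, hA0 p.1 p.2 fun h => hp' (Or.inr h), sub_zero, add_zero,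
      zero_div]

/-- The variational constraints for displacements that agree with test functions. -/
theorem variationalConstraint_of_eq {C : ℝ → ThermoConfig} {wf ws : ℝ × Space → Space}
    (hη : ∀ t ∈ Icc 0 D.T, ∀ x ∈ closure D.Ω,
      thermoEtaF C t x = wf (t, x) ∧ thermoEtaS C t x = ws (t, x))
    (hf : ∀ t ∈ Ioo 0 D.T, ∀ x ∈ D.Ω, (dl ((C 0).thermoState D t)).sf x
        * (deriv (fun ε => (C ε).σf t x) 0 + divv (fun y => (C 0).σf t y • wf (t, y)) x)
      = inner ℝ (R.ff t x) (wf (t, x)) - contract (R.τf t x) (gradV (fun y => wf (t, y)) x)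
        + (-R.J t x * (deriv (fun ε => (C ε).γf t x) 0
            + inner ℝ (wf (t, x)) (gradient ((C 0).γf t) x))
          + R.J t x * (deriv (fun ε => (C ε).γs t x) 0
            + inner ℝ (ws (t, x)) (gradient ((C 0).γs t) x))))
    (hs : ∀ t ∈ Ioo 0 D.T, ∀ x ∈ D.Ω, (dl ((C 0).thermoState D t)).ss x
        * (deriv (fun ε => (C ε).σs t x) 0 + divv (fun y => (C 0).σs t y • ws (t, y)) x)
      = inner ℝ (R.fs t x) (ws (t, x)) - contract (R.τs t x) (gradV (fun y => ws (t, y)) x)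
        + (R.J t x * (deriv (fun ε => (C ε).γf t x) 0
            + inner ℝ (wf (t, x)) (gradient ((C 0).γf t) x))
          + -R.J t x * (deriv (fun ε => (C ε).γs t x) 0
            + inner ℝ (ws (t, x)) (gradient ((C 0).γs t) x)))) :
    VariationalConstraint D dl R C := by
  have hg : ∀ {η : Space → Space} {w : Space → Space} {x : Space}, x ∈ D.Ω →
      (∀ y ∈ D.Ω, η y = w y) → gradV η x = gradV w x := by
    intro η w x hx h
    ext i j
    refine pd_congr ?_
    filter_upwards [D.Ω_open.mem_nhds hx] with y hy
    rw [h y hy]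
  have hηf : ∀ t ∈ Ioo 0 D.T, ∀ x ∈ D.Ω, thermoEtaF C t x = wf (t, x) := fun t ht x hx =>
    (hη t (Ioo_subset_Icc_self ht) x (subset_closure hx)).1
  have hηs : ∀ t ∈ Ioo 0 D.T, ∀ x ∈ D.Ω, thermoEtaS C t x = ws (t, x) := fun t ht x hx =>
    (hη t (Ioo_subset_Icc_self ht) x (subset_closure hx)).2
  refine ⟨fun t ht x hx => ?_, fun t ht x hx => ?_⟩
  · rw [DdeltaBar, Ddelta, Ddelta, hg hx (hηf t ht), hηf t ht x hx, hηs t ht x hx,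
      divv_congr (w := fun y => (C 0).σf t y • wf (t, y)) D.Ω_open
        (fun y hy => by rw [hηf t ht y hy]) hx]
    exact hf t ht x hx
  · rw [DdeltaBar, Ddelta, Ddelta, hg hx (hηs t ht), hηf t ht x hx, hηs t ht x hx,
      divv_congr (w := fun y => (C 0).σs t y • ws (t, y)) D.Ω_open
        (fun y hy => by rw [hηs t ht y hy]) hx]
    exact hs t ht x hx

/-! ### The thermodynamic principle -/

/-- Variations of the entropies alone give the rates of the thermal displacements. -/
theorem IsThermoCritical.displacement (hl : IsFunctionalDeriv D.T D.Ω l dl)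
    (hc : c.IsAdmissible D) {bc : VariationClass} (h : IsThermoCritical D k bc l dl R c) :
    ∀ t ∈ Ioo 0 D.T, ∀ x ∈ D.Ω, Dt c.uf c.γf t x = -(dl (c.thermoState D t)).sf x ∧
      Dt c.us c.γs t x = -(dl (c.thermoState D t)).ss x := by
  obtain ⟨δ, hδ, hvar⟩ := hc.exists_variation
  obtain ⟨-, hG⟩ := hc.config.smooth_state hl hc.sf_smooth hc.ss_smooth
  have h01 : (0 : ℝ) ∈ Ioo (-1 : ℝ) 1 := hc.config.const.zero_mem
  have hu : SmoothIn D c.uf := hc.config.const.family_f.smooth_velocity.smoothIn h01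
  have hv : SmoothIn D c.us := hc.config.const.family_s.smooth_velocity.smoothIn h01
  have z1 := IsSmallTest.zero (V := ℝ) D δ
  have z3 := IsSmallTest.zero (V := Space) D δ
  have zs : SmoothST D.T D.Ω (fun _ _ => (0 : ℝ)) := z1.smoothST
  -- with `η = 0`, `δγ = 0` and `δσ = 0` the constraints hold and `δs` is arbitrary
  have key : ∀ pf ps : ℝ × Space → ℝ, IsSmallTest D δ pf → IsSmallTest D δ ps →
      ∫ p in D.cyl, (((dl (c.thermoState D p.1)).sf p.2 + Dt c.uf c.γf p.1 p.2) * pf p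
        + ((dl (c.thermoState D p.1)).ss p.2 + Dt c.us c.γs p.1 p.2) * ps p) = 0 := by
    intro pf ps hpf hps
    obtain ⟨C, hC, hC0, hη, hall, hγ, hlin⟩ := hvar _ _ _ _ _ _ _ (fun t x => pf (t, x))
      (fun t x => ps (t, x)) _ _ z3 z3 z1 z1 z1 z1 z1 hpf.smoothST hps.smoothST zs zs
    have hV : VariationalConstraint D dl R C := variationalConstraint_of_eq (wf := fun _ => 0)
      (ws := fun _ => 0) hη
      (fun t _ x _ => by
        simp [(hlin t x).2.2.1.1, (hlin t x).2.2.2.1, (hlin t x).2.2.2.2, divv, gradV, contract,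
          pd_const])
      (fun t _ x _ => by
        simp [(hlin t x).2.2.1.2, (hlin t x).2.2.2.1, (hlin t x).2.2.2.2, divv, gradV, contract,
          pd_const])
    obtain ⟨-, hd⟩ := hC.hasDerivAt_action hl k (hC.isThermoTest (hall _) hγ)
    rw [← hd.unique (h.stationary 1 C hC hC0 (hall bc) (fun _ => hγ) hV)]
    refine setIntegral_congr_fun D.isOpen_cyl.measurableSet fun p hp => ?_
    have hp1 := Ioo_subset_Icc_self hp.1
    have hp2 := subset_closure hp.2
    obtain ⟨⟨e1, e2, e3⟩, ⟨e4, e5⟩, ⟨e6, e7⟩, e8, e9⟩ := hlin p.1 p.2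
    have e10 : deriv (fun e => (C e).sf p.1 p.2 - (C e).σf p.1 p.2) 0 = pf p := by
      rw [deriv_fun_sub (hC.sf_smooth.hasDerivAt h01 hp1 hp2).differentiableAt
        (hC.σf_smooth.hasDerivAt h01 hp1 hp2).differentiableAt, e4, e6, sub_zero]
    have e11 : deriv (fun e => (C e).ss p.1 p.2 - (C e).σs p.1 p.2) 0 = ps p := by
      rw [deriv_fun_sub (hC.ss_smooth.hasDerivAt h01 hp1 hp2).differentiableAt
        (hC.σs_smooth.hasDerivAt h01 hp1 hp2).differentiableAt, e5, e7, sub_zero]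
    have e12 : deriv (fun e => k.solid (C e).μs p.1 p.2) 0 = 0 := by
      cases k
      · simp [Incompressible.solid]
      · exact e3
    obtain ⟨hηf, hηs⟩ := hη p.1 hp1 p.2 hp2
    have hηf' : etaF (fun ε => (C ε).toConfig) p.1 p.2 = 0 := hηf
    have hηs' : etaS (fun ε => (C ε).toConfig) p.1 p.2 = 0 := hηs
    simp only [thermoDensity, variationDensity, Ddelta, hηf, hηs, hηf', hηs', e1, e2, e4, e5, e8,
      e9, e10, e11, e12, hC0, inner_zero_right, inner_zero_left, mul_zero, zero_add, add_zero,
      sub_zero]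
    change _ = (dl (c.thermoState D p.1)).sf p.2 * pf p + (dl (c.thermoState D p.1)).ss p.2 * ps p
      + pf p * _ + ps p * _
    ring
  intro t ht x hx
  refine ⟨eq_neg_of_add_eq_zero_right ?_, eq_neg_of_add_eq_zero_right ?_⟩
  · refine SmoothIn.eq_zero_of_integral
      (h := fun t x => (dl (c.thermoState D t)).sf x + Dt c.uf c.γf t x)
      (fun t ht x hx => SmoothAt.add (hG.sf.smoothIn h01 t ht x hx)
        ((hu t ht x hx).Dt (hc.γf_smooth.smoothIn t ht x hx))) hδ (fun g hg => ?_) t ht x hx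
    simpa using key g _ hg z1
  · refine SmoothIn.eq_zero_of_integral
      (h := fun t x => (dl (c.thermoState D t)).ss x + Dt c.us c.γs t x)
      (fun t ht x hx => SmoothAt.add (hG.ss.smoothIn h01 t ht x hx)
        ((hv t ht x hx).Dt (hc.γs_smooth.smoothIn t ht x hx))) hδ (fun g hg => ?_) t ht x hx
    simpa using key _ g z1 hg

/-- The weak form of the equations of motion, tested with arbitrary displacements and variations
of the other unknowns, the generated entropies being varied according to the constraints. -/
theorem IsThermoCritical.integral_eq_zero (hl : IsFunctionalDeriv D.T D.Ω l dl)
    (hR : R.IsSmooth D) (hc : c.IsAdmissible D)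
    (hT : ∀ t ∈ Ioo 0 D.T, ∀ x ∈ D.Ω,
      (dl (c.thermoState D t)).sf x ≠ 0 ∧ (dl (c.thermoState D t)).ss x ≠ 0)
    {bc : VariationClass} (h : IsThermoCritical D k bc l dl R c) :
    ∃ δ : NNReal, 0 < δ ∧ ∀ (wf ws : ℝ × Space → Space) (g hf hs rf rs : ℝ × Space → ℝ),
      IsSmallTest D δ wf → IsSmallTest D δ ws → IsSmallTest D δ g → IsSmallTest D δ hf →
      IsSmallTest D δ hs → IsSmallTest D δ rf → IsSmallTest D δ rs →
      ∫ p in D.cyl, (inner ℝ (c.forceF D dl (c.thermoState D) p.1 p.2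
            + (divT (R.τf p.1) p.2 + R.ff p.1 p.2)) (wf p)
        + inner ℝ (c.forceS D k dl (c.thermoState D) p.1 p.2
            + (divT (R.τs p.1) p.2 + R.fs p.1 p.2)) (ws p)
        + c.fraction k dl (c.thermoState D) p.1 p.2 * g p
        + (c.φ p.1 p.2 - c.pushF D p.1 p.2) * hf p
        + k.solid (fun t x => (1 - c.φ t x) - c.pushS D t x) p.1 p.2 * hs p
        - Dbar c.uf (fun t x => c.sf t x - c.σf t x) p.1 p.2
          * (rf p + inner ℝ (wf p) (gradient (c.γf p.1) p.2))
        - Dbar c.us (fun t x => c.ss t x - c.σs t x) p.1 p.2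
          * (rs p + inner ℝ (ws p) (gradient (c.γs p.1) p.2))) = 0 := by
  obtain ⟨δ, hδ, hvar⟩ := hc.exists_variation
  refine ⟨δ, hδ, ?_⟩
  intro wf ws g hf hs rf rs hwf hws hg hhf hhs hrf hrs
  obtain ⟨-, hG⟩ := hc.config.smooth_state hl hc.sf_smooth hc.ss_smooth
  have h01 : (0 : ℝ) ∈ Ioo (-1 : ℝ) 1 := hc.config.const.zero_mem
  -- the heat exchange term of the fluid constraint; that of the solid has the opposite sign
  set A : ℝ → Space → ℝ := fun t x =>
    -R.J t x * (rf (t, x) + inner ℝ (wf (t, x)) (gradient (c.γf t) x))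
      + R.J t x * (rs (t, x) + inner ℝ (ws (t, x)) (gradient (c.γs t) x)) with hAdef
  have hA : SmoothIn D A := by
    intro t ht x hx
    have hJ := hR.J.smoothIn t ht x hx
    have h1 : SmoothAt (fun t x => wf (t, x)) t x := hwf.contDiff.contDiffAt
    have h2 : SmoothAt (fun t x => ws (t, x)) t x := hws.contDiff.contDiffAt
    have h3 : SmoothAt (fun t x => rf (t, x)) t x := hrf.contDiff.contDiffAt
    have h4 : SmoothAt (fun t x => rs (t, x)) t x := hrs.contDiff.contDiffAt
    exact (hJ.neg.mul (h3.add (h1.inner (hc.γf_smooth.smoothIn t ht x hx).gradient))).add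
      (hJ.mul (h4.add (h2.inner (hc.γs_smooth.smoothIn t ht x hx).gradient)))
  set K : Set (ℝ × Space) := (tsupport wf ∪ tsupport ws) ∪ (tsupport rf ∪ tsupport rs) with hKdef
  have hK : IsClosed K := ((isClosed_tsupport _).union (isClosed_tsupport _)).union
    ((isClosed_tsupport _).union (isClosed_tsupport _))
  have hKs : K ⊆ D.cyl :=
    union_subset (union_subset hwf.support hws.support) (union_subset hrf.support hrs.support)
  have hA0 : ∀ t x, (t, x) ∉ K → A t x = 0 := by
    intro t x hp
    simp only [hKdef, mem_union, not_or] at hp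
    simp only [hAdef, image_eq_zero_of_notMem_tsupport hp.1.1,
      image_eq_zero_of_notMem_tsupport hp.1.2, image_eq_zero_of_notMem_tsupport hp.2.1,
      image_eq_zero_of_notMem_tsupport hp.2.2, inner_zero_left, add_zero, mul_zero]
  have hqf := smoothST_solveConstraint (hG.sf.smoothIn h01) (fun t ht x hx => (hT t ht x hx).1)
    hc.σf_smooth.smoothIn hR.ff.smoothIn hR.τf.smoothIn hwf hA hK hKs hA0
  have hqs := smoothST_solveConstraint (hG.ss.smoothIn h01) (fun t ht x hx => (hT t ht x hx).2)
    hc.σs_smooth.smoothIn hR.fs.smoothIn hR.τs.smoothIn hws (fun t ht x hx => (hA t ht x hx).neg)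
    hK hKs (fun t x hp => by rw [hA0 t x hp, neg_zero])
  obtain ⟨C, hC, hC0, hη, hall, hγ, hlin⟩ := hvar wf ws g hf hs rf rs (fun _ _ => 0)
    (fun _ _ => 0) _ _ hwf hws hg hhf hhs hrf hrs (IsSmallTest.zero (V := ℝ) D δ).smoothST
    (IsSmallTest.zero (V := ℝ) D δ).smoothST hqf hqs
  have hV : VariationalConstraint D dl R C := by
    refine variationalConstraint_of_eq hη (fun t ht x hx => ?_) (fun t ht x hx => ?_)
    · rw [(hlin t x).2.2.1.1, (hlin t x).2.2.2.1, (hlin t x).2.2.2.2, hC0]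
      exact solveConstraint_spec (ls := fun t => (dl (c.thermoState D t)).sf) _ _ _ _
        (hT t ht x hx).1
    · rw [(hlin t x).2.2.1.2, (hlin t x).2.2.2.1, (hlin t x).2.2.2.2, hC0]
      refine (solveConstraint_spec (ls := fun t => (dl (c.thermoState D t)).ss) _ _ _ _
        (hT t ht x hx).2).trans ?_
      simp only [hAdef]
      ring
  have hdisp := h.displacement hl hc
  obtain ⟨-, hd⟩ := hC.hasDerivAt_action_constrained hl k (hC.isThermoTest (hall _) hγ) hR
    (by rw [hC0]; exact fun t ht x hx => (hdisp t ht x hx).1)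
    (by rw [hC0]; exact fun t ht x hx => (hdisp t ht x hx).2) hV
  rw [← hd.unique (h.stationary 1 C hC hC0 (hall bc) (fun _ => hγ) hV)]
  refine setIntegral_congr_fun D.isOpen_cyl.measurableSet fun p hp => ?_
  obtain ⟨⟨e1, e2, e3⟩, -, -, e8, e9⟩ := hlin p.1 p.2
  obtain ⟨hηf, hηs⟩ := hη p.1 (Ioo_subset_Icc_self hp.1) p.2 (subset_closure hp.2)
  have hηf' : etaF (fun ε => (C ε).toConfig) p.1 p.2 = wf (p.1, p.2) := hηf
  have hηs' : etaS (fun ε => (C ε).toConfig) p.1 p.2 = ws (p.1, p.2) := hηs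
  have hk := k.mul_deriv_solid (fun t x => 1 - c.φ t x - c.pushS D t x)
    (fun e => (C e).μs) p.1 p.2
  rw [e3] at hk
  simp only [thermoBalance, balanceDensity, Ddelta, hηf, hηs, hηf', hηs', hC0, hk, e1, e2, e8, e9]

/-- The thermodynamic principle for any class of variations implies the equations of motion. -/
theorem IsThermoCritical.generalThermoSystem (hl : IsFunctionalDeriv D.T D.Ω l dl)
    (hR : R.IsSmooth D) (hc : c.IsAdmissible D)
    (hT : ∀ t ∈ Ioo 0 D.T, ∀ x ∈ D.Ω,
      (dl (c.thermoState D t)).sf x ≠ 0 ∧ (dl (c.thermoState D t)).ss x ≠ 0)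
    {bc : VariationClass} (h : IsThermoCritical D k bc l dl R c) :
    GeneralThermoSystem D k dl R c := by
  obtain ⟨δ, hδ, hint⟩ := h.integral_eq_zero hl hR hc hT
  have hdisp := h.displacement hl hc
  have h01 : (0 : ℝ) ∈ Ioo (-1 : ℝ) 1 := hc.config.const.zero_mem
  have hu : SmoothIn D c.uf := hc.config.const.family_f.smooth_velocity.smoothIn h01
  have hv : SmoothIn D c.us := hc.config.const.family_s.smooth_velocity.smoothIn h01
  have z1 := IsSmallTest.zero (V := ℝ) D δ
  have z3 := IsSmallTest.zero (V := Space) D δ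
  -- the variations of the thermal displacements give the rates of the generated entropies
  have hDf : ∀ t ∈ Ioo 0 D.T, ∀ x ∈ D.Ω, Dbar c.uf (fun t x => c.sf t x - c.σf t x) t x = 0 := by
    refine SmoothIn.eq_zero_of_integral (fun t ht x hx => (hu t ht x hx).Dbar
      ((hc.sf_smooth.smoothIn t ht x hx).sub (hc.σf_smooth.smoothIn t ht x hx))) hδ
      fun g hg => ?_
    simpa [integral_neg] using hint _ _ _ _ _ _ _ z3 z3 z1 z1 z1 hg z1
  have hDs : ∀ t ∈ Ioo 0 D.T, ∀ x ∈ D.Ω, Dbar c.us (fun t x => c.ss t x - c.σs t x) t x = 0 := by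
    refine SmoothIn.eq_zero_of_integral (fun t ht x hx => (hv t ht x hx).Dbar
      ((hc.ss_smooth.smoothIn t ht x hx).sub (hc.σs_smooth.smoothIn t ht x hx))) hδ
      fun g hg => ?_
    simpa [integral_neg] using hint _ _ _ _ _ _ _ z3 z3 z1 z1 z1 z1 hg
  have key := eq_zero_of_integral_balance (D := D)
    (Af := fun t x => c.forceF D dl (c.thermoState D) t x + (divT (R.τf t) x + R.ff t x))
    (As := fun t x => c.forceS D k dl (c.thermoState D) t x + (divT (R.τs t) x + R.fs t x))
    (P := c.fraction k dl (c.thermoState D)) (Q := fun t x => c.φ t x - c.pushF D t x)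
    (R := k.solid fun t x => (1 - c.φ t x) - c.pushS D t x)
    (fun t ht x hx => (hc.config.smoothIn_forceF hl hc.sf_smooth hc.ss_smooth t ht x hx).add
      ((hR.τf.smoothIn t ht x hx).divT.add (hR.ff.smoothIn t ht x hx)))
    (fun t ht x hx => (hc.config.smoothIn_forceS k hl hc.sf_smooth hc.ss_smooth t ht x hx).add
      ((hR.τs.smoothIn t ht x hx).divT.add (hR.fs.smoothIn t ht x hx)))
    (hc.config.smoothIn_fraction k hl hc.sf_smooth hc.ss_smooth)
    (fun t ht x hx => (hc.config.φ_smooth.smoothIn t ht x hx).sub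
      (hc.config.smoothIn_pushF t ht x hx))
    (k.smoothIn_solid fun t ht x hx =>
      ((SmoothAt.const 1).sub (hc.config.φ_smooth.smoothIn t ht x hx)).sub
        (hc.config.smoothIn_pushS t ht x hx))
    hδ (fun wf ws g hf hs hwf hws hg hhf hhs => by
      rw [← hint wf ws g hf hs _ _ hwf hws hg hhf hhs z1 z1]
      refine setIntegral_congr_fun D.isOpen_cyl.measurableSet fun p hp => ?_
      simp only [hDf p.1 hp.1 p.2 hp.2, hDs p.1 hp.1 p.2 hp.2, zero_mul, sub_zero])
  have hcf : ∀ t ∈ Ioo 0 D.T, ∀ x ∈ D.Ω, c.φ t x = c.pushF D t x := fun t ht x hx =>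
    sub_eq_zero.1 (key t ht x hx).2.2.2.1
  have hcs : k = .both → ∀ t ∈ Ioo 0 D.T, ∀ x ∈ D.Ω, 1 - c.φ t x = c.pushS D t x := by
    rintro rfl t ht x hx
    exact sub_eq_zero.1 (key t ht x hx).2.2.2.2
  have hgf : ∀ t ∈ Ioo 0 D.T, ∀ x ∈ D.Ω, Dbar c.uf c.σf t x = Dbar c.uf c.sf t x := by
    intro t ht x hx
    have := hDf t ht x hx
    rw [Dbar_sub (hu t ht x hx) (hc.sf_smooth.smoothIn t ht x hx)
      (hc.σf_smooth.smoothIn t ht x hx)] at this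
    exact (sub_eq_zero.1 this).symm
  have hgs : ∀ t ∈ Ioo 0 D.T, ∀ x ∈ D.Ω, Dbar c.us c.σs t x = Dbar c.us c.ss t x := by
    intro t ht x hx
    have := hDs t ht x hx
    rw [Dbar_sub (hv t ht x hx) (hc.ss_smooth.smoothIn t ht x hx)
      (hc.σs_smooth.smoothIn t ht x hx)] at this
    exact (sub_eq_zero.1 this).symm
  exact
    { momentum := (generalMomentum_iff (fun _ => rfl) hcf hcs).2 fun t ht x hx =>
        ⟨(key t ht x hx).1, (key t ht x hx).2.1, (key t ht x hx).2.2.1⟩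
      kinematic := hc.config.kinematicEqs _ _
      entropy_f := fun t ht x hx => by
        rw [← hgf t ht x hx, h.phenomenological.fluid t ht x hx, (hdisp t ht x hx).1,
          (hdisp t ht x hx).2]
        ring
      entropy_s := fun t ht x hx => by
        rw [← hgs t ht x hx, h.phenomenological.solid t ht x hx, (hdisp t ht x hx).1,
          (hdisp t ht x hx).2]
        ring
      generated_f := hgf
      generated_s := hgs
      displacement_f := fun t ht x hx => (hdisp t ht x hx).1
      displacement_s := fun t ht x hx => (hdisp t ht x hx).2
      volume := hc.config.volumeEqs hcf hcs }

end

/-! ### The porous media Lagrangian -/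

section Energy

/-- Positive definiteness is an open condition. -/
theorem isOpen_posDef :
    IsOpen {B : Tensor | ∀ v : Fin 3 → ℝ, v ≠ 0 → 0 < ∑ i, ∑ j, v i * B i j * v j} := by
  rw [isOpen_iff_eventually]
  intro B hB
  have hq : Continuous fun p : Tensor × (Fin 3 → ℝ) => ∑ i, ∑ j, p.2 i * p.1 i j * p.2 j := by
    fun_prop
  have h1 : ∀ᶠ A in 𝓝 B, ∀ v ∈ Metric.sphere (0 : Fin 3 → ℝ) 1,
      0 < ∑ i, ∑ j, v i * A i j * v j := by
    refine (isCompact_sphere _ _).eventually_forall_of_forall_eventually fun v hv => ?_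
    exact hq.continuousAt.eventually (lt_mem_nhds (hB v (ne_zero_of_mem_unit_sphere ⟨v, hv⟩)))
  filter_upwards [h1] with A hA v hv
  have hn : 0 < ‖v‖ := norm_pos_iff.2 hv
  have h2 := hA (‖v‖⁻¹ • v) (by simp [norm_smul, hn.ne'])
  have h3 : ∑ i, ∑ j, v i * A i j * v j
      = ‖v‖ ^ 2 * ∑ i, ∑ j, (‖v‖⁻¹ • v) i * A i j * (‖v‖⁻¹ • v) j := by
    simp only [Pi.smul_apply, smul_eq_mul, Fin.sum_univ_three]
    field_simp
  rw [h3]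
  positivity

theorem Energies.contDiffAt_ef (e : Energies) {r h : ℝ} (B : Tensor) (hr : 0 < r) :
    ContDiffAt ℝ ∞ (fun p : ℝ × ℝ × Tensor => e.ef p.1 p.2.1) (r, h, B) := by
  have h1 : ContDiffAt ℝ ∞ (fun p : ℝ × ℝ => e.ef p.1 p.2) (r, h) :=
    e.ef_smooth.contDiffAt ((isOpen_lt continuous_const continuous_fst).mem_nhds hr)
  exact ContDiffAt.comp (r, h, B) (g := fun p : ℝ × ℝ => e.ef p.1 p.2)
    (f := fun p : ℝ × ℝ × Tensor => (p.1, p.2.1)) h1 (by fun_prop)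

theorem Energies.contDiffAt_es (e : Energies) {r h : ℝ} {B : Tensor} (hr : 0 < r)
    (hB : ∀ v : Fin 3 → ℝ, v ≠ 0 → 0 < ∑ i, ∑ j, v i * B i j * v j) :
    ContDiffAt ℝ ∞ (fun p : ℝ × ℝ × Tensor => e.es p.1 p.2.1 p.2.2) (r, h, B) := by
  refine e.es_smooth.contDiffAt (IsOpen.mem_nhds ?_ ⟨hr, hB⟩)
  exact (isOpen_lt continuous_const continuous_fst).inter
    (isOpen_posDef.preimage (continuous_snd.comp continuous_snd))

variable {E : Type*} [NormedAddCommGroup E] [NormedSpace ℝ E] {G : ℝ → ℝ → Tensor → ℝ}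

/-- A smooth function of actual density, specific entropy and Finger tensor, and its partial
derivatives, along smooth fields. -/
theorem contDiffAt_partials {r h : E → ℝ} {B : E → Tensor} {p : E}
    (hG : ContDiffAt ℝ ∞ (fun p : ℝ × ℝ × Tensor => G p.1 p.2.1 p.2.2) (r p, h p, B p))
    (hr : ContDiffAt ℝ ∞ r p) (hh : ContDiffAt ℝ ∞ h p) (hB : ContDiffAt ℝ ∞ B p) :
    ContDiffAt ℝ ∞ (fun q => G (r q) (h q) (B q)) p ∧
    ContDiffAt ℝ ∞ (fun q => deriv (fun z => G z (h q) (B q)) (r q)) p ∧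
    ContDiffAt ℝ ∞ (fun q => deriv (fun z => G (r q) z (B q)) (h q)) p ∧
    ∀ v, ContDiffAt ℝ ∞ (fun q => fderiv ℝ (fun z => G (r q) (h q) z) (B q) v) p := by
  have hle : (∞ : WithTop ℕ∞) + 1 ≤ ∞ := by norm_cast
  refine ⟨?_, ?_, ?_, fun v => ?_⟩
  · exact ContDiffAt.comp p (g := fun p : ℝ × ℝ × Tensor => G p.1 p.2.1 p.2.2) hG
      (hr.prodMk (hh.prodMk hB))
  · refine (ContDiffAt.fderiv (f := fun q z => G z (h q) (B q)) (n := ∞) ?_ hr hle).clm_apply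
      (contDiffAt_const (c := (1 : ℝ)))
    exact ContDiffAt.comp (p, r p) (g := fun p : ℝ × ℝ × Tensor => G p.1 p.2.1 p.2.2)
      (f := fun q : E × ℝ => (q.2, h q.1, B q.1)) hG
      (contDiffAt_snd.prodMk ((hh.comp (p, r p) contDiffAt_fst).prodMk
        (hB.comp (p, r p) contDiffAt_fst)))
  · refine (ContDiffAt.fderiv (f := fun q z => G (r q) z (B q)) (n := ∞) ?_ hh hle).clm_apply
      (contDiffAt_const (c := (1 : ℝ)))
    exact ContDiffAt.comp (p, h p) (g := fun p : ℝ × ℝ × Tensor => G p.1 p.2.1 p.2.2)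
      (f := fun q : E × ℝ => (r q.1, q.2, B q.1)) hG
      ((hr.comp (p, h p) contDiffAt_fst).prodMk (contDiffAt_snd.prodMk
        (hB.comp (p, h p) contDiffAt_fst)))
  · refine (ContDiffAt.fderiv (f := fun q z => G (r q) (h q) z) (n := ∞) ?_ hB hle).clm_apply
      (contDiffAt_const (c := v))
    exact ContDiffAt.comp (p, B p) (g := fun p : ℝ × ℝ × Tensor => G p.1 p.2.1 p.2.2)
      (f := fun q : E × Tensor => (r q.1, h q.1, q.2)) hG
      ((hr.comp (p, B p) contDiffAt_fst).prodMk ((hh.comp (p, B p) contDiffAt_fst).prodMk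
        contDiffAt_snd))

/-- Variation of `G (ρ/φ, s/ρ, b)`. -/
theorem hasDerivAt_specific {R H : ℝ → ℝ} {B : ℝ → Tensor} {ε R' H' : ℝ} {B' : Tensor}
    (hG : DifferentiableAt ℝ (fun p : ℝ × ℝ × Tensor => G p.1 p.2.1 p.2.2) (R ε, H ε, B ε))
    (hR : HasDerivAt R R' ε) (hH : HasDerivAt H H' ε) (hB : HasDerivAt B B' ε) :
    HasDerivAt (fun e => G (R e) (H e) (B e))
      (R' * deriv (fun z => G z (H ε) (B ε)) (R ε) + H' * deriv (fun z => G (R ε) z (B ε)) (H ε)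
        + fderiv ℝ (fun z => G (R ε) (H ε) z) (B ε) B') ε := by
  have h0 := hG.hasFDerivAt
  set L := fderiv ℝ (fun p : ℝ × ℝ × Tensor => G p.1 p.2.1 p.2.2) (R ε, H ε, B ε) with hL
  have h1 : HasDerivAt (fun e => G (R e) (H e) (B e)) (L (R', H', B')) ε :=
    HasFDerivAt.comp_hasDerivAt (l := fun p : ℝ × ℝ × Tensor => G p.1 p.2.1 p.2.2) ε h0
      (hR.prodMk (hH.prodMk hB))
  have h2 : HasDerivAt (fun z => G z (H ε) (B ε)) (L (1, 0, 0)) (R ε) :=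
    HasFDerivAt.comp_hasDerivAt (l := fun p : ℝ × ℝ × Tensor => G p.1 p.2.1 p.2.2) (R ε) h0
      ((hasDerivAt_id _).prodMk ((hasDerivAt_const _ _).prodMk (hasDerivAt_const _ _)))
  have h3 : HasDerivAt (fun z => G (R ε) z (B ε)) (L (0, 1, 0)) (H ε) :=
    HasFDerivAt.comp_hasDerivAt (l := fun p : ℝ × ℝ × Tensor => G p.1 p.2.1 p.2.2) (H ε) h0
      ((hasDerivAt_const _ _).prodMk ((hasDerivAt_id _).prodMk (hasDerivAt_const _ _)))
  have h4 : HasFDerivAt (fun z => G (R ε) (H ε) z)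
      (L.comp ((0 : Tensor →L[ℝ] ℝ).prod ((0 : Tensor →L[ℝ] ℝ).prod
        (ContinuousLinearMap.id ℝ Tensor)))) (B ε) :=
    HasFDerivAt.comp (g := fun p : ℝ × ℝ × Tensor => G p.1 p.2.1 p.2.2)
      (f := fun z => (R ε, H ε, z)) (B ε) h0
      ((hasFDerivAt_const _ _).prodMk ((hasFDerivAt_const _ _).prodMk (hasFDerivAt_id _)))
  rw [h2.deriv, h3.deriv, h4.fderiv]
  convert h1 using 1
  have e : ((R', H', B') : ℝ × ℝ × Tensor)
      = R' • (1, 0, 0) + H' • (0, 1, 0) + (0, 0, B') := by simp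
  rw [e, map_add, map_add, map_smul, map_smul]
  rfl

/-- Variation of the internal energy density `ρ G (ρ/φ, s/ρ, b)`. -/
theorem hasDerivAt_energy {r φ s : ℝ → ℝ} {B : ℝ → Tensor} {ε r' φ' s' : ℝ} {B' : Tensor}
    (hG : DifferentiableAt ℝ (fun p : ℝ × ℝ × Tensor => G p.1 p.2.1 p.2.2)
      (r ε / φ ε, s ε / r ε, B ε))
    (hr : HasDerivAt r r' ε) (hφ : HasDerivAt φ φ' ε) (hs : HasDerivAt s s' ε)
    (hB : HasDerivAt B B' ε) (hr0 : r ε ≠ 0) (hφ0 : φ ε ≠ 0) :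
    HasDerivAt (fun e => r e * G (r e / φ e) (s e / r e) (B e))
      (r' * (G (r ε / φ ε) (s ε / r ε) (B ε)
          + r ε / φ ε * deriv (fun z => G z (s ε / r ε) (B ε)) (r ε / φ ε)
          - s ε / r ε * deriv (fun z => G (r ε / φ ε) z (B ε)) (s ε / r ε))
        - (r ε / φ ε) ^ 2 * deriv (fun z => G z (s ε / r ε) (B ε)) (r ε / φ ε) * φ'
        + s' * deriv (fun z => G (r ε / φ ε) z (B ε)) (s ε / r ε)
        + r ε * fderiv ℝ (fun z => G (r ε / φ ε) (s ε / r ε) z) (B ε) B') ε := by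
  have h1 := hr.mul (hasDerivAt_specific (R := fun e => r e / φ e) (H := fun e => s e / r e) hG
    (hr.div hφ hφ0) (hs.div hr hr0) hB)
  refine HasDerivAt.congr_deriv h1 ?_
  field_simp
  ring

theorem symUnit_comm (i j : Fin 3) : symUnit i j = symUnit j i := by
  ext k m
  simp only [symUnit, add_comm]

/-- A linear form on symmetric tensors is the contraction with its values on the symmetrized
units. -/
theorem contract_symUnit (L : Tensor →L[ℝ] ℝ) {A : Tensor} (hA : ∀ i j, A i j = A j i) :
    contract (fun i j => L (symUnit i j)) A = L A := by
  have h : A = ∑ i, ∑ j, A i j • symUnit i j := by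
    ext k m
    have h1 : ∀ i j, (A i j • symUnit i j) k m = (A i j * (if k = i ∧ m = j then 1 else 0)
      + A i j * (if k = j ∧ m = i then 1 else 0)) / 2 := fun i j => by
      simp only [Pi.smul_apply, symUnit, smul_eq_mul]; ring
    simp only [Finset.sum_apply, h1]
    fin_cases k <;> fin_cases m <;> simp [Fin.sum_univ_three, hA 1 0, hA 2 0, hA 2 1]
  conv_rhs => rw [h]
  simp only [contract, map_sum, map_smul, smul_eq_mul, mul_comm]

end Energy

section

variable {D : Setup} {a : ℝ} {F : ℝ → ℝ → Fields}

/-- The fluid energy and its partial derivatives along a smooth family of states. -/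
theorem SmoothFamily.energy_f {T : ℝ} {Ω : Set Space} (hF : SmoothFamily a T Ω F)
    (hph : ∀ ε ∈ Ioo (-a) a, ∀ t ∈ Icc 0 T, (F ε t).IsPhysical Ω) (e : Energies) :
    (SmoothEST a T Ω (fun ε t => (F ε t).rbf) ∧ SmoothEST a T Ω (fun ε t => (F ε t).hf)) ∧
    SmoothEST a T Ω (fun ε t x => e.ef ((F ε t).rbf x) ((F ε t).hf x)) ∧
    SmoothEST a T Ω (fun ε t => e.efρ (F ε t)) ∧ SmoothEST a T Ω (fun ε t => e.tempF (F ε t)) := by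
  have h1 : SmoothEST a T Ω (fun ε t => (F ε t).rbf) := fun ε hε t ht x hx =>
    (hF.ρf ε hε t ht x hx).div (hF.φ ε hε t ht x hx) ((hph ε hε t ht).φ_pos x hx).ne'
  have h2 : SmoothEST a T Ω (fun ε t => (F ε t).hf) := fun ε hε t ht x hx =>
    (hF.sf ε hε t ht x hx).div (hF.ρf ε hε t ht x hx) ((hph ε hε t ht).ρf_pos x hx).ne'
  have h := fun ε hε t ht x hx => contDiffAt_partials (G := fun r h _ => e.ef r h)
    (p := (ε, t, x)) (r := fun q : ℝ × ℝ × Space => (F q.1 q.2.1).rbf q.2.2)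
    (h := fun q => (F q.1 q.2.1).hf q.2.2) (B := fun q => (F q.1 q.2.1).b q.2.2)
    (e.contDiffAt_ef ((F ε t).b x) (div_pos ((hph ε hε t ht).ρf_pos x hx)
      ((hph ε hε t ht).φ_pos x hx))) (h1 ε hε t ht x hx) (h2 ε hε t ht x hx) (hF.b ε hε t ht x hx)
  exact ⟨⟨h1, h2⟩, fun ε hε t ht x hx => (h ε hε t ht x hx).1,
    fun ε hε t ht x hx => (h ε hε t ht x hx).2.1, fun ε hε t ht x hx => (h ε hε t ht x hx).2.2.1⟩

/-- The solid energy and its partial derivatives along a smooth family of states. -/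
theorem SmoothFamily.energy_s {T : ℝ} {Ω : Set Space} (hF : SmoothFamily a T Ω F)
    (hph : ∀ ε ∈ Ioo (-a) a, ∀ t ∈ Icc 0 T, (F ε t).IsPhysical Ω) (e : Energies) :
    (SmoothEST a T Ω (fun ε t => (F ε t).rbs) ∧ SmoothEST a T Ω (fun ε t => (F ε t).hs)) ∧
    SmoothEST a T Ω (fun ε t x => e.es ((F ε t).rbs x) ((F ε t).hs x) ((F ε t).b x)) ∧
    SmoothEST a T Ω (fun ε t => e.esρ (F ε t)) ∧ SmoothEST a T Ω (fun ε t => e.tempS (F ε t)) ∧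
    SmoothEST a T Ω (fun ε t => e.esb (F ε t)) := by
  have h1 : SmoothEST a T Ω (fun ε t => (F ε t).rbs) := fun ε hε t ht x hx =>
    (hF.ρs ε hε t ht x hx).div (contDiffAt_const.sub (hF.φ ε hε t ht x hx))
      (sub_pos.2 ((hph ε hε t ht).φ_lt_one x hx)).ne'
  have h2 : SmoothEST a T Ω (fun ε t => (F ε t).hs) := fun ε hε t ht x hx =>
    (hF.ss ε hε t ht x hx).div (hF.ρs ε hε t ht x hx) ((hph ε hε t ht).ρs_pos x hx).ne'
  have h := fun ε hε t ht x hx => contDiffAt_partials (G := e.es)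
    (p := (ε, t, x)) (r := fun q : ℝ × ℝ × Space => (F q.1 q.2.1).rbs q.2.2)
    (h := fun q => (F q.1 q.2.1).hs q.2.2) (B := fun q => (F q.1 q.2.1).b q.2.2)
    (e.contDiffAt_es (div_pos ((hph ε hε t ht).ρs_pos x hx)
      (sub_pos.2 ((hph ε hε t ht).φ_lt_one x hx))) ((hph ε hε t ht).b_pos x hx))
    (h1 ε hε t ht x hx) (h2 ε hε t ht x hx) (hF.b ε hε t ht x hx)
  exact ⟨⟨h1, h2⟩, fun ε hε t ht x hx => (h ε hε t ht x hx).1,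
    fun ε hε t ht x hx => (h ε hε t ht x hx).2.1, fun ε hε t ht x hx => (h ε hε t ht x hx).2.2.1,
    fun ε hε t ht x hx => contDiffAt_pi.2 fun i => contDiffAt_pi.2 fun j =>
      (h ε hε t ht x hx).2.2.2 (symUnit i j)⟩

theorem SmoothEST.norm_sq {T : ℝ} {Ω : Set Space} {f : ℝ → ℝ → Space → Space}
    (hf : SmoothEST a T Ω f) : SmoothEST a T Ω (fun ε t x => ‖f ε t x‖ ^ 2) :=
  fun ε hε t ht x hx => ContDiffAt.norm_sq ℝ (hf ε hε t ht x hx)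

/-- The functional derivatives of the porous media Lagrangian are the partial derivatives of its
integrand. -/
theorem Energies.isFunctionalDeriv (e : Energies) (D : Setup) :
    IsFunctionalDeriv D.T D.Ω (e.lagrangian D.Ω) e.dLagrangian := by
  intro a F hF hph
  obtain ⟨⟨f1, f2⟩, f3, f4, f5⟩ := hF.energy_f hph e
  obtain ⟨⟨s1, s2⟩, s3, s4, s5, s6⟩ := hF.energy_s hph e
  have half : SmoothEST a D.T D.Ω (fun _ _ _ => (1 / 2 : ℝ)) := SmoothEST.const _
  have hL : SmoothEST a D.T D.Ω (fun ε t x => 1 / 2 * (F ε t).ρf x * ‖(F ε t).uf x‖ ^ 2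
      - (F ε t).ρf x * e.ef ((F ε t).rbf x) ((F ε t).hf x)
      + 1 / 2 * (F ε t).ρs x * ‖(F ε t).us x‖ ^ 2
      - (F ε t).ρs x * e.es ((F ε t).rbs x) ((F ε t).hs x) ((F ε t).b x)) :=
    ((((half.mul hF.ρf).mul hF.uf.norm_sq).sub (hF.ρf.mul f3)).add
      ((half.mul hF.ρs).mul hF.us.norm_sq)).sub (hF.ρs.mul s3)
  refine ⟨⟨?_, ?_, ?_, ?_, ?_, ?_, ?_, ?_⟩, fun ε hε t ht => ⟨fun x hx i j => ?_, ?_⟩⟩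
  · exact fun ε hε t ht x hx => (hF.ρf ε hε t ht x hx).smul (hF.uf ε hε t ht x hx)
  · exact fun ε hε t ht x hx => (hF.ρs ε hε t ht x hx).smul (hF.us ε hε t ht x hx)
  · exact (((half.mul hF.uf.norm_sq).sub f3).sub (f1.mul f4)).add (f2.mul f5)
  · exact (((half.mul hF.us.norm_sq).sub s3).sub (s1.mul s4)).add (s2.mul s5)
  · exact fun ε hε t ht x hx => (f5 ε hε t ht x hx).neg
  · exact fun ε hε t ht x hx => (s5 ε hε t ht x hx).neg
  · exact fun ε hε t ht x hx => contDiffAt_pi.2 fun i => contDiffAt_pi.2 fun j =>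
      (hF.ρs ε hε t ht x hx).neg.mul
        (SmoothAt₃.entry (f := fun ε t => e.esb (F ε t)) (s6 ε hε t ht x hx) i j)
  · exact fun ε hε t ht x hx => (((f1 ε hε t ht x hx).pow 2).mul (f4 ε hε t ht x hx)).sub
      (((s1 ε hε t ht x hx).pow 2).mul (s4 ε hε t ht x hx))
  · simp only [Energies.dLagrangian, Energies.esb, symUnit_comm i j]
  · have hd := hL.hasDerivAt_integral hε ht
    refine HasDerivAt.congr_deriv hd (Eq.symm ?_)
    refine setIntegral_congr_fun D.Ω_open.measurableSet fun x hx => ?_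
    have hx' := subset_closure hx
    have hp := hph ε hε t ht
    have d1 := hF.uf.hasDerivAt hε ht hx'
    have d2 := hF.us.hasDerivAt hε ht hx'
    have d3 := hF.ρf.hasDerivAt hε ht hx'
    have d4 := hF.ρs.hasDerivAt hε ht hx'
    have d5 := hF.sf.hasDerivAt hε ht hx'
    have d6 := hF.ss.hasDerivAt hε ht hx'
    have d7 := hF.b.hasDerivAt hε ht hx'
    have d8 := hF.φ.hasDerivAt hε ht hx'
    have hb : ∀ i j, deriv (fun e => (F e t).b x) ε i j = deriv (fun e => (F e t).b x) ε j i := by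
      intro i j
      rw [deriv_entry d7.differentiableAt, deriv_entry d7.differentiableAt]
      refine Filter.EventuallyEq.deriv_eq ?_
      filter_upwards [isOpen_Ioo.mem_nhds hε] with e he using (hph e he t ht).b_symm x hx' i j
    have k1 := hasDerivAt_energy (G := fun r h _ => e.ef r h) (r := fun e => (F e t).ρf x)
      (φ := fun e => (F e t).φ x) (s := fun e => (F e t).sf x) (B := fun e => (F e t).b x)
      (differentiableAt_of_smooth (e.contDiffAt_ef ((F ε t).b x)
        (div_pos (hp.ρf_pos x hx') (hp.φ_pos x hx'))))
      d3 d8 d5 d7 (hp.ρf_pos x hx').ne' (hp.φ_pos x hx').ne'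
    have k2 := hasDerivAt_energy (G := e.es) (r := fun e => (F e t).ρs x)
      (φ := fun e => 1 - (F e t).φ x) (s := fun e => (F e t).ss x) (B := fun e => (F e t).b x)
      (differentiableAt_of_smooth
      (e.contDiffAt_es (div_pos (hp.ρs_pos x hx') (sub_pos.2 (hp.φ_lt_one x hx')))
        (hp.b_pos x hx'))) d4 (d8.const_sub 1) d6 d7 (hp.ρs_pos x hx').ne'
      (sub_pos.2 (hp.φ_lt_one x hx')).ne'
    have k3 := ((((d3.const_mul (1 / 2)).mul d1.norm_sq).sub k1).add
      ((d4.const_mul (1 / 2)).mul d2.norm_sq)).sub k2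
    have k4 := contract_symUnit (fderiv ℝ (fun z => e.es ((F ε t).rbs x) ((F ε t).hs x) z)
      ((F ε t).b x)) hb
    have k5 : contract (fun i j => -(F ε t).ρs x * e.esb (F ε t) x i j)
        (deriv (fun e => (F e t).b x) ε) = -(F ε t).ρs x * fderiv ℝ
          (fun z => e.es ((F ε t).rbs x) ((F ε t).hs x) z) ((F ε t).b x)
          (deriv (fun e => (F e t).b x) ε) := by
      rw [← k4]
      simp only [contract, Energies.esb, Fin.sum_univ_three]
      ring
    refine Eq.trans ?_ k3.deriv.symm
    simp only [Energies.dLagrangian, k5, real_inner_smul_left, Energies.pF, Energies.pS,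
      Energies.efρ, Energies.esρ, Energies.tempF, Energies.tempS, fderiv_fun_const]
    simp only [Fields.rbf, Fields.rbs, Fields.hf, Fields.hs, Pi.zero_apply,
      _root_.zero_apply]
    ring

end

/-! ### The momentum balance of a porous medium -/

section Balance

variable {t : ℝ} {x : Space}

theorem gradient_half_norm_sq {u : Space → Space} (hu : DifferentiableAt ℝ u x) (i : Fin 3) :
    pd i (fun y => 1 / 2 * ‖u y‖ ^ 2) x = ∑ j, u x j * pd i (fun y => u y j) x := by
  have h := (hu.hasFDerivAt.norm_sq.const_mul (1 / 2 : ℝ)).fderiv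
  rw [pd, h]
  simp [inner_eq_sum, fderiv_coord hu, pd]

/-- The momentum density `ρ u` of a medium whose mass is conserved. -/
theorem deriv_add_lieMomentum_smul_velocity {ρ : ℝ → Space → ℝ} {u : ℝ → Space → Space}
    (hρ : SmoothAt ρ t x) (hu : SmoothAt u t x)
    (hm : deriv (fun τ => ρ τ x) t + divv (fun y => ρ t y • u t y) x = 0) :
    deriv (fun τ => ρ τ x • u τ x) t + lieMomentum (u t) (fun y => ρ t y • u t y) x
      = ρ t x • (deriv (fun τ => u τ x) t + advect (u t) (u t) x)
        + ρ t x • gradient (fun y => 1 / 2 * ‖u t y‖ ^ 2) x := by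
  ext i
  have e1 : deriv (fun τ => ρ τ x * u τ x i) t = _ :=
    (hρ.ds.hasDerivAt.mul (hu.coord i).ds.hasDerivAt).deriv
  have e2 : ∀ i j, pd j (fun y => ρ t y * u t y i) x = _ := fun i j =>
    pd_mul hρ.dx (hu.coord i).dx
  simp only [divv, PiLp.smul_apply, smul_eq_mul, e2, Fin.sum_univ_three] at hm
  simp only [PiLp.add_apply, PiLp.smul_apply, smul_eq_mul, deriv_coord (hρ.smul hu).ds,
    deriv_coord hu.ds, e1, lieMomentum, e2, gradient_apply, gradient_half_norm_sq hu.dx, advect,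
    fderiv_coord_eq_sum hu.dx, divv, Fin.sum_univ_three]
  linear_combination u t x i * hm

/-- Space derivatives of a function of actual density, specific entropy and Finger tensor. -/
theorem pd_specific {G : ℝ → ℝ → Tensor → ℝ} {R H : Space → ℝ} {B : Space → Tensor}
    (hG : DifferentiableAt ℝ (fun p : ℝ × ℝ × Tensor => G p.1 p.2.1 p.2.2) (R x, H x, B x))
    (hR : DifferentiableAt ℝ R x) (hH : DifferentiableAt ℝ H x) (hB : DifferentiableAt ℝ B x)
    (i : Fin 3) :
    pd i (fun y => G (R y) (H y) (B y)) x
      = pd i R x * deriv (fun z => G z (H x) (B x)) (R x)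
        + pd i H x * deriv (fun z => G (R x) z (B x)) (H x)
        + fderiv ℝ (fun z => G (R x) (H x) z) (B x) (fderiv ℝ B x (EuclideanSpace.single i 1)) := by
  set γ : ℝ → Space := fun ε => x + ε • EuclideanSpace.single i 1 with hγ
  have h0 : γ 0 = x := by simp [hγ]
  have hd : HasDerivAt γ (EuclideanSpace.single i 1) 0 :=
    (((hasDerivAt_id (0 : ℝ)).smul_const (EuclideanSpace.single i (1 : ℝ))).const_add x).congr_deriv
      (one_smul _ _)
  have line : ∀ {V : Type} [NormedAddCommGroup V] [NormedSpace ℝ V] {f : Space → V},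
      DifferentiableAt ℝ f x →
      HasDerivAt (fun ε => f (γ ε)) (fderiv ℝ f x (EuclideanSpace.single i 1)) 0 := by
    intro V _ _ f hf
    exact HasFDerivAt.comp_hasDerivAt (l := f) 0 (by rw [h0]; exact hf.hasFDerivAt) hd
  have h1 := hasDerivAt_specific (R := fun ε => R (γ ε)) (H := fun ε => H (γ ε))
    (B := fun ε => B (γ ε)) (G := G) (by simpa only [h0] using hG) (line hR) (line hH) (line hB)
  have hc : DifferentiableAt ℝ (fun y => G (R y) (H y) (B y)) x :=
    DifferentiableAt.comp x (g := fun p : ℝ × ℝ × Tensor => G p.1 p.2.1 p.2.2)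
      (f := fun y => (R y, H y, B y)) hG (hR.prodMk (hH.prodMk hB))
  have h2 := (line hc).unique h1
  simp only [h0] at h2
  exact h2

/-- The thermodynamic part of the momentum balance: the derivatives of the energy density combine
to the gradient of the pressure `R² ∂G/∂R`, where `R = ρ/ϕ`, and to the derivative along `b`. -/
theorem energy_gradient {G : ℝ → ℝ → Tensor → ℝ} {ρ ϕ s : Space → ℝ} {B : Space → Tensor}
    {u : Space → Space} (hρ : ContDiffAt ℝ ∞ ρ x) (hϕ : ContDiffAt ℝ ∞ ϕ x)
    (hs : ContDiffAt ℝ ∞ s x) (hB : ContDiffAt ℝ ∞ B x) (hu : ContDiffAt ℝ ∞ u x)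
    (hρ0 : ρ x ≠ 0) (hϕ0 : ϕ x ≠ 0)
    (hG : ContDiffAt ℝ ∞ (fun p : ℝ × ℝ × Tensor => G p.1 p.2.1 p.2.2)
      (ρ x / ϕ x, s x / ρ x, B x)) :
    ρ x • gradient (fun y => 1 / 2 * ‖u y‖ ^ 2 - G (ρ y / ϕ y) (s y / ρ y) (B y)
        - ρ y / ϕ y * deriv (fun z => G z (s y / ρ y) (B y)) (ρ y / ϕ y)
        + s y / ρ y * deriv (fun z => G (ρ y / ϕ y) z (B y)) (s y / ρ y)) x
      + s x • gradient (fun y => -deriv (fun z => G (ρ y / ϕ y) z (B y)) (s y / ρ y)) x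
    = ρ x • gradient (fun y => 1 / 2 * ‖u y‖ ^ 2) x
      - ϕ x • gradient
        (fun y => (ρ y / ϕ y) ^ 2 * deriv (fun z => G z (s y / ρ y) (B y)) (ρ y / ϕ y)) x
      - ρ x • WithLp.toLp 2 (fun i => fderiv ℝ (fun z => G (ρ x / ϕ x) (s x / ρ x) z) (B x)
          (fderiv ℝ B x (EuclideanSpace.single i 1))) := by
  have hR := hρ.div hϕ hϕ0
  have hH := hs.div hρ hρ0
  obtain ⟨g0, g1, g2, -⟩ := contDiffAt_partials (r := fun y => ρ y / ϕ y) (h := fun y => s y / ρ y)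
    hG hR hH hB
  have dR : DifferentiableAt ℝ (fun y => ρ y / ϕ y) x := differentiableAt_of_smooth hR
  have dH : DifferentiableAt ℝ (fun y => s y / ρ y) x := differentiableAt_of_smooth hH
  have d0 := differentiableAt_of_smooth g0
  have d1 := differentiableAt_of_smooth g1
  have d2 := differentiableAt_of_smooth g2
  have dn : DifferentiableAt ℝ (fun y => 1 / 2 * ‖u y‖ ^ 2) x :=
    differentiableAt_of_smooth (contDiffAt_const.mul (hu.norm_sq ℝ))
  ext i
  have hpow : (fun y => (ρ y / ϕ y) ^ 2 * deriv (fun z => G z (s y / ρ y) (B y)) (ρ y / ϕ y))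
      = fun y => ρ y / ϕ y * (ρ y / ϕ y * deriv (fun z => G z (s y / ρ y) (B y)) (ρ y / ϕ y)) := by
    funext y; ring
  simp only [PiLp.add_apply, PiLp.sub_apply, PiLp.smul_apply, smul_eq_mul, gradient_apply, hpow]
  rw [pd_add ((dn.fun_sub d0).fun_sub (dR.fun_mul d1)) (dH.fun_mul d2),
    pd_sub (dn.fun_sub d0) (dR.fun_mul d1), pd_sub dn d0, pd_mul dR d1, pd_mul dH d2, pd_neg,
    pd_mul dR (dR.fun_mul d1), pd_mul dR d1,
    pd_specific (R := fun y => ρ y / ϕ y) (H := fun y => s y / ρ y)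
      (differentiableAt_of_smooth hG) dR dH (differentiableAt_of_smooth hB)]
  field_simp
  ring

end Balance

section

variable {D : Setup} {e : Energies} {F : ℝ → Fields} {k : Incompressible}

/-- The fluid momentum balance in terms of the acceleration and of the pressure. -/
theorem Energies.fluid_balance (e : Energies) (hF : SmoothFamily 1 D.T D.Ω (fun _ t => F t))
    (hph : ∀ t ∈ Icc 0 D.T, (F t).IsPhysical D.Ω) (hk : KinematicEqs D F) {t : ℝ}
    (ht : t ∈ Ioo 0 D.T) {x : Space} (hx : x ∈ D.Ω) :
    deriv (fun τ => (e.dLagrangian (F τ)).uf x) t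
        + lieMomentum (F t).uf (e.dLagrangian (F t)).uf x
      - ((F t).ρf x • gradient (e.dLagrangian (F t)).ρf x
        + (F t).sf x • gradient (e.dLagrangian (F t)).sf x)
      = (F t).ρf x • (deriv (fun τ => (F τ).uf x) t + advect (F t).uf (F t).uf x)
        + (F t).φ x • gradient (e.pF (F t)) x := by
  have h01 : (0 : ℝ) ∈ Ioo (-1 : ℝ) 1 := by norm_num
  have hp := hph t (Ioo_subset_Icc_self ht)
  have hx' := subset_closure hx
  have hρ := hF.ρf.smoothIn h01 t ht x hx
  have hu := hF.uf.smoothIn h01 t ht x hx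
  have h1 := deriv_add_lieMomentum_smul_velocity hρ hu (hk.mass_f t ht x hx)
  have h2 := energy_gradient (G := fun r h _ => e.ef r h) hρ.slice
    (hF.φ.smoothIn h01 t ht x hx).slice (hF.sf.smoothIn h01 t ht x hx).slice
    (hF.b.smoothIn h01 t ht x hx).slice hu.slice (hp.ρf_pos x hx').ne' (hp.φ_pos x hx').ne'
    (e.contDiffAt_ef ((F t).b x) (div_pos (hp.ρf_pos x hx') (hp.φ_pos x hx')))
  have h3 : (WithLp.toLp 2 (fun i => fderiv ℝ
      (fun _ : Tensor => e.ef ((F t).ρf x / (F t).φ x) ((F t).sf x / (F t).ρf x)) ((F t).b x)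
      (fderiv ℝ (F t).b x (EuclideanSpace.single i 1))) : Space) = 0 := by
    ext i; simp
  simp only [h3, smul_zero, sub_zero] at h2
  change deriv (fun τ => (F τ).ρf x • (F τ).uf x) t
      + lieMomentum (F t).uf (fun y => (F t).ρf y • (F t).uf y) x
    - _ = _ + (F t).φ x • gradient (fun y => ((F t).ρf y / (F t).φ y) ^ 2
      * deriv (fun z => e.ef z ((F t).sf y / (F t).ρf y)) ((F t).ρf y / (F t).φ y)) x
  rw [h1]
  refine (congrArg (fun w => _ - w) h2).trans ?_
  abel

/-- The solid momentum balance in terms of the acceleration, the pressure and the elastic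
stress. -/
theorem Energies.solid_balance (e : Energies) (hF : SmoothFamily 1 D.T D.Ω (fun _ t => F t))
    (hph : ∀ t ∈ Icc 0 D.T, (F t).IsPhysical D.Ω) (hk : KinematicEqs D F) {t : ℝ}
    (ht : t ∈ Ioo 0 D.T) {x : Space} (hx : x ∈ D.Ω) :
    deriv (fun τ => (e.dLagrangian (F τ)).us x) t
        + lieMomentum (F t).us (e.dLagrangian (F t)).us x
      - ((F t).ρs x • gradient (e.dLagrangian (F t)).ρs x
        + (F t).ss x • gradient (e.dLagrangian (F t)).ss x)
      + contractGrad ((e.dLagrangian (F t)).b x) (F t).b x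
      + (2 : ℝ) • divT (fun y => tmul ((e.dLagrangian (F t)).b y) ((F t).b y)) x
      = (F t).ρs x • (deriv (fun τ => (F τ).us x) t + advect (F t).us (F t).us x)
        + (1 - (F t).φ x) • gradient (e.pS (F t)) x - divT (e.sigmaEl (F t)) x := by
  have h01 : (0 : ℝ) ∈ Ioo (-1 : ℝ) 1 := by norm_num
  have hp := hph t (Ioo_subset_Icc_self ht)
  have hx' := subset_closure hx
  have hρ := hF.ρs.smoothIn h01 t ht x hx
  have hu := hF.us.smoothIn h01 t ht x hx
  have hb := hF.b.smoothIn h01 t ht x hx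
  have hφ := hF.φ.smoothIn h01 t ht x hx
  have hE : SmoothAt (fun t => e.esb (F t)) t x :=
    (hF.energy_s (fun _ _ t ht => hph t ht) e).2.2.2.2.smoothIn h01 t ht x hx
  have h1 := deriv_add_lieMomentum_smul_velocity hρ hu (hk.mass_s t ht x hx)
  have h2 := energy_gradient (G := e.es) (ϕ := fun y => 1 - (F t).φ y) hρ.slice
    (contDiffAt_const.sub hφ.slice) (hF.ss.smoothIn h01 t ht x hx).slice hb.slice hu.slice
    (hp.ρs_pos x hx').ne' (sub_pos.2 (hp.φ_lt_one x hx')).ne'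
    (e.contDiffAt_es (div_pos (hp.ρs_pos x hx') (sub_pos.2 (hp.φ_lt_one x hx')))
      (hp.b_pos x hx'))
  -- the derivative of the energy along `b` is the contraction of `∂e/∂b` with `∇b`
  have h3 : (WithLp.toLp 2 (fun i => fderiv ℝ (fun z => e.es ((F t).ρs x / (1 - (F t).φ x))
      ((F t).ss x / (F t).ρs x) z) ((F t).b x)
      (fderiv ℝ (F t).b x (EuclideanSpace.single i 1))) : Space)
      = contractGrad (e.esb (F t) x) (F t).b x := by
    have hd := hb.dx
    have hentry : ∀ i m n, fderiv ℝ (F t).b x (EuclideanSpace.single i 1) m n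
        = pd i (fun y => (F t).b y m n) x := fun i m n => by
      have q1 := hasFDerivAt_pi'.1 (hasFDerivAt_pi'.1 hd.hasFDerivAt m) n
      rw [pd, q1.fderiv]; rfl
    ext i
    change fderiv ℝ (fun z => e.es ((F t).ρs x / (1 - (F t).φ x))
      ((F t).ss x / (F t).ρs x) z) ((F t).b x) (fderiv ℝ (F t).b x (EuclideanSpace.single i 1))
      = contract (e.esb (F t) x) (fun m n => pd i (fun y => (F t).b y m n) x)
    rw [← contract_symUnit]
    · simp only [contract, hentry]
      rfl
    · intro m n
      rw [hentry, hentry]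
      refine pd_congr ?_
      filter_upwards [D.Ω_open.mem_nhds hx] with y hy using hp.b_symm y (subset_closure hy) m n
  have h4 : contractGrad ((e.dLagrangian (F t)).b x) (F t).b x
      = -((F t).ρs x • contractGrad (e.esb (F t) x) (F t).b x) := by
    ext i
    simp only [contractGrad, contract, PiLp.neg_apply, PiLp.smul_apply, smul_eq_mul,
      Energies.dLagrangian, Fin.sum_univ_three]
    ring
  have h5 : (2 : ℝ) • divT (fun y => tmul ((e.dLagrangian (F t)).b y) ((F t).b y)) x
      = -divT (e.sigmaEl (F t)) x := by
    have q1 : ∀ i j, DifferentiableAt ℝ (fun y => tmul ((e.dLagrangian (F t)).b y) ((F t).b y) i j)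
        x := fun i j => by
      have q2 : SmoothAt (fun t y => tmul ((e.dLagrangian (F t)).b y) ((F t).b y) i j) t x :=
        SmoothAt.sum fun m _ => ((hρ.neg).mul (hE.entry i m)).mul (hb.entry m j)
      exact q2.dx
    have q3 : ∀ i j, (fun y => e.sigmaEl (F t) y i j)
        = fun y => -((2 : ℝ) * tmul ((e.dLagrangian (F t)).b y) ((F t).b y) i j) := fun i j => by
      funext y
      simp only [Energies.sigmaEl, tmul, Energies.dLagrangian, Fin.sum_univ_three]
      ring
    have q4 : ∀ i j, pd j (fun y => (2 : ℝ) * tmul ((e.dLagrangian (F t)).b y) ((F t).b y) i j) x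
        = _ := fun i j => pd_mul (differentiableAt_const _) (q1 i j)
    ext i
    simp only [divT, PiLp.smul_apply, PiLp.neg_apply, smul_eq_mul, q3, pd_neg, q4, pd_const,
      mul_zero, add_zero, Fin.sum_univ_three]
    ring
  rw [h3] at h2
  rw [h4, h5]
  change deriv (fun τ => (F τ).ρs x • (F τ).us x) t
      + lieMomentum (F t).us (fun y => (F t).ρs y • (F t).us y) x
    - _ + _ + _ = _ + (1 - (F t).φ x) • gradient (fun y => ((F t).ρs y / (1 - (F t).φ y)) ^ 2
      * deriv (fun z => e.es z ((F t).ss y / (F t).ρs y) ((F t).b y))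
        ((F t).ρs y / (1 - (F t).φ y))) x - _
  rw [h1]
  refine (congrArg (fun w => _ - w + _ + _) h2).trans ?_
  abel

/-- Under the pressure condition the momentum equations of the porous media Lagrangian are those
with the pressure. -/
theorem PressureCondition.momentum_iff (hF : SmoothFamily 1 D.T D.Ω (fun _ t => F t))
    (hph : ∀ t ∈ Icc 0 D.T, (F t).IsPhysical D.Ω) (hk : KinematicEqs D F)
    {μf μs p : ℝ → Space → ℝ} (hμf : SmoothIn D μf) (hμs : SmoothIn D μs)
    (hp : PressureCondition D e F μf μs p) {Ff Fs : ℝ → Space → Space} :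
    GeneralMomentum D F (fun t => e.dLagrangian (F t)) μf μs Ff Fs
      ↔ PorousMomentum D e F p Ff Fs := by
  have h01 : (0 : ℝ) ∈ Ioo (-1 : ℝ) 1 := by norm_num
  obtain ⟨⟨f1, -⟩, -, f4, -⟩ := hF.energy_f (fun _ _ t ht => hph t ht) e
  obtain ⟨⟨s1, -⟩, -, s4, -⟩ := hF.energy_s (fun _ _ t ht => hph t ht) e
  have hadd : ∀ {q μ : Space → ℝ} {t : ℝ} {x : Space}, x ∈ D.Ω → DifferentiableAt ℝ q x →
      DifferentiableAt ℝ μ x → (∀ y ∈ D.Ω, p t y = q y + μ y) →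
      gradient (p t) x = gradient q x + gradient μ x := by
    intro q μ t x hx hq hμ h
    ext i
    simp only [PiLp.add_apply, gradient_apply]
    rw [← pd_add hq hμ]
    refine pd_congr ?_
    filter_upwards [D.Ω_open.mem_nhds hx] with y hy using h y hy
  have hpf : ∀ t ∈ Ioo 0 D.T, ∀ x ∈ D.Ω,
      gradient (p t) x = gradient (e.pF (F t)) x + gradient (μf t) x := fun t ht x hx =>
    hadd hx (differentiableAt_of_smooth (((f1.smoothIn h01 t ht x hx).slice.pow 2).mul
      (f4.smoothIn h01 t ht x hx).slice)) (hμf t ht x hx).dx fun y hy => (hp t ht y hy).1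
  have hps : ∀ t ∈ Ioo 0 D.T, ∀ x ∈ D.Ω,
      gradient (p t) x = gradient (e.pS (F t)) x + gradient (μs t) x := fun t ht x hx =>
    hadd hx (differentiableAt_of_smooth (((s1.smoothIn h01 t ht x hx).slice.pow 2).mul
      (s4.smoothIn h01 t ht x hx).slice)) (hμs t ht x hx).dx fun y hy => (hp t ht y hy).2
  constructor
  · intro h
    refine ⟨fun t ht x hx => ?_, fun t ht x hx => ?_⟩
    · have h1 := e.fluid_balance hF hph hk ht hx
      rw [h.fluid t ht x hx] at h1
      rw [hpf t ht x hx, smul_add ((F t).φ x) (gradient (e.pF (F t)) x)]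
      refine (eq_sub_of_add_eq h1.symm).trans ?_
      abel
    · have h1 := e.solid_balance hF hph hk ht hx
      rw [h.solid t ht x hx] at h1
      rw [hps t ht x hx, smul_add (1 - (F t).φ x) (gradient (e.pS (F t)) x)]
      refine (eq_sub_of_add_eq (eq_add_of_sub_eq h1.symm)).trans ?_
      abel
  · intro h
    refine ⟨fun t ht x hx => ?_, fun t ht x hx => ?_, fun t ht x hx => ?_⟩
    · have h1 := e.fluid_balance hF hph hk ht hx
      rw [h.fluid t ht x hx, hpf t ht x hx, smul_add] at h1
      refine (eq_add_of_sub_eq h1).trans ?_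
      abel
    · have h1 := e.solid_balance hF hph hk ht hx
      rw [h.solid t ht x hx, hps t ht x hx, smul_add] at h1
      refine (eq_add_of_sub_eq (eq_sub_of_add_eq (eq_sub_of_add_eq h1))).trans ?_
      abel
    · have h1 := hp t ht x hx
      change e.pF (F t) x - e.pS (F t) x + μf t x - μs t x = 0
      linarith [h1.1, h1.2]

/-- The condition from `δφ` says that the two expressions of the pressure agree. -/
theorem GeneralMomentum.pressureCondition {μf μs : ℝ → Space → ℝ} {Ff Fs : ℝ → Space → Space}
    (h : GeneralMomentum D F (fun t => e.dLagrangian (F t)) μf μs Ff Fs) :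
    PressureCondition D e F μf μs (fun t x => e.pF (F t) x + μf t x) := by
  intro t ht x hx
  have h1 : e.pF (F t) x - e.pS (F t) x + μf t x - μs t x = 0 := h.fraction t ht x hx
  exact ⟨rfl, by linarith⟩

theorem Config.IsAdmissible.smooth_physical {c : Config} (hc : c.IsAdmissible D)
    {sf ss : ℝ → Space → ℝ} (hsf : SmoothST D.T D.Ω sf) (hss : SmoothST D.T D.Ω ss) :
    SmoothFamily 1 D.T D.Ω (fun _ t => c.state D sf ss t) ∧
      ∀ t ∈ Icc 0 D.T, (c.state D sf ss t).IsPhysical D.Ω :=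
  ⟨hc.const.smoothFamily (sf := fun _ => sf) (ss := fun _ => ss)
    (fun _ _ t ht x hx => SmoothAt₃.of_smoothAt (hsf t ht x hx))
    (fun _ _ t ht x hx => SmoothAt₃.of_smoothAt (hss t ht x hx)),
    fun _ ht => hc.isPhysical ht _ _⟩

/-- For the porous media Lagrangian the general system is the system with the pressure. -/
theorem generalSystem_iff_incompressibleSystem {c : Config} (hc : c.IsAdmissible D)
    {ff fs : ℝ → Space → Space} :
    GeneralSystem D k e.dLagrangian ff fs c ↔ IncompressibleSystem D k e ff fs c := by
  have h01 := hc.const.zero_mem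
  obtain ⟨hF, hph⟩ := hc.smooth_physical
    ((hc.const.family_f.smooth_pushDensity D.sf0_smooth).slice h01)
    ((hc.const.family_s.smooth_pushDensity D.ss0_smooth).slice h01)
  have hμf := hc.μf_smooth.smoothIn
  have hμs := hc.smoothIn_solid k
  constructor
  · intro h
    have hp := h.momentum.pressureCondition
    exact ⟨_, hp, ⟨(hp.momentum_iff hF hph h.kinematic hμf hμs).1 h.momentum, h.kinematic,
      h.entropy⟩, h.volume⟩
  · rintro ⟨p, hp, h, hv⟩
    exact ⟨(hp.momentum_iff hF hph h.kinematic hμf hμs).2 h.momentum, h.kinematic, h.entropy, hv⟩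

/-- For the porous media Lagrangian the general system with irreversible processes is the system
with the pressure and the temperatures. -/
theorem generalThermoSystem_iff_incompressibleThermoSystem {c : ThermoConfig}
    (hc : c.IsAdmissible D) {R : Friction} :
    GeneralThermoSystem D k e.dLagrangian R c ↔ IncompressibleThermoSystem D k e R c := by
  obtain ⟨hF, hph⟩ := hc.config.smooth_physical hc.sf_smooth hc.ss_smooth
  have hμf := hc.config.μf_smooth.smoothIn
  have hμs := hc.config.smoothIn_solid k
  have tf : ∀ t x, (e.dLagrangian (c.thermoState D t)).sf x = -e.tempF (c.thermoState D t) x :=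
    fun _ _ => rfl
  have ts : ∀ t x, (e.dLagrangian (c.thermoState D t)).ss x = -e.tempS (c.thermoState D t) x :=
    fun _ _ => rfl
  constructor
  · intro h
    have hp := h.momentum.pressureCondition
    refine ⟨⟨_, hp, ⟨(hp.momentum_iff hF hph h.kinematic hμf hμs).1 h.momentum, h.kinematic,
      fun t ht x hx => ?_, fun t ht x hx => ?_⟩, h.volume⟩, fun t ht x hx =>
      ⟨h.generated_f t ht x hx, h.generated_s t ht x hx, ?_, ?_⟩⟩
    · have h1 := h.entropy_f t ht x hx
      rw [tf, ts] at h1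
      change e.tempF (c.thermoState D t) x * Dbar c.uf c.sf t x
        = -inner ℝ (R.ff t x) (c.uf t x) + contract (R.τf t x) (gradV (c.uf t) x) - _
      linear_combination -h1
    · have h1 := h.entropy_s t ht x hx
      rw [tf, ts] at h1
      change e.tempS (c.thermoState D t) x * Dbar c.us c.ss t x
        = -inner ℝ (R.fs t x) (c.us t x) + contract (R.τs t x) (gradV (c.us t) x) - _
      linear_combination -h1
    · rw [h.displacement_f t ht x hx, tf, neg_neg]
    · rw [h.displacement_s t ht x hx, ts, neg_neg]
  · rintro ⟨⟨p, hp, h, hv⟩, hg⟩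
    refine ⟨(hp.momentum_iff hF hph h.kinematic hμf hμs).2 h.momentum, h.kinematic,
      fun t ht x hx => ?_, fun t ht x hx => ?_, fun t ht x hx => (hg t ht x hx).1,
      fun t ht x hx => (hg t ht x hx).2.1, fun t ht x hx => ?_, fun t ht x hx => ?_, hv⟩
    · have h1 : e.tempF (c.thermoState D t) x * Dbar c.uf c.sf t x
        = -inner ℝ (R.ff t x) (c.uf t x) + contract (R.τf t x) (gradV (c.uf t) x) - _ :=
        h.entropy_f t ht x hx
      rw [tf, ts]
      linear_combination -h1
    · have h1 : e.tempS (c.thermoState D t) x * Dbar c.us c.ss t x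
        = -inner ℝ (R.fs t x) (c.us t x) + contract (R.τs t x) (gradV (c.us t) x) - _ :=
        h.entropy_s t ht x hx
      rw [tf, ts]
      linear_combination -h1
    · rw [(hg t ht x hx).2.2.1, tf, neg_neg]
    · rw [(hg t ht x hx).2.2.2, ts, neg_neg]

end

end

end PorousMedia

theorem mainTheorem3 (D : PorousMedia.Setup) :
    -- the variation of the constraint terms
    (∀ (a : ℝ) (c : ℝ → PorousMedia.Config), PorousMedia.IsVariation D a c →
      ∀ t ∈ Set.Icc 0 D.T, ∀ x ∈ D.Ω,
        HasDerivAt (fun ε => PorousMedia.pushDensity (c ε).ψf D.φf0 t x)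
          (-PorousMedia.divv (fun y => PorousMedia.pushDensity (c 0).ψf D.φf0 t y •
            PorousMedia.etaF c t y) x) 0 ∧
        HasDerivAt (fun ε => PorousMedia.pushDensity (c ε).ψs (fun X => 1 - D.φs0 X) t x)
          (-PorousMedia.divv (fun y => PorousMedia.pushDensity (c 0).ψs (fun X => 1 - D.φs0 X) t y •
            PorousMedia.etaS c t y) x) 0 ∧
        ((∀ y ∈ D.Ω, (c 0).φ t y = PorousMedia.pushDensity (c 0).ψf D.φf0 t y) →
          HasDerivAt (fun ε => PorousMedia.pushDensity (c ε).ψf D.φf0 t x)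
            (-PorousMedia.divv (fun y => (c 0).φ t y • PorousMedia.etaF c t y) x) 0) ∧
        ((∀ y ∈ D.Ω, 1 - (c 0).φ t y
              = PorousMedia.pushDensity (c 0).ψs (fun X => 1 - D.φs0 X) t y) →
          HasDerivAt (fun ε => PorousMedia.pushDensity (c ε).ψs (fun X => 1 - D.φs0 X) t x)
            (-PorousMedia.divv (fun y => (1 - (c 0).φ t y) • PorousMedia.etaS c t y) x) 0)) ∧
    -- advected entropies, general Lagrangian
    (∀ (l : PorousMedia.Fields → ℝ) (dl : PorousMedia.Fields → PorousMedia.Fields),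
      PorousMedia.IsFunctionalDeriv D.T D.Ω l dl →
      ∀ (k : PorousMedia.Incompressible) (ff fs : ℝ → PorousMedia.Space → PorousMedia.Space),
      PorousMedia.SmoothST D.T D.Ω ff → PorousMedia.SmoothST D.T D.Ω fs →
      ∀ c : PorousMedia.Config, c.IsAdmissible D →
        (∀ bc, PorousMedia.IsCritical D k bc l ff fs c →
          PorousMedia.GeneralSystem D k dl ff fs c) ∧
        (PorousMedia.GeneralSystem D k dl ff fs c →
          PorousMedia.IsCritical D k .interior l ff fs c)) ∧
    -- the functional derivatives of the porous media Lagrangian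
    (∀ e : PorousMedia.Energies,
      PorousMedia.IsFunctionalDeriv D.T D.Ω (e.lagrangian D.Ω) e.dLagrangian) ∧
    -- advected entropies, porous media Lagrangian
    (∀ (e : PorousMedia.Energies) (k : PorousMedia.Incompressible)
      (ff fs : ℝ → PorousMedia.Space → PorousMedia.Space),
      PorousMedia.SmoothST D.T D.Ω ff → PorousMedia.SmoothST D.T D.Ω fs →
      ∀ c : PorousMedia.Config, c.IsAdmissible D →
        (∀ bc, PorousMedia.IsCritical D k bc (e.lagrangian D.Ω) ff fs c →
          PorousMedia.IncompressibleSystem D k e ff fs c) ∧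
        (PorousMedia.IncompressibleSystem D k e ff fs c →
          PorousMedia.IsCritical D k .interior (e.lagrangian D.Ω) ff fs c)) ∧
    -- irreversible processes, general Lagrangian with nonvanishing temperatures
    (∀ (l : PorousMedia.Fields → ℝ) (dl : PorousMedia.Fields → PorousMedia.Fields),
      PorousMedia.IsFunctionalDeriv D.T D.Ω l dl →
      ∀ (k : PorousMedia.Incompressible) (R : PorousMedia.Friction), R.IsSmooth D →
      ∀ c : PorousMedia.ThermoConfig, c.IsAdmissible D →
        (∀ t ∈ Set.Ioo 0 D.T, ∀ x ∈ D.Ω,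
          (dl (c.thermoState D t)).sf x ≠ 0 ∧ (dl (c.thermoState D t)).ss x ≠ 0) →
        (∀ bc, PorousMedia.IsThermoCritical D k bc l dl R c →
          PorousMedia.GeneralThermoSystem D k dl R c) ∧
        (PorousMedia.GeneralThermoSystem D k dl R c →
          PorousMedia.IsThermoCritical D k .interior l dl R c)) ∧
    -- irreversible processes, porous media Lagrangian with nonvanishing temperatures
    (∀ (e : PorousMedia.Energies) (k : PorousMedia.Incompressible) (R : PorousMedia.Friction),
      R.IsSmooth D →
      ∀ c : PorousMedia.ThermoConfig, c.IsAdmissible D →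
        (∀ t ∈ Set.Ioo 0 D.T, ∀ x ∈ D.Ω,
          e.tempF (c.thermoState D t) x ≠ 0 ∧ e.tempS (c.thermoState D t) x ≠ 0) →
        (∀ bc, PorousMedia.IsThermoCritical D k bc (e.lagrangian D.Ω) e.dLagrangian R c →
          PorousMedia.IncompressibleThermoSystem D k e R c) ∧
        (PorousMedia.IncompressibleThermoSystem D k e R c →
          PorousMedia.IsThermoCritical D k .interior (e.lagrangian D.Ω) e.dLagrangian R c)) := by
  refine ⟨fun a c h t ht x hx => ?_, fun l dl hl k ff fs hff hfs c hc => ?_,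
    fun e => e.isFunctionalDeriv D, fun e k ff fs hff hfs c hc => ?_,
    fun l dl hl k R hR c hc hT => ?_, fun e k R hR c hc hT => ?_⟩
  · have hF := h.family_f.hasDerivAt_pushDensity h.zero_mem ht hx D.φf0_smooth
    have hS := h.family_s.hasDerivAt_pushDensity h.zero_mem ht hx D.one_sub_φs0_smooth
    refine ⟨hF, hS, fun hφ => ?_, fun hφ => ?_⟩
    · rw [PorousMedia.divv_congr D.Ω_open (fun y hy => by rw [hφ y hy]) hx]
      exact hF
    · rw [PorousMedia.divv_congr D.Ω_open (fun y hy => by rw [hφ y hy]) hx]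
      exact hS
  · exact ⟨fun bc h => h.generalSystem hl hff hfs hc, fun h => h.isCritical hl hff hfs⟩
  · have hl := e.isFunctionalDeriv D
    have hiff := PorousMedia.generalSystem_iff_incompressibleSystem (e := e) (k := k) (ff := ff)
      (fs := fs) hc
    exact ⟨fun bc h => hiff.1 (h.generalSystem hl hff hfs hc),
      fun h => (hiff.2 h).isCritical hl hff hfs⟩
  · exact ⟨fun bc h => h.generalThermoSystem hl hR hc hT,
      fun h => h.isThermoCritical hl hR hc⟩
  · have hl := e.isFunctionalDeriv D
    have hiff := PorousMedia.generalThermoSystem_iff_incompressibleThermoSystem (e := e) (k := k)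
      (R := R) hc
    -- `δℓ/δs_k = -T_k`
    exact ⟨fun bc h => hiff.1 (h.generalThermoSystem hl hR hc fun t ht x hx =>
        ⟨neg_ne_zero.2 (hT t ht x hx).1, neg_ne_zero.2 (hT t ht x hx).2⟩),
      fun h => (hiff.2 h).isThermoCritical hl hR hc⟩
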